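/- Let $m,n,s,k,\alpha,t,\lambda$ be positive integers with $\alpha\mid 2nk$, $t\mid \frac{2nk}{\alpha}$ and $\lambda\mid t$, and put $v'=\frac{2nk}{\alpha}+t$ and $v=\frac{2nk}{\alpha\lambda}+\frac t\lambda=\frac{v'}{\lambda}$. An $^{\alpha}\mathrm H_t(m,n;s,k)$ is an $m\times n$ array $A=(a_c)$ with entries in $\mathbb Z_{v'}$, some cells possibly being empty, such that each row has $s$ and each column has $k$ filled cells, each element of $\mathbb Z_{v'}$ outside the subgroup of order $t$ occurs $\alpha$ times in the multiset of all $\pm a_c$, and every row and column sums to $0$. Let $A$ be an $^{\alpha}\mathrm H_t(m,n;s,k)$ and let $B=(b_c)$, $b_c=\pi(a_c)$, be the array obtained by applying the natural projection $\pi:\mathbb Z_{v'}\to\mathbb Z_v$ to the entries of $A$. Let $\alpha_r$ (resp. $\alpha_c$) be a permutation of the filled cells that permutes the filled cells of each row (resp. column) cyclically. Suppose that for $B$ the corresponding orderings are simple (the partial sums $s_1,\dots,s_l$ of the entries of any row or column, of $l$ filled cells, taken in this cyclic order, are pairwise distinct) and compatible ($\alpha_c\circ\alpha_r$ is a single cycle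 on all filled cells). Let $\Gamma_A$ be the multigraph with vertex set $\mathbb Z_{v'}$ and with a directed edge $(x,c,\varepsilon)$ from $x$ to $x+\varepsilon a_c$ for all $x\in\mathbb Z_{v'}$, all filled cells $c$ and $\varepsilon=\pm1$, the reverse $\tau$ of $(x,c,\varepsilon)$ being $(x+\varepsilon a_c,c,-\varepsilon)$; define $\Gamma_B$ in the same way over $\mathbb Z_v$. Let $\rho_A$ be the permutation of the directed edges of $\Gamma_A$ with $(x,c,1)\mapsto(x,\alpha_r(c),-1)$ and $(x,c,-1)\mapsto(x,\alpha_c(c),1)$, and define $\rho_B$ in the same way. A biembedding of $\Gamma_A$ associated to $\alpha_r,\alpha_c$ is a cellular embedding $\sigma'$ of $\Gamma_A$ into a closed connected orientable surface which corresponds to the rotation $\rho_A$ (its faces are open discs whose boundary walks are the orbits of $\rho_A\circ\tau$), and whose faces are properly $2$-colourable so that the boundaries of the faces of one colour are the $s$-cycles of the decomposition of $\Gamma_A$ formed by the cycles $(x,x+s_1,x+s_2,\dots)$, $x\in\mathbb Z_{v'}$, where $s_1,s_2,\dots$ are the partial sums along the cycles of $\alpha_r^{-1}$, and those of the other colour are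 the $k$-cycles of the decomposition obtained in this way from $\alpha_c$. Define biembeddings of $\Gamma_B$ associated to $\alpha_r,\alpha_c$ in the same way. Then $B$ is an $^{\alpha\lambda}\mathrm H_{t/\lambda}(m,n;s,k)$; $\Gamma_A$ is the multigraph $^{\alpha}K_{(\frac{2nk}{\alpha t}+1)\times t}$ (the complete multipartite graph with $\frac{2nk}{\alpha t}+1$ parts of size $t$, each edge repeated $\alpha$ times) and $\Gamma_B$ is $^{\alpha\lambda}K_{(\frac{2nk}{\alpha t}+1)\times \frac t\lambda}$; the map $\pi:\Gamma_A\to\Gamma_B$, $(x,c,\varepsilon)\mapsto(\pi(x),c,\varepsilon)$, is a covering of multigraphs; and $\Gamma_B$ has a biembedding associated to $\alpha_r,\alpha_c$. Moreover, for every biembedding $\sigma:\Gamma_B\to\Sigma$ associated to $\alpha_r,\alpha_c$ there is a biembedding $\sigma':\Gamma_A\to\Sigma'$ associated to $\alpha_r,\alpha_c$ into a closed connected orientable surface $\Sigma'$, and a covering map $p:\Sigma'\to\Sigma$ (continuous, surjective, every point of $\Sigma$ being evenly covered) such that $p\circ\sigma'=\sigma\circ\pi$. -/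

import Mathlib

open Equiv (Perm)

namespace Heffter

noncomputable section

/-! ### Closed orientable surfaces -/

/-- A closed orientable surface: a nonempty connected compact Hausdorff space that carries an atlas
of charts onto open subsets of the plane whose transition maps are smooth with positive Jacobian
determinant. (Every topological surface is smoothable, so asking for smooth transition maps loses
nothing.) -/
structure IsClosedOrientableSurface (S : Type*) [TopologicalSpace S] : Prop where
  t2 : T2Space S
  compact : CompactSpace S
  connected : ConnectedSpace S
  oriented_atlas : ∃ atlas : Set (OpenPartialHomeomorph S ℂ),
    (∀ x, ∃ φ ∈ atlas, x ∈ φ.source) ∧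
    ∀ φ ∈ atlas, ∀ ψ ∈ atlas,
      ContDiffOn ℝ ((⊤ : ℕ∞) : WithTop ℕ∞) (φ.symm.trans ψ) (φ.symm.trans ψ).source ∧
      ∀ z ∈ (φ.symm.trans ψ).source, 0 < (fderiv ℝ (φ.symm.trans ψ) z).det

/-! ### Multigraphs -/

/-- A multigraph, given by its vertices and its directed edges; `rev` is the involution exchanging
the two directions `e⁺`, `e⁻` of every edge, so an (undirected) edge is a pair `{d, rev d}`. -/
structure Multigraph where
  V : Type
  D : Type
  tail : D → V
  rev : D → D
  rev_rev : ∀ d, rev (rev d) = d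
  rev_ne : ∀ d, rev d ≠ d

namespace Multigraph

variable (Γ : Multigraph)

/-- The end point of a directed edge. -/
def head (d : Γ.D) : Γ.V := Γ.tail (Γ.rev d)

/-- The permutation of the directed edges reversing every edge. -/
def revPerm : Perm Γ.D := Function.Involutive.toPerm Γ.rev Γ.rev_rev

/-- `Γ` is the multigraph obtained from the complete multipartite graph with `q` parts of size `r`
by repeating every edge `lam` times. -/
def IsCompleteMultipartite (lam q r : ℕ) : Prop :=
  ∃ part : Γ.V → Fin q, (∀ i, Nat.card {x // part x = i} = r) ∧
    ∀ x y, (part x = part y → IsEmpty {d // Γ.tail d = x ∧ Γ.head d = y}) ∧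
      (part x ≠ part y → Nat.card {d // Γ.tail d = x ∧ Γ.head d = y} = lam)

/-- Gluing relation of the topological realization: `(d, 0)` is the tail of `d`, and `(d, s)` is the
same point as `(rev d, 1 - s)`. -/
inductive Glue : (Σ _ : Γ.V, PUnit.{1}) ⊕ (Σ _ : Γ.D, unitInterval) →
    (Σ _ : Γ.V, PUnit.{1}) ⊕ (Σ _ : Γ.D, unitInterval) → Prop
  | tail (d : Γ.D) : Glue (Sum.inr ⟨d, 0⟩) (Sum.inl ⟨Γ.tail d, PUnit.unit⟩)
  | rev (d : Γ.D) (s : unitInterval) :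
      Glue (Sum.inr ⟨d, s⟩) (Sum.inr ⟨Γ.rev d, unitInterval.symm s⟩)

/-- The multigraph as a topological space: a discrete set of vertices together with one copy of
the unit interval for every edge, glued at the end points, with the quotient topology. -/
def Realization : Type := Quot Γ.Glue

instance : TopologicalSpace Γ.Realization :=
  inferInstanceAs (TopologicalSpace (Quot Γ.Glue))

variable {Γ}

/-- The point of the realization at parameter `s` on the directed edge `d`. -/
def point (d : Γ.D) (s : unitInterval) : Γ.Realization := Quot.mk _ (Sum.inr ⟨d, s⟩)

/-- A homomorphism of multigraphs. -/
structure Hom (Γ' Γ : Multigraph) where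
  onV : Γ'.V → Γ.V
  onD : Γ'.D → Γ.D
  tail_onD : ∀ d, Γ.tail (onD d) = onV (Γ'.tail d)
  rev_onD : ∀ d, Γ.rev (onD d) = onD (Γ'.rev d)

/-- The map induced by a homomorphism on the topological realizations. -/
def Hom.realize {Γ' Γ : Multigraph} (π : Hom Γ' Γ) : Γ'.Realization → Γ.Realization :=
  Quot.map (Sum.map (fun x => ⟨π.onV x.1, PUnit.unit⟩) (fun e => ⟨π.onD e.1, e.2⟩)) (by
    intro a b h
    cases h with
    | tail d =>
      have := Glue.tail (Γ := Γ) (π.onD d)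
      rw [π.tail_onD] at this
      exact this
    | rev d s =>
      have := Glue.rev (Γ := Γ) (π.onD d) s
      rw [π.rev_onD] at this
      exact this)

/-- A covering of multigraphs: a surjective homomorphism mapping the edges at every vertex `x`
one-to-one onto the edges at the image of `x`. -/
def Hom.IsCovering {Γ' Γ : Multigraph} (π : Hom Γ' Γ) : Prop :=
  Function.Surjective π.onV ∧ Function.Surjective π.onD ∧
    ∀ x, Set.BijOn π.onD {d | Γ'.tail d = x} {d | Γ.tail d = π.onV x}

/-- `C` is (the set of directed edges, in both directions, of) a cycle of length `l`. -/
def IsCycle (l : ℕ) (C : Set Γ.D) : Prop :=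
  2 ≤ l ∧ ∃ w : ZMod l → Γ.D,
    (∀ i, Γ.head (w i) = Γ.tail (w (i + 1))) ∧
    Function.Injective (fun i => Γ.tail (w i)) ∧
    (∀ i j, w i ≠ Γ.rev (w j)) ∧
    C = Set.range w ∪ Set.range (fun i => Γ.rev (w i))

/-- A decomposition of `Γ` into cycles of length `l`: every edge is in exactly one of the cycles. -/
def IsCycleDecomposition (l : ℕ) (𝒟 : Set (Set Γ.D)) : Prop :=
  (∀ C ∈ 𝒟, IsCycle l C) ∧ ∀ d : Γ.D, ∃! C, C ∈ 𝒟 ∧ d ∈ C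

/-- A rotation: a permutation acting cyclically on the directed edges out of every vertex. -/
def IsRotation (ρ : Perm Γ.D) : Prop :=
  ∀ d d', ρ.SameCycle d d' ↔ Γ.tail d = Γ.tail d'

/-! ### Embeddings -/

variable {S : Type*} [TopologicalSpace S]

/-- The faces of `σ`: the connected components of the complement of the embedded multigraph. -/
def faces (σ : Γ.Realization → S) : Set (Set S) :=
  {F | ∃ x ∈ (Set.range σ)ᶜ, F = connectedComponentIn (Set.range σ)ᶜ x}

/-- The directed edges (in both directions) lying on the topological boundary of `F`. -/
def boundaryEdges (σ : Γ.Realization → S) (F : Set S) : Set Γ.D :=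
  {d | ∀ s, σ (point d s) ∈ frontier F}

/-- The boundary of `F` is the closed walk `d, φ d, φ² d, …`: there is a map of the closed unit disc
to the surface which maps the open disc bijectively onto `F` and which runs, along the unit
circle, through the edges of the walk one after the other. -/
def IsBoundaryWalk (σ : Γ.Realization → S) (F : Set S) (φ : Perm Γ.D) (d : Γ.D) : Prop :=
  ∃ χ : ℂ → S, ContinuousOn χ (Metric.closedBall 0 1) ∧ Set.BijOn χ (Metric.ball 0 1) F ∧
    ∀ (j : ℕ) (s : unitInterval),
      χ (Complex.exp (2 * Real.pi * Complex.I * ((j + (s : ℝ) : ℝ) : ℂ) /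
        (Function.minimalPeriod φ d : ℂ))) = σ (point ((φ ^ j) d) s)

/-- `σ` is a cellular embedding corresponding to the rotation `ρ`: its faces are open discs, and they
correspond one-to-one to the orbits of `ρ ∘ rev`, each face being bounded by its orbit. -/
structure IsCellularEmbedding (ρ : Perm Γ.D) (σ : Γ.Realization → S) : Prop where
  rotation : IsRotation ρ
  continuous : Continuous σ
  injective : Function.Injective σ
  cellular : ∀ F ∈ faces σ, Nonempty (F ≃ₜ Metric.ball (0 : ℂ) 1)
  boundaries : ∃ face : Γ.D → Set S,
    Set.range face = faces σ ∧
    (∀ d d', face d = face d' ↔ (ρ * Γ.revPerm).SameCycle d d') ∧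
    ∀ d, IsBoundaryWalk σ (face d) (ρ * Γ.revPerm) d

/-- `σ` is a biembedding of the decompositions `𝒟` (into `l`-cycles) and `𝒟'` (into `l'`-cycles):
an embedding whose faces can be coloured with two colours, faces with a common edge having
different colours, such that the boundaries of the faces of the first colour are the cycles in
`𝒟` and those of the second colour are the cycles in `𝒟'`. -/
structure IsBiembedding (l l' : ℕ) (𝒟 𝒟' : Set (Set Γ.D)) (σ : Γ.Realization → S) : Prop where
  decomposition : IsCycleDecomposition l 𝒟
  decomposition' : IsCycleDecomposition l' 𝒟'
  continuous : Continuous σ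
  injective : Function.Injective σ
  frontier_eq : ∀ F ∈ faces σ,
    frontier F = {y | ∃ d ∈ boundaryEdges σ F, ∃ s, y = σ (point d s)}
  colouring : ∃ 𝓕 𝓕' : Set (Set S), 𝓕 ∪ 𝓕' = faces σ ∧ Disjoint 𝓕 𝓕' ∧
    𝓕.PairwiseDisjoint (boundaryEdges σ) ∧ 𝓕'.PairwiseDisjoint (boundaryEdges σ) ∧
    Set.BijOn (boundaryEdges σ) 𝓕 𝒟 ∧ Set.BijOn (boundaryEdges σ) 𝓕' 𝒟'

end Multigraph

/-! ### Partially filled arrays and Heffter arrays -/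

/-- An `m × n` partially filled array: the set of filled cells, and their entries. -/
structure PFArray (m n : ℕ) (G : Type) where
  skel : Finset (Fin m × Fin n)
  entry : skel → G

/-- The array obtained by applying a homomorphism to all entries. -/
def PFArray.map {m n : ℕ} {G H : Type} [AddCommGroup G] [AddCommGroup H] (f : G →+ H)
    (A : PFArray m n G) : PFArray m n H where
  skel := A.skel
  entry := fun c => f (A.entry c)

/-- The order `v = 2nk/λ + t` of the cyclic group underlying a `λ`-fold Heffter array. -/
abbrev order (n k lam t : ℕ) : ℕ := 2 * n * k / lam + t

/-- `A` is a `λ`-fold Heffter array over `ℤ_v` relative to its subgroup of order `t`, with `s` filled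
cells in each row and `k` filled cells in each column. -/
structure IsHeffterArray (lam t s k : ℕ) {m n : ℕ} (A : PFArray m n (ZMod (order n k lam t))) :
    Prop where
  n_pos : 0 < n
  k_pos : 0 < k
  lam_pos : 0 < lam
  t_pos : 0 < t
  lam_dvd : lam ∣ 2 * n * k
  t_dvd : t ∣ 2 * n * k / lam
  row_card : ∀ i, (A.skel.filter (fun c => c.1 = i)).card = s
  col_card : ∀ j, (A.skel.filter (fun c => c.2 = j)).card = k
  count : ∀ x : ZMod (order n k lam t),
    x ∉ AddSubgroup.zmultiples ((order n k lam t / t : ℕ) : ZMod (order n k lam t)) →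
      (Finset.univ.filter (fun c => A.entry c = x)).card +
        (Finset.univ.filter (fun c => -A.entry c = x)).card = lam
  row_sum : ∀ i, ∑ c with c.1.1 = i, A.entry c = 0
  col_sum : ∀ j, ∑ c with c.1.2 = j, A.entry c = 0

theorem order_dvd {n k lam t l : ℕ} (ht : t ∣ 2 * n * k / lam) (hl : l ∣ t) :
    order n k (lam * l) (t / l) ∣ order n k lam t := by
  refine ⟨l, ?_⟩
  unfold order
  rw [← Nat.div_div_eq_div_mul, add_mul, Nat.div_mul_cancel (hl.trans ht), Nat.div_mul_cancel hl]

/-- The natural projection `ℤ_{2nk/α + t} → ℤ_{2nk/(αλ) + t/λ}`. -/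
def proj {n k lam t l : ℕ} (ht : t ∣ 2 * n * k / lam) (hl : l ∣ t) :
    ZMod (order n k lam t) →+ ZMod (order n k (lam * l) (t / l)) :=
  (ZMod.castHom (order_dvd ht hl) (ZMod (order n k (lam * l) (t / l)))).toAddMonoidHom

section orderings

variable {m n : ℕ} {G : Type} [AddCommGroup G]

/-- The sum of the first `j` entries, starting at the cell `c` and following the permutation `a`. -/
def PFArray.partialSum (A : PFArray m n G) (a : Perm A.skel) (c : A.skel) (j : ℕ) : G :=
  ∑ i ∈ Finset.range j, A.entry ((a ^ i) c)

/-- The orderings given by the cycles of `a` are simple: their partial sums `s₁, …, s_l` are pairwise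
distinct, `l` being the length of the cycle. -/
def PFArray.IsSimple (A : PFArray m n G) (a : Perm A.skel) : Prop :=
  ∀ c, Set.InjOn (A.partialSum a c) (Set.Icc 1 (Function.minimalPeriod a c))

/-- `αr` and `αc` give simple and compatible orderings of `A`: `αr` permutes the filled cells of each
row cyclically, `αc` those of each column, all these orderings are simple, and `αc ∘ αr` is a
single cycle on the filled cells. -/
structure PFArray.SimpleCompatible (A : PFArray m n G) (αr αc : Perm A.skel) : Prop where
  rows : ∀ c d, αr.SameCycle c d ↔ c.1.1 = d.1.1
  cols : ∀ c d, αc.SameCycle c d ↔ c.1.2 = d.1.2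
  simple_rows : A.IsSimple αr
  simple_cols : A.IsSimple αc
  compatible : (αc * αr).IsCycleOn Set.univ

/-! ### The embedding of the multigraph of an array -/

/-- The multigraph of an array `A = (a_c)`: for all `x ∈ G`, every filled cell `c` and `ε = ±1`
there is a directed edge `(x, c, ε)` from `x` to `x + ε a_c`, the reverse of which is
`(x + ε a_c, c, -ε)`. -/
def PFArray.graph (A : PFArray m n G) : Multigraph where
  V := G
  D := G × A.skel × ℤˣ
  tail := fun d => d.1
  rev := fun d => (d.1 + (d.2.2 : ℤ) • A.entry d.2.1, d.2.1, -d.2.2)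
  rev_rev := by
    rintro ⟨x, c, ε⟩
    simp
  rev_ne := by
    rintro ⟨x, c, ε⟩ h
    have h2 : -ε = ε := congrArg (fun d => d.2.2) h
    rcases Int.units_eq_one_or ε with rfl | rfl <;> exact absurd h2 (by decide)

/-- The rotation of the multigraph of `A` given by `(x, c, 1) ↦ (x, αr c, -1)` and
`(x, c, -1) ↦ (x, αc c, 1)`. -/
def PFArray.rotation (A : PFArray m n G) (αr αc : Perm A.skel) : Perm A.graph.D where
  toFun := fun d => if d.2.2 = 1 then (d.1, αr d.2.1, -1) else (d.1, αc d.2.1, 1)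
  invFun := fun d => if d.2.2 = 1 then (d.1, αc.symm d.2.1, -1) else (d.1, αr.symm d.2.1, 1)
  left_inv := by
    rintro ⟨x, c, ε⟩
    rcases Int.units_eq_one_or ε with rfl | rfl <;> simp [show (-1 : ℤˣ) ≠ 1 by decide] <;> rfl
  right_inv := by
    rintro ⟨x, c, ε⟩
    rcases Int.units_eq_one_or ε with rfl | rfl <;> simp [show (-1 : ℤˣ) ≠ 1 by decide] <;> rfl

/-- The cycles `(x, x + s₁, x + s₂, …)` with `s_j` the partial sums of the orderings given by the
cycles of `a`, and `x ∈ G`; each is given by its directed edges, in both directions. -/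
def PFArray.cycles (A : PFArray m n G) (a : Perm A.skel) : Set (Set A.graph.D) :=
  {C | ∃ (x : G) (c : A.skel), C = {d | ∃ j : ℕ,
    d = (x + A.partialSum a c j, (a ^ j) c, 1) ∨
    d = A.graph.rev (x + A.partialSum a c j, (a ^ j) c, 1)}}

/-- `σ` is a biembedding associated to the row orderings `αr` and column orderings `αc` of `A`: a
cellular embedding corresponding to the rotation given by `αr` and `αc`, which is a biembedding
of the cycle decompositions obtained from `αr⁻¹` and `αc`. -/
structure PFArray.IsAssociatedBiembedding (A : PFArray m n G) (s k : ℕ) (αr αc : Perm A.skel)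
    {S : Type*} [TopologicalSpace S] (σ : A.graph.Realization → S) : Prop where
  cellular : Multigraph.IsCellularEmbedding (A.rotation αr αc) σ
  biembedding : Multigraph.IsBiembedding s k (A.cycles αr⁻¹) (A.cycles αc) σ

/-- The homomorphism `(x, c, ε) ↦ (f x, c, ε)` from the multigraph of an array to the multigraph of
its image under `f`. -/
def PFArray.graphProj {H : Type} [AddCommGroup H] (A : PFArray m n G) (f : G →+ H) :
    Multigraph.Hom A.graph (A.map f).graph where
  onV := f
  onD := fun d => (f d.1, d.2)
  tail_onD := fun _ => rfl
  rev_onD := by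
    rintro ⟨x, c, ε⟩
    simp [PFArray.graph, PFArray.map]

end orderings

/-- The array obtained from the Heffter array `A` by the natural projection of its entries. -/
abbrev IsHeffterArray.projection {m n s k lam t l : ℕ} {A : PFArray m n (ZMod (order n k lam t))}
    (hA : IsHeffterArray lam t s k A) (hl : l ∣ t) :
    PFArray m n (ZMod (order n k (lam * l) (t / l))) :=
  A.map (proj hA.t_dvd hl)

/-- The map of multigraphs induced by the natural projection. -/
abbrev IsHeffterArray.graphProjection {m n s k lam t l : ℕ}
    {A : PFArray m n (ZMod (order n k lam t))} (hA : IsHeffterArray lam t s k A) (hl : l ∣ t) :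
    Multigraph.Hom A.graph (hA.projection hl).graph :=
  A.graphProj (proj hA.t_dvd hl)

end

end Heffter

/-!
The surface of a rotation is obtained by gluing, for every face, a regular polygon to the graph;
here the polygon is the closed unit disc, and its boundary is divided into as many equal arcs as the
boundary walk has edges. At a vertex the faces of the two colours alternate. Hence the maps
`z ↦ z ^ l` on the `l`-gons of one colour and `z ↦ z ^ (-l)` on those of the other fit together to a
map to the Riemann sphere which is branched only at the vertices and at the centres of the faces,
and an atlas whose charts are roots of this map has holomorphic transition maps.

Rows and columns sum to zero, so the boundary walks close up after `s` or `k` edges, over `A` as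
over `B`; the simplicity of the orderings, which passes from `B` to `A`, says that they are cycles.
Since a face over `A` has as many edges as its image, the covering of graphs extends, by the
identity on each disc, to a covering of the surfaces that is unbranched also at the centres of the
faces. Finally, the surface of any cellular embedding with the same rotation is homeomorphic to the
glued one, compatibly with the embeddings: once the boundary parametrizations of its faces are
adjusted, it is glued from discs in the same way.
-/

namespace Heffter

noncomputable section

/-! ### Quotients, charts and oriented atlases -/

section topology

variable {X Y : Type*} [TopologicalSpace X] [TopologicalSpace Y] {f : X → Y}

theorem isClosedMap_of_isClosed_ker [CompactSpace X] (hf : Topology.IsQuotientMap f)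
    (hker : IsClosed {p : X × X | f p.1 = f p.2}) : IsClosedMap f := by
  intro C hC
  have hsat : f ⁻¹' (f '' C) = Prod.snd '' ({p : X × X | f p.1 = f p.2} ∩ Prod.fst ⁻¹' C) := by
    ext b
    constructor
    · rintro ⟨a, ha, hab⟩
      exact ⟨(a, b), ⟨hab, ha⟩, rfl⟩
    · rintro ⟨⟨a, b⟩, ⟨hab, ha⟩, rfl⟩
      exact ⟨a, ha, hab⟩
  rw [← hf.isClosed_preimage, hsat]
  exact isClosedMap_snd_of_compactSpace _ (hker.inter (hC.preimage continuous_fst))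

theorem t2Space_of_isClosedMap [NormalSpace X] [T1Space X] (hcont : Continuous f)
    (hsurj : Function.Surjective f) (hcl : IsClosedMap f) : T2Space Y := by
  have hfiber (y : Y) : IsClosed (f ⁻¹' {y}) := by
    obtain ⟨x, rfl⟩ := hsurj y
    rw [← Set.image_singleton]
    exact (hcl _ isClosed_singleton).preimage hcont
  refine t2Space_iff_disjoint_nhds.2 fun y y' hne => ?_
  refine Filter.disjoint_comap_iff hsurj |>.1 ?_
  exact (disjoint_nhdsSet_nhdsSet (hfiber y) (hfiber y')
    ((Set.disjoint_singleton.2 hne).preimage f)).mono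
      (isClosedMap_iff_comap_nhds_le.1 hcl) (isClosedMap_iff_comap_nhds_le.1 hcl)

theorem connectedComponentIn_eq_of_isOpen {U V : Set X} (hU : IsOpen U) (hV : IsOpen V)
    (hUV : Disjoint U V) (hconn : IsPreconnected U) {x : X} (hx : x ∈ U) :
    connectedComponentIn (U ∪ V) x = U := by
  refine Set.Subset.antisymm ?_ (hconn.subset_connectedComponentIn hx Set.subset_union_left)
  exact isPreconnected_connectedComponentIn.subset_left_of_subset_union hU hV hUV
    (connectedComponentIn_subset _ _) ⟨x, mem_connectedComponentIn (Or.inl hx), hx⟩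

theorem isLocalHomeomorph_of_charts {Z : Type*} [TopologicalSpace Z]
    (h : ∀ x, ∃ (e : OpenPartialHomeomorph X Z) (e' : OpenPartialHomeomorph Y Z), x ∈ e.source ∧
      e.target = e'.target ∧ ∀ z ∈ e.target, f (e.symm z) = e'.symm z) : IsLocalHomeomorph f := by
  refine IsLocalHomeomorph.mk _ fun x => ?_
  obtain ⟨e, e', hx, htarget, hf⟩ := h x
  have hsource : (e.trans e'.symm).source = e.source := by
    rw [OpenPartialHomeomorph.trans_source, e'.symm_source, ← htarget, Set.inter_eq_left]
    exact fun y hy => e.map_source hy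
  refine ⟨e.trans e'.symm, hsource.symm ▸ hx, fun y hy => ?_⟩
  rw [hsource] at hy
  rw [OpenPartialHomeomorph.coe_trans, Function.comp_apply, ← hf _ (e.map_source hy),
    e.left_inv hy]

theorem exists_openPartialHomeomorph_of_isCompact [Nonempty X] [T2Space Y] {K U : Set X}
    (hK : IsCompact K) (hU : IsOpen U) (hUK : U ⊆ K) (hf : ContinuousOn f K)
    (hinj : Set.InjOn f U) (hdisj : ∀ z ∈ K, f z ∈ f '' U → z ∈ U) (hopen : IsOpen (f '' U)) :
    ∃ e : OpenPartialHomeomorph Y X, e.source = f '' U ∧ e.target = U ∧ ∀ z, e.symm z = f z := by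
  let E : PartialEquiv X Y := hinj.toPartialEquiv
  have himage (W : Set X) :
      E.source.domRestrict E '' (Subtype.val ⁻¹' W) = f '' U ∩ (f '' (K \ (U ∩ W)))ᶜ := by
    ext y
    constructor
    · rintro ⟨⟨z, hz⟩, hzW, rfl⟩
      refine ⟨⟨z, hz, rfl⟩, ?_⟩
      rintro ⟨z', ⟨hz'K, hz'⟩, h⟩
      obtain rfl : z' = z := hinj (hdisj z' hz'K ⟨z, hz, h.symm⟩) hz h
      exact hz' ⟨hz, hzW⟩
    · rintro ⟨⟨z, hz, rfl⟩, h⟩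
      refine ⟨⟨z, hz⟩, ?_, rfl⟩
      by_contra hzW
      exact h ⟨z, ⟨hUK hz, fun hzUW => hzW hzUW.2⟩, rfl⟩
  have hE : IsOpenMap (E.source.domRestrict E) := by
    intro V hV
    obtain ⟨W, hW, rfl⟩ := isOpen_induced_iff.1 hV
    rw [himage]
    exact hopen.inter ((hK.diff (hU.inter hW)).image_of_continuousOn
      (hf.mono Set.sdiff_subset)).isClosed.isOpen_compl
  exact ⟨(OpenPartialHomeomorph.ofContinuousOpenRestrict E (hf.mono hUK) hE hU).symm,
    rfl, rfl, fun _ => rfl⟩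

end topology

theorem det_smul_one_complex (c : ℂ) : (c • (1 : ℂ →L[ℝ] ℂ)).det = Complex.normSq c := by
  rw [← Algebra.norm_complex_apply, Algebra.norm_apply, ContinuousLinearMap.det]
  congr 1

section transition

variable {X : Type*} [TopologicalSpace X]

theorem hasDerivAt_transition {e e' : OpenPartialHomeomorph X ℂ} {u : X → ℂ} {z a b : ℂ}
    (hz : z ∈ (e.symm.trans e').source) (hb : b ≠ 0) (hu : HasDerivAt (fun z => u (e.symm z)) a z)
    (hu' : HasStrictDerivAt (fun z => u (e'.symm z)) b (e' (e.symm z))) :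
    HasDerivAt (e.symm.trans e') (b⁻¹ * a) z := by
  set τ := e.symm.trans e'
  have hval {w : ℂ} (hw : w ∈ τ.source) : u (e'.symm (τ w)) = u (e.symm w) :=
    congrArg u (e'.left_inv (e.symm.trans_source e' ▸ hw).2)
  have hinv := (hu'.to_localInverse hb).hasDerivAt
  have hleft := (hu'.hasStrictFDerivAt_equiv hb).eventually_left_inverse
  rw [show u (e'.symm (e' (e.symm z))) = u (e.symm z) from hval hz] at hinv
  refine (hinv.comp z hu).congr_of_eventuallyEq ?_
  filter_upwards [τ.open_source.mem_nhds hz, (τ.continuousAt hz).eventually hleft] with w hw hτw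
  rw [Function.comp, ← hval hw]
  exact hτw.symm

theorem contDiffOn_and_det_pos_of_hasDerivAt {f : ℂ → ℂ} {s : Set ℂ} (hs : IsOpen s)
    (hf : ∀ z ∈ s, ∃ c : ℂ, c ≠ 0 ∧ HasDerivAt f c z) :
    ContDiffOn ℝ ((⊤ : ℕ∞) : WithTop ℕ∞) f s ∧ ∀ z ∈ s, 0 < (fderiv ℝ f z).det := by
  constructor
  · have hd : DifferentiableOn ℂ f s := fun z hz =>
      (hf z hz).choose_spec.2.differentiableAt.differentiableWithinAt
    exact (hd.contDiffOn hs).restrict_scalars ℝ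
  · intro z hz
    obtain ⟨c, hc, h⟩ := hf z hz
    rw [h.complexToReal_fderiv.fderiv, det_smul_one_complex]
    exact Complex.normSq_pos.2 hc

/-- The excluded points `c i` are the possible branch points of `u`, where it is no local chart. -/
theorem transition_oriented_of_branched {I : Type*} (κ : I → OpenPartialHomeomorph X ℂ)
    (c : I → X) (u : X → ℂ) (hc : ∀ i j, i ≠ j → c i ∉ (κ j).source)
    (hu : ∀ i, ∀ z ∈ (κ i).target, (κ i).symm z ≠ c i →
      ∃ a : ℂ, a ≠ 0 ∧ HasStrictDerivAt (fun z => u ((κ i).symm z)) a z) (i j : I) :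
    ContDiffOn ℝ ((⊤ : ℕ∞) : WithTop ℕ∞) ((κ i).symm.trans (κ j)) ((κ i).symm.trans (κ j)).source ∧
      ∀ z ∈ ((κ i).symm.trans (κ j)).source, 0 < (fderiv ℝ ((κ i).symm.trans (κ j)) z).det := by
  refine contDiffOn_and_det_pos_of_hasDerivAt (OpenPartialHomeomorph.open_source _) fun z hz => ?_
  obtain ⟨hzi : z ∈ (κ i).target, hzj : (κ i).symm z ∈ (κ j).source⟩ :=
    (κ i).symm.trans_source (κ j) ▸ hz
  rcases eq_or_ne i j with rfl | hij
  · refine ⟨1, one_ne_zero, (hasDerivAt_id z).congr_of_eventuallyEq ?_⟩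
    filter_upwards [(κ i).open_target.mem_nhds hzi] with w hw
    exact (κ i).right_inv hw
  · have hne : (κ i).symm z ≠ c i := fun h => hc i j hij (h ▸ hzj)
    have hne' : (κ j).symm (κ j ((κ i).symm z)) ≠ c j := by
      rw [(κ j).left_inv hzj]
      exact fun h => hc j i hij.symm (h ▸ (κ i).map_target hzi)
    obtain ⟨a, ha, hua⟩ := hu i z hzi hne
    obtain ⟨b, hb, hub⟩ := hu j _ ((κ j).map_source hzj) hne'
    exact ⟨b⁻¹ * a, mul_ne_zero (inv_ne_zero hb) ha,
      hasDerivAt_transition hz hb hua.hasDerivAt hub⟩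

end transition

/-! ### Angles -/

/-- The point `exp (2πiζ / l)`. For real `ζ` it runs through the unit circle with period `l`, an
edge of an `l`-gon inscribed in the circle corresponding to an interval of length `1`; for `ζ` in
the upper half plane it covers the punctured open disc. -/
def arc (l : ℕ) (ζ : ℂ) : ℂ := Complex.exp (2 * Real.pi * Complex.I * ζ / l)

theorem arc_add (l : ℕ) (a b : ℂ) : arc l (a + b) = arc l a * arc l b := by
  rw [arc, arc, arc, ← Complex.exp_add]
  congr 1
  ring

theorem arc_zero (l : ℕ) : arc l 0 = 1 := by simp [arc]

theorem arc_ne_zero (l : ℕ) (a : ℂ) : arc l a ≠ 0 := Complex.exp_ne_zero _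

theorem arc_neg (l : ℕ) (a : ℂ) : arc l (-a) = (arc l a)⁻¹ := by
  rw [arc, arc, ← Complex.exp_neg]
  congr 1
  ring

theorem arc_zpow (l : ℕ) (ζ : ℂ) (n : ℤ) : arc l ζ ^ n = arc l (n * ζ) := by
  rw [arc, arc, ← Complex.exp_int_mul]
  congr 1
  ring

theorem norm_arc (l : ℕ) (ζ : ℂ) : ‖arc l ζ‖ = Real.exp (-(2 * Real.pi * ζ.im / l)) := by
  have hre : (2 * Real.pi * Complex.I * ζ / l : ℂ) = ((2 * Real.pi / l : ℝ) : ℂ) *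
      (Complex.I * ζ) := by
    push_cast
    ring
  rw [arc, Complex.norm_exp, hre, Complex.re_ofReal_mul, Complex.I_mul_re]
  congr 1
  ring

theorem norm_arc_ofReal (l : ℕ) (x : ℝ) : ‖arc l (x : ℂ)‖ = 1 := by simp [norm_arc]

theorem norm_arc_intCast (l : ℕ) (i : ℤ) : ‖arc l i‖ = 1 := by simp [norm_arc]

theorem norm_arc_lt_one {l : ℕ} (hl : 0 < l) {ζ : ℂ} : ‖arc l ζ‖ < 1 ↔ 0 < ζ.im := by
  rw [norm_arc, Real.exp_lt_one_iff, neg_lt_zero, div_pos_iff_of_pos_right (Nat.cast_pos.2 hl),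
    mul_pos_iff_of_pos_left Real.two_pi_pos]

theorem norm_arc_le_one {l : ℕ} (hl : 0 < l) {ζ : ℂ} : ‖arc l ζ‖ ≤ 1 ↔ 0 ≤ ζ.im := by
  rw [norm_arc, Real.exp_le_one_iff, neg_nonpos, le_div_iff₀ (Nat.cast_pos.2 hl), zero_mul,
    mul_nonneg_iff_of_pos_left Real.two_pi_pos]

theorem arc_eq_arc {l : ℕ} (hl : 0 < l) {a b : ℂ} :
    arc l a = arc l b ↔ ∃ n : ℤ, a = b + n * l := by
  have hl' : (l : ℂ) ≠ 0 := by exact_mod_cast hl.ne'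
  rw [arc, arc, Complex.exp_eq_exp_iff_exists_int]
  refine exists_congr fun n => ?_
  rw [show (2 * Real.pi * Complex.I * b / l + n * (2 * Real.pi * Complex.I) : ℂ)
    = (2 * Real.pi * Complex.I) * ((b + n * l) / l) by field_simp, mul_div_assoc,
    mul_right_inj' Complex.two_pi_I_ne_zero, div_left_inj' hl']

theorem exists_arc_eq {l : ℕ} (hl : 0 < l) {z : ℂ} (hz : z ≠ 0) : ∃ ζ, arc l ζ = z := by
  have hl' : (l : ℂ) ≠ 0 := by exact_mod_cast hl.ne'
  refine ⟨l * Complex.log z / (2 * Real.pi * Complex.I), ?_⟩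
  rw [arc, show (2 * Real.pi * Complex.I * (l * Complex.log z / (2 * Real.pi * Complex.I)) / l : ℂ)
    = Complex.log z by field_simp, Complex.exp_log hz]

theorem exists_arc_ofReal_eq {l : ℕ} (hl : 0 < l) {z : ℂ} (hz : ‖z‖ = 1) :
    ∃ x : ℝ, arc l x = z := by
  obtain ⟨ζ, rfl⟩ := exists_arc_eq hl (norm_ne_zero_iff.1 (hz ▸ one_ne_zero))
  have him : ζ.im = 0 := le_antisymm
    (not_lt.1 fun h => ((norm_arc_lt_one hl).2 h).ne hz) ((norm_arc_le_one hl).1 hz.le)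
  exact ⟨ζ.re, by rw [show ((ζ.re : ℝ) : ℂ) = ζ from Complex.ext rfl him.symm]⟩

theorem continuous_arc (l : ℕ) : Continuous (arc l) := by
  unfold arc
  fun_prop

theorem isOpenMap_arc {l : ℕ} (hl : 0 < l) : IsOpenMap (arc l) := by
  have hl' : (2 * Real.pi * Complex.I / l : ℂ) ≠ 0 :=
    div_ne_zero Complex.two_pi_I_ne_zero (by exact_mod_cast hl.ne')
  convert Complex.isOpenMap_exp.comp (Homeomorph.mulLeft₀ _ hl').isOpenMap using 1
  funext ζ
  exact congrArg Complex.exp (div_mul_eq_mul_div _ _ _).symm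

theorem arc_mul_cancel {q : ℕ} (hq : 0 < q) (l : ℕ) (ζ : ℂ) :
    arc (l * q) (ζ * q) = arc l ζ := by
  have hq' : (q : ℂ) ≠ 0 := by exact_mod_cast hq.ne'
  rw [arc, arc, Nat.cast_mul, ← mul_assoc, mul_div_mul_right _ _ hq']

theorem arc_zpow_mul {l : ℕ} (hl : 0 < l) (ζ : ℂ) (n : ℤ) :
    arc l ζ ^ ((l : ℤ) * n) = arc 1 (n * ζ) := by
  rw [arc_zpow, ← arc_mul_cancel hl 1, one_mul]
  push_cast
  congr 1
  ring

theorem arc_one_intCast (n : ℤ) : arc 1 n = 1 := by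
  rw [← arc_zero 1, arc_eq_arc one_pos]
  exact ⟨n, by simp⟩

theorem arc_two_intCast (n : ℤ) : arc 2 n = ((((-1 : ℤˣ) ^ n : ℤˣ) : ℤ) : ℂ) := by
  have hone : arc 2 1 = -1 := by
    rw [arc, ← Complex.exp_pi_mul_I]
    congr 1
    push_cast
    ring
  rw [← mul_one (n : ℂ), ← arc_zpow, hone]
  rcases Int.even_or_odd n with hn | hn
  · rw [hn.neg_one_zpow, hn.neg_one_zpow, Units.val_one, Int.cast_one]
  · rw [hn.neg_one_zpow, hn.neg_one_zpow, Units.val_neg, Units.val_one, Int.cast_neg, Int.cast_one]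

theorem eq_of_arc_eq_of_abs_sub_lt {l : ℕ} {x y : ℝ} (hxy : |x - y| < l)
    (h : arc l x = arc l y) : x = y := by
  have hl : 0 < l := by exact_mod_cast (abs_nonneg _).trans_lt hxy
  obtain ⟨n, hn⟩ := (arc_eq_arc hl).1 h
  have hn' : x = y + n * l := by exact_mod_cast hn
  rw [hn', add_sub_cancel_left, abs_mul, Nat.abs_cast,
    mul_lt_iff_lt_one_left (Nat.cast_pos.2 hl)] at hxy
  obtain rfl : n = 0 := Int.abs_lt_one_iff.1 (by exact_mod_cast hxy)
  simpa using hn'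

theorem norm_mul_arc {a : ℝ} (ha : 0 ≤ a) (l : ℕ) (t : ℝ) : ‖(a : ℂ) * arc l t‖ = a := by
  rw [norm_mul, norm_arc_ofReal, mul_one, Complex.norm_real, Real.norm_of_nonneg ha]

theorem norm_mul_arc_arg {l : ℕ} (hl : 0 < l) (w : ℂ) :
    (‖w‖ : ℂ) * arc l ((l * w.arg / (2 * Real.pi) : ℝ) : ℂ) = w := by
  have hl' : (l : ℂ) ≠ 0 := by exact_mod_cast hl.ne'
  have hpi : (Real.pi : ℂ) ≠ 0 := by exact_mod_cast Real.pi_ne_zero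
  conv_rhs => rw [← Complex.norm_mul_exp_arg_mul_I w]
  rw [arc]
  congr 2
  push_cast
  field_simp

theorem im_mul_arc_two (a t : ℝ) : ((a : ℂ) * arc 2 t).im = a * Real.sin (Real.pi * t) := by
  have hexp : (2 * Real.pi * Complex.I * t / (2 : ℕ) : ℂ) =
      ((Real.pi * t : ℝ) : ℂ) * Complex.I := by
    push_cast
    ring
  rw [Complex.im_ofReal_mul, arc, hexp, Complex.exp_ofReal_mul_I_im]

theorem im_mul_arc_two_nonneg {a t : ℝ} (ha : 0 ≤ a) (ht : t ∈ Set.Icc (0 : ℝ) 1) :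
    0 ≤ ((a : ℂ) * arc 2 t).im := by
  rw [im_mul_arc_two]
  exact mul_nonneg ha (Real.sin_nonneg_of_nonneg_of_le_pi (mul_nonneg Real.pi_pos.le ht.1)
    (mul_le_of_le_one_right Real.pi_pos.le ht.2))

/-- The upper half plane together with the nonnegative real axis, a fundamental domain of the
plane for `ζ ↦ -ζ`. -/
def halfPlane : Set ℂ := {ζ | 0 < ζ.im ∨ ∃ a : ℝ, 0 ≤ a ∧ (a : ℂ) = ζ}

theorem im_nonneg_of_mem_halfPlane {ζ : ℂ} (hζ : ζ ∈ halfPlane) : 0 ≤ ζ.im := by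
  rcases hζ with hζ | ⟨a, -, rfl⟩
  · exact hζ.le
  · exact (Complex.ofReal_im a).ge

theorem mul_arc_two_mem_halfPlane {a t : ℝ} (ha : 0 ≤ a) (ht : t ∈ Set.Ico (0 : ℝ) 1) :
    (a : ℂ) * arc 2 t ∈ halfPlane := by
  rcases ha.eq_or_lt with rfl | ha
  · exact Or.inr ⟨0, le_rfl, by rw [Complex.ofReal_zero, zero_mul]⟩
  rcases ht.1.eq_or_lt with rfl | ht0
  · exact Or.inr ⟨a, ha.le, by rw [Complex.ofReal_zero, arc_zero, mul_one]⟩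
  · left
    rw [im_mul_arc_two]
    exact mul_pos ha (Real.sin_pos_of_pos_of_lt_pi (mul_pos Real.pi_pos ht0)
      (mul_lt_of_lt_one_right Real.pi_pos ht.2))

/-! ### Continuity in polar coordinates -/

theorem continuousOn_prod_univ_of_Icc_intCast {X Y : Type*} [TopologicalSpace X]
    [TopologicalSpace Y] {f : X × ℝ → Y} {s : Set X} (hs : IsClosed s)
    (hf : ∀ j : ℤ, ContinuousOn f (s ×ˢ Set.Icc (j : ℝ) (j + 1))) :
    ContinuousOn f (s ×ˢ Set.univ) := by
  have hfin : LocallyFinite fun j : ℤ => s ×ˢ Set.Icc (j : ℝ) (j + 1) := by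
    intro p
    refine ⟨Set.univ ×ˢ Set.Ioo (p.2 - 1) (p.2 + 1), prod_mem_nhds Filter.univ_mem
      (Ioo_mem_nhds (by linarith) (by linarith)), ?_⟩
    refine (Set.finite_Icc (⌊p.2⌋ - 2) (⌈p.2⌉ + 1)).subset ?_
    rintro j ⟨q, ⟨-, hj⟩, -, hq⟩
    have hfloor := Int.floor_le p.2
    have hceil := Int.le_ceil p.2
    have hlo : ((⌊p.2⌋ - 2 : ℤ) : ℝ) ≤ j := by
      push_cast
      linarith [hj.2, hq.1]
    have hhi : (j : ℝ) ≤ ((⌈p.2⌉ + 1 : ℤ) : ℝ) := by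
      push_cast
      linarith [hj.1, hq.2]
    exact ⟨by exact_mod_cast hlo, by exact_mod_cast hhi⟩
  refine (hfin.continuousOn_iUnion (fun j => hs.prod isClosed_Icc) hf).mono fun p hp => ?_
  exact Set.mem_iUnion.2 ⟨⌊p.2⌋, hp.1, Int.floor_le _, (Int.lt_floor_add_one _).le⟩

theorem continuousOn_closedBall_of_mul_arc {Y : Type*} [TopologicalSpace Y] {f : ℂ → Y} {l : ℕ}
    (hl : 0 < l)
    (hf : ContinuousOn (fun p : ℝ × ℝ => f (p.1 * arc l p.2)) (Set.Icc 0 1 ×ˢ Set.univ)) :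
    ContinuousOn f (Metric.closedBall 0 1) := by
  let T : Set (ℝ × ℝ) := Set.Icc 0 1 ×ˢ Set.Icc (-(l / 2 : ℝ)) (l / 2)
  have hT : CompactSpace T := isCompact_iff_compactSpace.1 (isCompact_Icc.prod isCompact_Icc)
  let P : T → Metric.closedBall (0 : ℂ) 1 := fun p => ⟨p.1.1 * arc l p.1.2, by
    rw [mem_closedBall_zero_iff, norm_mul_arc p.2.1.1]
    exact p.2.1.2⟩
  have hPc : Continuous P :=
    (Continuous.mul (by fun_prop) ((continuous_arc l).comp (by fun_prop))).subtype_mk _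
  have hPs : Function.Surjective P := by
    rintro ⟨w, hw⟩
    have harg : |l * w.arg / (2 * Real.pi)| ≤ l / 2 := by
      rw [mul_div_assoc, abs_mul, Nat.abs_cast, abs_div, abs_of_pos Real.two_pi_pos,
        div_eq_mul_one_div (l : ℝ)]
      refine mul_le_mul_of_nonneg_left ?_ (Nat.cast_nonneg l)
      rw [div_le_iff₀ Real.two_pi_pos, one_div, inv_mul_cancel_left₀ two_ne_zero]
      exact Complex.abs_arg_le_pi w
    exact ⟨⟨(‖w‖, l * w.arg / (2 * Real.pi)),
      ⟨norm_nonneg w, mem_closedBall_zero_iff.1 hw⟩, abs_le.1 harg⟩,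
      Subtype.ext (norm_mul_arc_arg hl w)⟩
  rw [continuousOn_iff_continuous_domRestrict,
    (hPc.isClosedMap.isQuotientMap hPc hPs).continuous_iff]
  exact hf.comp_continuous continuous_subtype_val fun p => ⟨p.2.1, Set.mem_univ _⟩

/-! ### Orbits of permutations -/

section perm

variable {T : Type*}

theorem minimalPeriod_perm_pos [Finite T] (a : Perm T) (c : T) :
    0 < Function.minimalPeriod a c :=
  Function.minimalPeriod_pos_of_mem_periodicPts (a.injective.mem_periodicPts c)

theorem zpow_apply_eq_self_iff {a : Perm T} {c : T} {i : ℤ} :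
    (a ^ i) c = c ↔ (Function.minimalPeriod a c : ℤ) ∣ i :=
  MulAction.zpow_smul_eq_iff_minimalPeriod_dvd (a := a) (b := c)

theorem zpow_apply_eq_zpow_apply_iff {a : Perm T} {c : T} {i j : ℤ} :
    (a ^ i) c = (a ^ j) c ↔ (Function.minimalPeriod a c : ℤ) ∣ i - j := by
  rw [← zpow_apply_eq_self_iff, sub_eq_neg_add, zpow_add, Equiv.Perm.mul_apply, zpow_neg,
    Equiv.Perm.inv_eq_iff_eq]

theorem minimalPeriod_zpow_apply {a : Perm T} (c : T) (i : ℤ) :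
    Function.minimalPeriod a ((a ^ i) c) = Function.minimalPeriod a c := by
  refine Nat.dvd_right_iff_eq.1 fun n => ?_
  rw [← Int.natCast_dvd_natCast, ← Int.natCast_dvd_natCast, ← zpow_apply_eq_self_iff,
    ← zpow_apply_eq_self_iff, ← Equiv.Perm.mul_apply, ← zpow_add, add_comm, zpow_add,
    Equiv.Perm.mul_apply, EmbeddingLike.apply_eq_iff_eq]

theorem semiconj_zpow {U : Type*} {a : Perm T} {b : Perm U} {f : T → U}
    (h : Function.Semiconj f a b) (i : ℤ) : Function.Semiconj f ⇑(a ^ i) ⇑(b ^ i) := by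
  have hpow : ∀ n : ℕ, Function.Semiconj f ⇑(a ^ n) ⇑(b ^ n) := fun n => by
    simpa only [Equiv.Perm.coe_pow] using h.iterate_right n
  obtain ⟨n, rfl | rfl⟩ := i.eq_nat_or_neg
  · simpa only [zpow_natCast] using hpow n
  · intro c
    rw [zpow_neg, zpow_neg, zpow_natCast, zpow_natCast, Equiv.Perm.eq_inv_iff_eq, ← hpow n,
      ← Equiv.Perm.mul_apply, mul_inv_cancel, Equiv.Perm.one_apply]

theorem injOn_pow_apply_range (a : Perm T) (c : T) :
    Set.InjOn (fun i => (a ^ i) c) (Finset.range (Function.minimalPeriod a c) : Set ℕ) := by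
  simpa only [Finset.coe_range, Equiv.Perm.iterate_eq_pow] using
    Function.iterate_injOn_Iio_minimalPeriod (f := a) (x := c)

open Classical in
theorem image_pow_apply_range [Fintype T] (a : Perm T) (c : T) :
    (Finset.range (Function.minimalPeriod a c)).image (fun i => (a ^ i) c)
      = Finset.univ.filter (fun d => a.SameCycle c d) := by
  ext d
  simp only [Finset.mem_image, Finset.mem_range, Finset.mem_filter_univ]
  constructor
  · rintro ⟨i, -, rfl⟩
    exact ⟨i, by rw [zpow_natCast]⟩
  · intro h
    obtain ⟨i, rfl⟩ := h.exists_nat_pow_eq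
    refine ⟨i % Function.minimalPeriod a c, Nat.mod_lt _ (minimalPeriod_perm_pos a c), ?_⟩
    rw [← Equiv.Perm.iterate_eq_pow, ← Equiv.Perm.iterate_eq_pow,
      Function.iterate_mod_minimalPeriod_eq]

open Classical in
theorem minimalPeriod_eq_card_sameCycle [Fintype T] (a : Perm T) (c : T) :
    Function.minimalPeriod a c = (Finset.univ.filter (fun d => a.SameCycle c d)).card := by
  rw [← image_pow_apply_range, Finset.card_image_of_injOn (injOn_pow_apply_range a c),
    Finset.card_range]

open Classical in
theorem sum_range_minimalPeriod [Fintype T] {G : Type*} [AddCommMonoid G] (a : Perm T) (c : T)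
    (f : T → G) :
    ∑ i ∈ Finset.range (Function.minimalPeriod a c), f ((a ^ i) c)
      = ∑ d with a.SameCycle c d, f d := by
  rw [← image_pow_apply_range, Finset.sum_image (injOn_pow_apply_range a c)]

end perm

/-! ### Reductions of cyclic groups -/

theorem card_filter_map_eq {G H : Type*} [AddGroup G] [AddGroup H] [Fintype G] [Fintype H]
    [DecidableEq H] (f : G →+ H) (hf : Function.Surjective f) (y : H) :
    (Finset.univ.filter fun x => f x = y).card = Fintype.card G / Fintype.card H := by
  have hsum := Finset.card_eq_sum_card_fiberwise (s := (Finset.univ : Finset G))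
    (t := (Finset.univ : Finset H)) (f := f) fun _ _ => Finset.mem_coe.2 (Finset.mem_univ _)
  rw [Finset.sum_congr rfl fun z _ => AddMonoidHom.card_fiber_eq_of_mem_range f (hf z) (hf y),
    Finset.sum_const, Finset.card_univ, Finset.card_univ, smul_eq_mul] at hsum
  exact (Nat.div_eq_of_eq_mul_right Fintype.card_pos hsum).symm

theorem mem_zmultiples_iff_castHom_eq_zero {N q : ℕ} (h : q ∣ N) (x : ZMod N) :
    x ∈ AddSubgroup.zmultiples (q : ZMod N) ↔ ZMod.castHom h (ZMod q) x = 0 := by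
  obtain ⟨a, rfl⟩ := ZMod.intCast_surjective x
  rw [map_intCast, ZMod.intCast_zmod_eq_zero_iff_dvd]
  constructor
  · rintro ⟨i, hi⟩
    have hdvd : (N : ℤ) ∣ i * q - a := by
      rw [← ZMod.intCast_zmod_eq_zero_iff_dvd]
      simpa [sub_eq_zero] using hi
    exact (Int.dvd_iff_dvd_of_dvd_sub ((Int.natCast_dvd_natCast.2 h).trans hdvd)).1
      (Dvd.intro_left i rfl)
  · rintro ⟨i, rfl⟩
    exact ⟨i, by simp [mul_comm]⟩

namespace Multigraph

/-! ### Points of the realization -/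

section

variable {Γ : Multigraph}

/-- The vertex `x` as a point of the realization. -/
def vert (x : Γ.V) : Γ.Realization := Quot.mk _ (Sum.inl ⟨x, PUnit.unit⟩)

theorem head_rev (d : Γ.D) : Γ.head (Γ.rev d) = Γ.tail d := by
  unfold head
  rw [Γ.rev_rev]

theorem point_zero (d : Γ.D) : point d 0 = vert (Γ.tail d) := Quot.sound (Glue.tail d)

theorem point_rev (d : Γ.D) (s : unitInterval) :
    point (Γ.rev d) (unitInterval.symm s) = point d s := (Quot.sound (Glue.rev d s)).symm

theorem point_one (d : Γ.D) : point d 1 = vert (Γ.head d) := by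
  rw [← point_rev d 1, unitInterval.symm_one, point_zero]
  rfl

theorem realization_cases (y : Γ.Realization) :
    (∃ x, y = vert x) ∨ ∃ d s, y = point d s := by
  induction y using Quot.ind with
  | mk a =>
    rcases a with ⟨x, ⟨⟩⟩ | ⟨d, s⟩
    · exact Or.inl ⟨x, rfl⟩
    · exact Or.inr ⟨d, s, rfl⟩

open Classical in
/-- The vertex at a point of the realization, or the two representations of an interior point of an
edge: a complete invariant of the gluing. -/
def normalForm : Γ.Realization → Γ.V ⊕ Set (Γ.D × unitInterval) :=
  Quot.lift (fun a => match a with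
    | Sum.inl x => Sum.inl x.1
    | Sum.inr e => if e.2 = 0 then Sum.inl (Γ.tail e.1) else if e.2 = 1 then Sum.inl (Γ.head e.1)
        else Sum.inr {(e.1, e.2), (Γ.rev e.1, unitInterval.symm e.2)}) (by
    intro a b h
    cases h with
    | tail d => simp
    | rev d s =>
      have h0 : unitInterval.symm s = 0 ↔ s = 1 := by
        rw [← unitInterval.symm_one, unitInterval.symm_inj]
      have h1 : unitInterval.symm s = 1 ↔ s = 0 := by
        rw [← unitInterval.symm_zero, unitInterval.symm_inj]
      simp only [h0, h1, head_rev, Γ.rev_rev, unitInterval.symm_symm, Set.pair_comm (d, s)]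
      by_cases hs0 : s = 0
      · subst hs0
        simp
      · by_cases hs1 : s = 1
        · subst hs1
          simp [head]
        · simp [hs0, hs1])

theorem normalForm_point (d : Γ.D) {s : unitInterval} (h0 : s ≠ 0) (h1 : s ≠ 1) :
    normalForm (point d s) = Sum.inr {(d, s), (Γ.rev d, unitInterval.symm s)} := by
  simp [normalForm, point, h0, h1]

theorem vert_injective : Function.Injective (vert : Γ.V → Γ.Realization) := fun _ _ h =>
  Sum.inl_injective (congrArg normalForm h)

theorem point_ne_vert (d : Γ.D) {s : unitInterval} (h0 : s ≠ 0) (h1 : s ≠ 1) (x : Γ.V) :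
    point d s ≠ vert x := fun h =>
  Sum.inr_ne_inl ((normalForm_point d h0 h1).symm.trans (congrArg normalForm h))

theorem eq_or_rev_of_point_eq {d d' : Γ.D} {s s' : unitInterval} (h0 : s ≠ 0) (h1 : s ≠ 1)
    (h : point d s = point d' s') :
    (d' = d ∧ s' = s) ∨ (d' = Γ.rev d ∧ s' = unitInterval.symm s) := by
  have h0' : s' ≠ 0 := by
    rintro rfl
    rw [point_zero] at h
    exact point_ne_vert d h0 h1 _ h
  have h1' : s' ≠ 1 := by
    rintro rfl
    rw [point_one] at h
    exact point_ne_vert d h0 h1 _ h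
  have hpair := congrArg normalForm h
  rw [normalForm_point d h0 h1, normalForm_point d' h0' h1', Sum.inr.injEq] at hpair
  have hmem : (d', s') ∈ ({(d, s), (Γ.rev d, unitInterval.symm s)} : Set (Γ.D × unitInterval)) :=
    hpair ▸ Set.mem_insert _ _
  simpa only [Set.mem_insert_iff, Set.mem_singleton_iff, Prod.mk.injEq] using hmem

theorem continuous_point (d : Γ.D) : Continuous (point d) :=
  continuous_quot_mk.comp (continuous_inr.comp continuous_sigmaMk)

theorem continuous_realization_iff {Y : Type*} [TopologicalSpace Y] {f : Γ.Realization → Y} :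
    Continuous f ↔ ∀ d, Continuous fun s => f (point d s) := by
  refine ⟨fun h d => h.comp (continuous_point d), fun h => continuous_coinduced_dom.2 ?_⟩
  refine (continuous_sumElim (f := fun x => f (vert x.1)) (g := fun e => f (point e.1 e.2))).2
    ⟨continuous_sigma fun x => continuous_of_discreteTopology, continuous_sigma h⟩ |>.congr ?_
  rintro (⟨x, ⟨⟩⟩ | e) <;> rfl

end

/-! ### Orbits of the face permutation -/

section

variable {Γ : Multigraph} {φ : Perm Γ.D}

/-- A face permutation, that is, one whose orbits are closed walks: `φ d` starts where `d` ends.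
Isolated vertices are excluded, as the discs glued along these walks would miss them. -/
structure IsFacePerm (φ : Perm Γ.D) : Prop where
  tail_apply : ∀ d, Γ.tail (φ d) = Γ.head d
  tail_surjective : Function.Surjective Γ.tail

/-- The length of the closed walk `d, φ d, φ² d, …`. -/
abbrev len (φ : Perm Γ.D) (d : Γ.D) : ℕ := Function.minimalPeriod φ d

theorem len_pos [Finite Γ.D] (φ : Perm Γ.D) (d : Γ.D) : 0 < len φ d := minimalPeriod_perm_pos φ d

theorem len_zpow (d : Γ.D) (i : ℤ) : len φ ((φ ^ i) d) = len φ d := minimalPeriod_zpow_apply d i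

/-- The point at parameter `x` on the closed walk `d, φ d, φ² d, …`. -/
def edgePoint (φ : Perm Γ.D) (d : Γ.D) (x : ℝ) : Γ.Realization :=
  point ((φ ^ ⌊x⌋) d) ⟨Int.fract x, Int.fract_nonneg x, (Int.fract_lt_one x).le⟩

theorem edgePoint_int_add (d : Γ.D) (i : ℤ) (x : ℝ) :
    edgePoint φ d (i + x) = edgePoint φ ((φ ^ i) d) x := by
  unfold edgePoint
  simp only [Int.floor_intCast_add, Int.fract_intCast_add]
  rw [add_comm, zpow_add, Equiv.Perm.mul_apply]

theorem edgePoint_zero (d : Γ.D) : edgePoint φ d 0 = vert (Γ.tail d) := by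
  simp only [edgePoint, Int.floor_zero, Int.fract_zero, zpow_zero, Equiv.Perm.one_apply]
  exact point_zero d

theorem edgePoint_unitInterval (hφ : IsFacePerm φ) (d : Γ.D) (s : unitInterval) :
    edgePoint φ d s = point d s := by
  rcases eq_or_ne s 1 with rfl | hs
  · have hone : edgePoint φ d (((1 : ℤ) : ℝ) + 0) = point d 1 := by
      rw [edgePoint_int_add, edgePoint_zero, zpow_one, hφ.tail_apply, point_one]
    rwa [Int.cast_one, add_zero] at hone
  · have hfloor : ⌊(s : ℝ)⌋ = 0 :=
      Int.floor_eq_zero_iff.2 ⟨s.2.1, lt_of_le_of_ne s.2.2 fun h => hs (Subtype.ext h)⟩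
    simp only [edgePoint, hfloor, zpow_zero, Equiv.Perm.one_apply]
    congr 1
    exact Subtype.ext (Int.fract_eq_self.2 (Int.floor_eq_zero_iff.1 hfloor))

theorem edgePoint_int_add_unitInterval (hφ : IsFacePerm φ) (d : Γ.D) (i : ℤ) (s : unitInterval) :
    edgePoint φ d (i + s) = point ((φ ^ i) d) s := by
  rw [edgePoint_int_add, edgePoint_unitInterval hφ]

theorem exists_edgePoint_eq (hφ : IsFacePerm φ) (y : Γ.Realization) :
    ∃ d x, edgePoint φ d x = y := by
  rcases realization_cases y with ⟨x, rfl⟩ | ⟨d, s, rfl⟩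
  · obtain ⟨d, rfl⟩ := hφ.tail_surjective x
    exact ⟨d, (0 : unitInterval), by rw [edgePoint_unitInterval hφ, point_zero]⟩
  · exact ⟨d, s, edgePoint_unitInterval hφ d s⟩

theorem edgePoint_eq_of_arc_eq [Finite Γ.D] {d : Γ.D} {x y : ℝ}
    (h : arc (len φ d) x = arc (len φ d) y) : edgePoint φ d x = edgePoint φ d y := by
  obtain ⟨n, hn⟩ := (arc_eq_arc (len_pos φ d)).1 h
  obtain rfl : x = ((n * len φ d : ℤ) : ℝ) + y := by
    push_cast
    rw [add_comm]
    exact_mod_cast hn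
  rw [edgePoint_int_add, zpow_apply_eq_self_iff.2 (Dvd.intro_left n rfl)]

/-! ### The surface obtained by gluing one disc to every orbit of the face permutation -/

/-- The relation identifying the discs at the directed edges of one orbit by rotations, so that only
one disc is attached to every orbit. -/
def rotationSetoid (φ : Perm Γ.D) : Setoid (Γ.D × ℂ) where
  r a b := ∃ i : ℤ, b.1 = (φ ^ i) a.1 ∧ a.2 = arc (len φ a.1) i * b.2
  iseqv :=
    { refl := fun a => ⟨0, by simp, by simp [arc_zero]⟩
      symm := by
        rintro ⟨d, z⟩ ⟨d', z'⟩ ⟨i, hd, hz⟩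
        dsimp only at hd hz
        subst hd hz
        refine ⟨-i, by simp, ?_⟩
        dsimp only
        rw [len_zpow, Int.cast_neg, arc_neg, inv_mul_cancel_left₀ (arc_ne_zero _ _)]
      trans := by
        rintro ⟨d, z⟩ ⟨d', z'⟩ ⟨d'', z''⟩ ⟨i, hd, hz⟩ ⟨j, hd', hz'⟩
        dsimp only at hd hz hd' hz'
        subst hd hd' hz' hz
        refine ⟨i + j, by rw [add_comm, zpow_add, Equiv.Perm.mul_apply], ?_⟩
        dsimp only
        rw [len_zpow, Int.cast_add, arc_add, mul_assoc] }

/-- One closed disc for every directed edge, from which the surface is glued. -/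
abbrev Discs (Γ : Multigraph) : Type := Σ _ : Γ.D, Metric.closedBall (0 : ℂ) 1

open Classical in
/-- The point of the graph at a boundary point of a disc, or the class of an inner point under
rotations: the fibres of this map are the points of the surface. -/
def cellMap (φ : Perm Γ.D) (a : Discs Γ) : Γ.Realization ⊕ Quotient (rotationSetoid φ) :=
  if ‖(a.2 : ℂ)‖ < 1 then Sum.inr (Quotient.mk _ (a.1, (a.2 : ℂ)))
  else Sum.inl (edgePoint φ a.1 (Function.invFun (fun x : ℝ => arc (len φ a.1) x) a.2))

/-- The surface obtained from the graph by attaching a disc along every orbit of `φ`. -/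
def Surface (φ : Perm Γ.D) : Type := Quotient (Setoid.ker (cellMap φ))

instance (φ : Perm Γ.D) : TopologicalSpace (Surface φ) :=
  inferInstanceAs (TopologicalSpace (Quotient (Setoid.ker (cellMap φ))))

instance [Finite Γ.D] (φ : Perm Γ.D) : CompactSpace (Surface φ) :=
  inferInstanceAs (CompactSpace (Quotient (Setoid.ker (cellMap φ))))

/-- The quotient map to the surface. -/
def Surface.mk (φ : Perm Γ.D) (a : Discs Γ) : Surface φ := Quotient.mk (Setoid.ker (cellMap φ)) a

theorem Surface.mk_eq_mk {a b : Discs Γ} :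
    Surface.mk φ a = Surface.mk φ b ↔ cellMap φ a = cellMap φ b :=
  ⟨fun h => Quotient.exact h, fun h => Quotient.sound h⟩

theorem Surface.isQuotientMap_mk : Topology.IsQuotientMap (Surface.mk φ) :=
  isQuotientMap_quotient_mk'

open Classical in
/-- The closed disc of the surface at the directed edge `d`, with the walk `d, φ d, φ² d, …`
running along its boundary; the value outside the unit disc is arbitrary. -/
def disc (φ : Perm Γ.D) (d : Γ.D) (z : ℂ) : Surface φ :=
  if h : ‖z‖ ≤ 1 then Surface.mk φ ⟨d, z, by simpa using h⟩
  else Surface.mk φ ⟨d, 0, by simp⟩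

theorem disc_of_mem (d : Γ.D) {z : ℂ} (h : z ∈ Metric.closedBall (0 : ℂ) 1) :
    disc φ d z = Surface.mk φ ⟨d, z, h⟩ :=
  dif_pos (mem_closedBall_zero_iff.1 h)

theorem exists_disc_eq (y : Surface φ) : ∃ d z, ‖z‖ ≤ 1 ∧ disc φ d z = y := by
  obtain ⟨⟨d, z, hz⟩, rfl⟩ := Quotient.exists_rep y
  exact ⟨d, z, mem_closedBall_zero_iff.1 hz, disc_of_mem d hz⟩

theorem continuousOn_disc (d : Γ.D) : ContinuousOn (disc φ d) (Metric.closedBall 0 1) := by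
  rw [continuousOn_iff_continuous_domRestrict]
  exact (Surface.isQuotientMap_mk.continuous.comp continuous_sigmaMk).congr
    fun z => (disc_of_mem d z.2).symm

theorem continuous_surface_iff {Y : Type*} [TopologicalSpace Y] {f : Surface φ → Y} :
    Continuous f ↔ ∀ d, ContinuousOn (fun z => f (disc φ d z)) (Metric.closedBall 0 1) := by
  refine ⟨fun h d => h.comp_continuousOn (continuousOn_disc d), fun h => ?_⟩
  refine continuous_coinduced_dom.2 (continuous_sigma fun d => ?_)
  refine (continuousOn_iff_continuous_domRestrict.1 (h d)).congr fun z => ?_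
  exact congrArg f (disc_of_mem d z.2)

theorem isOpen_surface_of {U : Set (Surface φ)}
    (h : ∀ d, ∃ V : Set ℂ, IsOpen V ∧ ∀ z, ‖z‖ ≤ 1 → (disc φ d z ∈ U ↔ z ∈ V)) : IsOpen U := by
  refine Surface.isQuotientMap_mk.isOpen_preimage.1 (isOpen_sigma_iff.2 fun d => ?_)
  obtain ⟨V, hV, hVU⟩ := h d
  convert hV.preimage (continuous_subtype_val (p := (· ∈ Metric.closedBall (0 : ℂ) 1))) using 1
  ext z
  have hz := hVU z (mem_closedBall_zero_iff.1 z.2)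
  rwa [disc_of_mem d z.2] at hz

theorem exists_zpow_of_disc_eq {d d' : Γ.D} {z z' : ℂ} (hz : ‖z‖ < 1) (hz' : ‖z'‖ ≤ 1)
    (h : disc φ d z = disc φ d' z') :
    ∃ i : ℤ, d' = (φ ^ i) d ∧ z = arc (len φ d) i * z' := by
  rw [disc_of_mem d (mem_closedBall_zero_iff.2 hz.le),
    disc_of_mem d' (mem_closedBall_zero_iff.2 hz'), Surface.mk_eq_mk, cellMap, cellMap,
    if_pos hz] at h
  split_ifs at h
  rw [Sum.inr.injEq, Quotient.eq] at h
  exact h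

theorem cellMap_arc [Finite Γ.D] (d : Γ.D) (x : ℝ)
    (h : arc (len φ d) x ∈ Metric.closedBall (0 : ℂ) 1) :
    cellMap φ ⟨d, arc (len φ d) x, h⟩ = Sum.inl (edgePoint φ d x) := by
  rw [cellMap, if_neg (norm_arc_ofReal _ _).not_lt]
  exact congrArg Sum.inl (edgePoint_eq_of_arc_eq
    (Function.invFun_eq (f := fun x : ℝ => arc (len φ d) x) ⟨x, rfl⟩))

theorem disc_arc_eq_disc_arc_iff [Finite Γ.D] {d d' : Γ.D} {x x' : ℝ} :
    disc φ d (arc (len φ d) x) = disc φ d' (arc (len φ d') x') ↔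
      edgePoint φ d x = edgePoint φ d' x' := by
  rw [disc_of_mem d (mem_closedBall_zero_iff.2 (norm_arc_ofReal _ _).le),
    disc_of_mem d' (mem_closedBall_zero_iff.2 (norm_arc_ofReal _ _).le),
    Surface.mk_eq_mk, cellMap_arc, cellMap_arc, Sum.inl.injEq]

theorem disc_arc_mul [Finite Γ.D] (d : Γ.D) (i : ℤ) {z : ℂ} (hz : ‖z‖ ≤ 1) :
    disc φ d (arc (len φ d) i * z) = disc φ ((φ ^ i) d) z := by
  rcases hz.lt_or_eq with hz1 | hz1
  · have hn : ‖arc (len φ d) i * z‖ < 1 := by rwa [norm_mul, norm_arc_intCast, one_mul]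
    rw [disc_of_mem d (mem_closedBall_zero_iff.2 hn.le),
      disc_of_mem _ (mem_closedBall_zero_iff.2 hz), Surface.mk_eq_mk, cellMap, cellMap,
      if_pos hn, if_pos hz1, Sum.inr.injEq, Quotient.eq]
    exact ⟨i, rfl, rfl⟩
  · obtain ⟨x, rfl⟩ := exists_arc_ofReal_eq (len_pos φ ((φ ^ i) d)) hz1
    have hadd : arc (len φ d) i * arc (len φ ((φ ^ i) d)) x = arc (len φ d) ((i + x : ℝ) : ℂ) := by
      rw [len_zpow, ← arc_add, Complex.ofReal_add, Complex.ofReal_intCast]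
    rw [hadd, disc_arc_eq_disc_arc_iff, edgePoint_int_add]

theorem disc_injOn [Finite Γ.D] (d : Γ.D) : Set.InjOn (disc φ d) (Metric.ball 0 1) := by
  intro z hz z' hz' h
  rw [mem_ball_zero_iff] at hz hz'
  obtain ⟨i, hi, rfl⟩ := exists_zpow_of_disc_eq hz hz'.le h
  obtain ⟨n, rfl⟩ := zpow_apply_eq_self_iff.1 hi.symm
  have hone : arc (len φ d) ((len φ d * n : ℤ) : ℂ) = 1 := by
    rw [← arc_zero (len φ d), arc_eq_arc (len_pos φ d)]
    exact ⟨n, by push_cast; ring⟩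
  rw [hone, one_mul]

theorem norm_eq_one_of_disc_eq {d d' : Γ.D} {z z' : ℂ} (hz : ‖z‖ = 1) (hz' : ‖z'‖ ≤ 1)
    (h : disc φ d z = disc φ d' z') : ‖z'‖ = 1 := by
  by_contra hlt
  obtain ⟨i, -, rfl⟩ := exists_zpow_of_disc_eq (lt_of_le_of_ne hz' hlt) hz.le h.symm
  rw [norm_mul, norm_arc_intCast, one_mul] at hlt
  exact hlt hz

/-- The map of the surface which is `f d` on the disc of every directed edge `d`; it makes sense for
families `f` which are compatible with the gluing, see `Surface.lift_disc`. -/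
def Surface.lift {Y : Type*} (f : Γ.D → ℂ → Y) (y : Surface φ) : Y :=
  f (exists_disc_eq y).choose (exists_disc_eq y).choose_spec.choose

theorem Surface.lift_disc [Finite Γ.D] {Y : Type*} {f : Γ.D → ℂ → Y}
    (hrot : ∀ d (i : ℤ) z, ‖z‖ ≤ 1 → f d (arc (len φ d) i * z) = f ((φ ^ i) d) z)
    (harc : ∀ d d' (x x' : ℝ), edgePoint φ d x = edgePoint φ d' x' →
      f d (arc (len φ d) x) = f d' (arc (len φ d') x')) (d : Γ.D) {z : ℂ} (hz : ‖z‖ ≤ 1) :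
    lift f (disc φ d z) = f d z := by
  obtain ⟨hnorm, hdisc⟩ := (exists_disc_eq (disc φ d z)).choose_spec.choose_spec
  unfold lift
  generalize (exists_disc_eq (disc φ d z)).choose_spec.choose = z' at *
  generalize (exists_disc_eq (disc φ d z)).choose = d' at *
  rcases hz.lt_or_eq with hlt | hone
  · obtain ⟨i, rfl, rfl⟩ := exists_zpow_of_disc_eq hlt hnorm hdisc.symm
    exact (hrot d i z' hnorm).symm
  · have hone' := norm_eq_one_of_disc_eq hone hnorm hdisc.symm
    obtain ⟨x, rfl⟩ := exists_arc_ofReal_eq (len_pos φ d) hone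
    obtain ⟨x', rfl⟩ := exists_arc_ofReal_eq (len_pos φ d') hone'
    exact harc _ _ _ _ (disc_arc_eq_disc_arc_iff.1 hdisc)

end

/-! ### The surface is Hausdorff -/

section

variable {Γ : Multigraph} {φ : Perm Γ.D}

theorem point_eq_point_iff {d d' : Γ.D} {s s' : unitInterval} :
    point d s = point d' s' ↔ (d' = d ∧ s' = s) ∨ (d' = Γ.rev d ∧ s' = unitInterval.symm s) ∨
      (s = 0 ∨ s = 1) ∧ (s' = 0 ∨ s' = 1) ∧ point d s = point d' s' := by
  constructor
  · intro h
    by_cases hs : s = 0 ∨ s = 1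
    · refine Or.inr (Or.inr ⟨hs, ?_, h⟩)
      by_contra hs'
      rw [not_or] at hs'
      rcases hs with rfl | rfl
      · exact point_ne_vert d' hs'.1 hs'.2 _ (h.symm.trans (point_zero d))
      · exact point_ne_vert d' hs'.1 hs'.2 _ (h.symm.trans (point_one d))
    · rw [not_or] at hs
      exact (eq_or_rev_of_point_eq hs.1 hs.2 h).imp_right Or.inl
  · rintro (⟨rfl, rfl⟩ | ⟨rfl, rfl⟩ | ⟨-, -, h⟩)
    · rfl
    · exact (point_rev d s).symm
    · exact h

theorem isClosed_setOf_point_eq (d d' : Γ.D) :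
    IsClosed {p : unitInterval × unitInterval | point d p.1 = point d' p.2} := by
  have hends : {p : unitInterval × unitInterval |
      (p.1 = 0 ∨ p.1 = 1) ∧ (p.2 = 0 ∨ p.2 = 1) ∧ point d p.1 = point d' p.2}.Finite :=
    ((Set.toFinite {0, 1}).prod (Set.toFinite {0, 1})).subset fun p hp => ⟨hp.1, hp.2.1⟩
  rw [Set.ext fun p : unitInterval × unitInterval => point_eq_point_iff (d := d) (d' := d')]
  exact (isClosed_const.and (isClosed_eq continuous_snd continuous_fst)).union
    ((isClosed_const.and (isClosed_eq continuous_snd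
      (unitInterval.continuous_symm.comp continuous_fst))).union hends.isClosed)

theorem exists_lt_len [Finite Γ.D] (d : Γ.D) (i : ℤ) :
    ∃ j < len φ d, (φ ^ i) d = (φ ^ (j : ℤ)) d ∧ arc (len φ d) i = arc (len φ d) (j : ℤ) := by
  have hl : (0 : ℤ) < len φ d := by exact_mod_cast len_pos φ d
  obtain ⟨j, hj⟩ := Int.eq_ofNat_of_zero_le (Int.emod_nonneg i hl.ne')
  have hdiv : i = j + len φ d * (i / len φ d) := hj ▸ (Int.emod_add_mul_ediv i (len φ d)).symm
  refine ⟨j, by exact_mod_cast hj ▸ Int.emod_lt_of_pos i hl, ?_, ?_⟩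
  · exact zpow_apply_eq_zpow_apply_iff.2 ⟨i / len φ d, sub_eq_iff_eq_add'.2 hdiv⟩
  · refine (arc_eq_arc (len_pos φ d)).2 ⟨i / len φ d, ?_⟩
    rw [mul_comm]
    exact_mod_cast hdiv

theorem exists_lt_len_unitInterval [Finite Γ.D] (d : Γ.D) (x : ℝ) :
    ∃ j < len φ d, ∃ s : unitInterval, edgePoint φ d x = point ((φ ^ (j : ℤ)) d) s ∧
      arc (len φ d) x = arc (len φ d) ((((j : ℤ) : ℝ) + s : ℝ) : ℂ) := by
  obtain ⟨j, hj, hzpow, harc⟩ := exists_lt_len (φ := φ) d ⌊x⌋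
  refine ⟨j, hj, ⟨Int.fract x, Int.fract_nonneg x, (Int.fract_lt_one x).le⟩, ?_, ?_⟩
  · rw [edgePoint, hzpow]
  · conv_lhs => rw [← Int.floor_add_fract x]
    push_cast at harc ⊢
    rw [arc_add, arc_add, harc]

theorem disc_eq_disc_iff [Finite Γ.D] (hφ : IsFacePerm φ) {d d' : Γ.D} {z z' : ℂ} (hz : ‖z‖ ≤ 1)
    (hz' : ‖z'‖ ≤ 1) : disc φ d z = disc φ d' z' ↔
      (∃ j < len φ d, d' = (φ ^ (j : ℤ)) d ∧ z = arc (len φ d) (j : ℤ) * z') ∨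
      ∃ j < len φ d, ∃ j' < len φ d', ∃ s s' : unitInterval,
        point ((φ ^ (j : ℤ)) d) s = point ((φ ^ (j' : ℤ)) d') s' ∧
        arc (len φ d) ((((j : ℤ) : ℝ) + s : ℝ) : ℂ) = z ∧
        arc (len φ d') ((((j' : ℤ) : ℝ) + s' : ℝ) : ℂ) = z' := by
  constructor
  · intro h
    rcases hz.lt_or_eq with hlt | hone
    · obtain ⟨i, hi, hi'⟩ := exists_zpow_of_disc_eq hlt hz' h
      obtain ⟨j, hj, hzpow, harc⟩ := exists_lt_len (φ := φ) d i
      exact Or.inl ⟨j, hj, hzpow ▸ hi, harc ▸ hi'⟩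
    · obtain ⟨x, rfl⟩ := exists_arc_ofReal_eq (len_pos φ d) hone
      obtain ⟨x', rfl⟩ :=
        exists_arc_ofReal_eq (len_pos φ d') (norm_eq_one_of_disc_eq hone hz' h)
      rw [disc_arc_eq_disc_arc_iff] at h
      obtain ⟨j, hj, s, hpoint, harc⟩ := exists_lt_len_unitInterval d x
      obtain ⟨j', hj', s', hpoint', harc'⟩ := exists_lt_len_unitInterval d' x'
      exact Or.inr ⟨j, hj, j', hj', s, s', by rw [← hpoint, ← hpoint', h], harc.symm, harc'.symm⟩
  · rintro (⟨j, -, rfl, rfl⟩ | ⟨j, -, j', -, s, s', h, rfl, rfl⟩)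
    · exact disc_arc_mul d j hz'
    · rwa [disc_arc_eq_disc_arc_iff, edgePoint_int_add_unitInterval hφ,
        edgePoint_int_add_unitInterval hφ]

theorem isClosed_setOf_disc_eq [Finite Γ.D] (hφ : IsFacePerm φ) (d d' : Γ.D) :
    IsClosed {p : ℂ × ℂ | ‖p.1‖ ≤ 1 ∧ ‖p.2‖ ≤ 1 ∧ disc φ d p.1 = disc φ d' p.2} := by
  let inner (j : ℕ) : Set (ℂ × ℂ) := {p | d' = (φ ^ (j : ℤ)) d ∧ p.1 = arc (len φ d) (j : ℤ) * p.2}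
  let rim (j j' : ℕ) : Set (ℂ × ℂ) := (fun p : unitInterval × unitInterval =>
      (arc (len φ d) ((((j : ℤ) : ℝ) + p.1 : ℝ) : ℂ),
        arc (len φ d') ((((j' : ℤ) : ℝ) + p.2 : ℝ) : ℂ))) ''
    {p | point ((φ ^ (j : ℤ)) d) p.1 = point ((φ ^ (j' : ℤ)) d') p.2}
  have hinner (j : ℕ) : IsClosed (inner j) :=
    isClosed_const.and (isClosed_eq (by fun_prop) (by fun_prop))
  have hrim (j j' : ℕ) : IsClosed (rim j j') :=
    ((isClosed_setOf_point_eq _ _).isCompact.image (Continuous.prodMk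
      ((continuous_arc _).comp (by fun_prop)) ((continuous_arc _).comp (by fun_prop)))).isClosed
  have hdecomp : {p : ℂ × ℂ | ‖p.1‖ ≤ 1 ∧ ‖p.2‖ ≤ 1 ∧ disc φ d p.1 = disc φ d' p.2}
      = {p | ‖p.1‖ ≤ 1 ∧ ‖p.2‖ ≤ 1} ∩ ((⋃ j ∈ Finset.range (len φ d), inner j) ∪
        ⋃ j ∈ Finset.range (len φ d), ⋃ j' ∈ Finset.range (len φ d'), rim j j') := by
    ext ⟨z, z'⟩
    simp only [Set.mem_inter_iff, Set.mem_ofPred_eq, ← and_assoc]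
    refine and_congr_right fun ⟨hz, hz'⟩ => ?_
    simp only [disc_eq_disc_iff hφ hz hz', Set.mem_union, Set.mem_iUnion, Finset.mem_range,
      exists_prop, inner, rim, Set.mem_image, Set.mem_ofPred_eq, Prod.mk.injEq, Prod.exists]
  rw [hdecomp]
  refine IsClosed.inter ((isClosed_le (by fun_prop) (by fun_prop)).and
    (isClosed_le (by fun_prop) (by fun_prop))) (IsClosed.union ?_ ?_)
  · exact isClosed_biUnion_finset fun j _ => hinner j
  · exact isClosed_biUnion_finset fun j _ => isClosed_biUnion_finset fun j' _ => hrim j j'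

theorem isClosed_ker_surfaceMk [Finite Γ.D] (hφ : IsFacePerm φ) :
    IsClosed {p : Discs Γ × Discs Γ | Surface.mk φ p.1 = Surface.mk φ p.2} := by
  have hdecomp : {p : Discs Γ × Discs Γ | Surface.mk φ p.1 = Surface.mk φ p.2}
      = ⋃ d, ⋃ d', (Prod.map (Sigma.mk d) (Sigma.mk d')) ''
        ((Prod.map Subtype.val Subtype.val) ⁻¹'
          {p : ℂ × ℂ | ‖p.1‖ ≤ 1 ∧ ‖p.2‖ ≤ 1 ∧ disc φ d p.1 = disc φ d' p.2}) := by
    ext ⟨⟨d, z⟩, ⟨d', z'⟩⟩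
    simp only [Set.mem_iUnion]
    constructor
    · intro h
      refine ⟨d, d', (z, z'), ⟨mem_closedBall_zero_iff.1 z.2, mem_closedBall_zero_iff.1 z'.2, ?_⟩,
        rfl⟩
      exact (disc_of_mem d z.2).trans (h.trans (disc_of_mem d' z'.2).symm)
    · rintro ⟨d, d', ⟨z, z'⟩, ⟨-, -, h⟩, he⟩
      rw [← he]
      exact (disc_of_mem d z.2).symm.trans (h.trans (disc_of_mem d' z'.2))
  rw [hdecomp]
  refine isClosed_iUnion_of_finite fun d => isClosed_iUnion_of_finite fun d' => ?_
  refine (Topology.IsClosedEmbedding.sigmaMk.prodMap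
    Topology.IsClosedEmbedding.sigmaMk).isClosedMap _ ?_
  exact (isClosed_setOf_disc_eq hφ d d').preimage (by fun_prop)

theorem IsFacePerm.t2Space [Finite Γ.D] (hφ : IsFacePerm φ) : T2Space (Surface φ) :=
  t2Space_of_isClosedMap Surface.isQuotientMap_mk.continuous Surface.isQuotientMap_mk.surjective
    (isClosedMap_of_isClosed_ker Surface.isQuotientMap_mk (isClosed_ker_surfaceMk hφ))

end

/-! ### The embedding of the graph in the surface -/

section

variable {Γ : Multigraph} {φ : Perm Γ.D}

/-- The embedding of the graph in the surface, an edge being sent to the boundary of a disc; by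
`embed_edgePoint` it does not matter which of the discs containing the edge is chosen. -/
def embed (hφ : IsFacePerm φ) (y : Γ.Realization) : Surface φ :=
  disc φ (exists_edgePoint_eq hφ y).choose
    (arc (len φ (exists_edgePoint_eq hφ y).choose) (exists_edgePoint_eq hφ y).choose_spec.choose)

/-- The open disc of the surface at the directed edge `d`. -/
def face (φ : Perm Γ.D) (d : Γ.D) : Set (Surface φ) := disc φ d '' Metric.ball 0 1

theorem embed_edgePoint [Finite Γ.D] (hφ : IsFacePerm φ) (d : Γ.D) (x : ℝ) :
    embed hφ (edgePoint φ d x) = disc φ d (arc (len φ d) x) := by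
  rw [embed, disc_arc_eq_disc_arc_iff]
  exact (exists_edgePoint_eq hφ _).choose_spec.choose_spec

theorem embed_point [Finite Γ.D] (hφ : IsFacePerm φ) (d : Γ.D) (s : unitInterval) :
    embed hφ (point d s) = disc φ d (arc (len φ d) (s : ℝ)) := by
  rw [← edgePoint_unitInterval hφ, embed_edgePoint]

theorem embed_injective [Finite Γ.D] (hφ : IsFacePerm φ) : Function.Injective (embed hφ) := by
  intro y y' h
  obtain ⟨d, x, rfl⟩ := exists_edgePoint_eq hφ y
  obtain ⟨d', x', rfl⟩ := exists_edgePoint_eq hφ y'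
  rwa [embed_edgePoint, embed_edgePoint, disc_arc_eq_disc_arc_iff] at h

theorem continuous_embed [Finite Γ.D] (hφ : IsFacePerm φ) : Continuous (embed hφ) := by
  rw [continuous_realization_iff]
  intro d
  simp only [embed_point]
  refine (continuousOn_disc d).comp_continuous ((continuous_arc _).comp (by fun_prop)) fun s => ?_
  exact mem_closedBall_zero_iff.2 (norm_arc_ofReal _ _).le

theorem disc_mem_range_embed [Finite Γ.D] (hφ : IsFacePerm φ) {d : Γ.D} {z : ℂ} (hz : ‖z‖ ≤ 1) :
    disc φ d z ∈ Set.range (embed hφ) ↔ ‖z‖ = 1 := by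
  constructor
  · rintro ⟨y, hy⟩
    obtain ⟨d', x', rfl⟩ := exists_edgePoint_eq hφ y
    rw [embed_edgePoint] at hy
    exact norm_eq_one_of_disc_eq (norm_arc_ofReal _ _) hz hy
  · intro h
    obtain ⟨x, rfl⟩ := exists_arc_ofReal_eq (len_pos φ d) h
    exact ⟨_, embed_edgePoint hφ d x⟩

theorem disc_mem_face [Finite Γ.D] {d d' : Γ.D} {z : ℂ} (hz : ‖z‖ ≤ 1) :
    disc φ d' z ∈ face φ d ↔ ‖z‖ < 1 ∧ φ.SameCycle d d' := by
  constructor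
  · rintro ⟨z', hz', h⟩
    rw [mem_ball_zero_iff] at hz'
    obtain ⟨i, rfl, rfl⟩ := exists_zpow_of_disc_eq hz' hz h
    rw [norm_mul, norm_arc_intCast, one_mul] at hz'
    exact ⟨hz', i, rfl⟩
  · rintro ⟨h, i, rfl⟩
    refine ⟨arc (len φ d) i * z, ?_, disc_arc_mul d i hz⟩
    rwa [mem_ball_zero_iff, norm_mul, norm_arc_intCast, one_mul]

theorem isOpen_face [Finite Γ.D] (d : Γ.D) : IsOpen (face φ d) := by
  refine isOpen_surface_of fun d' => ⟨{z | ‖z‖ < 1 ∧ φ.SameCycle d d'}, ?_, fun z hz => ?_⟩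
  · exact (isOpen_lt continuous_norm continuous_const).and isOpen_const
  · exact disc_mem_face hz

theorem center_mem_face (d : Γ.D) : disc φ d 0 ∈ face φ d :=
  ⟨0, Metric.mem_ball_self one_pos, rfl⟩

theorem face_eq_iff [Finite Γ.D] {d d' : Γ.D} : face φ d = face φ d' ↔ φ.SameCycle d d' := by
  constructor
  · intro h
    have hcenter : disc φ d' 0 ∈ face φ d := h ▸ center_mem_face d'
    exact ((disc_mem_face (norm_zero.trans_le zero_le_one)).1 hcenter).2
  · intro h
    ext y
    obtain ⟨d'', z, hz, rfl⟩ := exists_disc_eq y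
    rw [disc_mem_face hz, disc_mem_face hz]
    exact and_congr_right fun _ => ⟨h.symm.trans, h.trans⟩

theorem isPreconnected_face (d : Γ.D) : IsPreconnected (face φ d) :=
  ((convex_ball (0 : ℂ) 1).isPreconnected).image _
    ((continuousOn_disc d).mono Metric.ball_subset_closedBall)

theorem compl_range_embed [Finite Γ.D] (hφ : IsFacePerm φ) :
    (Set.range (embed hφ))ᶜ = ⋃ d, face φ d := by
  ext y
  obtain ⟨d, z, hz, rfl⟩ := exists_disc_eq y
  rw [Set.mem_compl_iff, disc_mem_range_embed hφ hz, Set.mem_iUnion]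
  constructor
  · intro h
    exact ⟨d, (disc_mem_face hz).2 ⟨lt_of_le_of_ne hz h, Equiv.Perm.SameCycle.refl _ _⟩⟩
  · rintro ⟨d', h⟩
    exact ((disc_mem_face hz).1 h).1.ne

theorem connectedComponentIn_face [Finite Γ.D] (hφ : IsFacePerm φ) {d : Γ.D} {y : Surface φ}
    (hy : y ∈ face φ d) : connectedComponentIn (Set.range (embed hφ))ᶜ y = face φ d := by
  set others := ⋃ d' ∈ {d' | ¬ φ.SameCycle d d'}, face φ d'
  have hdisj : Disjoint (face φ d) others := by
    rw [Set.disjoint_left]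
    rintro x hx hx'
    obtain ⟨d'', z, hz, rfl⟩ := exists_disc_eq x
    obtain ⟨d', hd', hx'⟩ := Set.mem_iUnion₂.1 hx'
    rw [disc_mem_face hz] at hx hx'
    exact hd' (hx.2.trans hx'.2.symm)
  have hunion : (Set.range (embed hφ))ᶜ = face φ d ∪ others := by
    rw [compl_range_embed]
    refine Set.Subset.antisymm (Set.iUnion_subset fun d' => ?_) (Set.union_subset
      (Set.subset_iUnion _ d) (Set.iUnion₂_subset fun d' _ => Set.subset_iUnion _ d'))
    by_cases h : φ.SameCycle d d'
    · exact face_eq_iff.2 h ▸ Set.subset_union_left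
    · exact (Set.subset_biUnion_of_mem (u := fun d' => face φ d') h).trans Set.subset_union_right
  rw [hunion]
  exact connectedComponentIn_eq_of_isOpen (isOpen_face d)
    (isOpen_biUnion fun d' _ => isOpen_face d') hdisj (isPreconnected_face d) hy

theorem faces_embed [Finite Γ.D] (hφ : IsFacePerm φ) : faces (embed hφ) = Set.range (face φ) := by
  ext F
  constructor
  · rintro ⟨y, hy, rfl⟩
    rw [compl_range_embed] at hy
    obtain ⟨d, hd⟩ := Set.mem_iUnion.1 hy
    exact ⟨d, (connectedComponentIn_face hφ hd).symm⟩
  · rintro ⟨d, rfl⟩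
    refine ⟨disc φ d 0, ?_, (connectedComponentIn_face hφ (center_mem_face d)).symm⟩
    rw [compl_range_embed]
    exact Set.mem_iUnion.2 ⟨d, center_mem_face d⟩

theorem exists_face_chart [Finite Γ.D] (hφ : IsFacePerm φ) (d : Γ.D) :
    ∃ e : OpenPartialHomeomorph (Surface φ) ℂ, e.source = face φ d ∧ e.target = Metric.ball 0 1 ∧
      ∀ z, e.symm z = disc φ d z := by
  have := hφ.t2Space
  exact exists_openPartialHomeomorph_of_isCompact (isCompact_closedBall (0 : ℂ) 1)
    Metric.isOpen_ball Metric.ball_subset_closedBall (continuousOn_disc d) (disc_injOn d)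
    (fun z hz h => mem_ball_zero_iff.2 ((disc_mem_face (mem_closedBall_zero_iff.1 hz)).1 h).1)
    (isOpen_face d)

theorem closure_face [Finite Γ.D] (hφ : IsFacePerm φ) (d : Γ.D) :
    closure (face φ d) = disc φ d '' Metric.closedBall 0 1 := by
  have := hφ.t2Space
  have hball := closure_ball (0 : ℂ) one_ne_zero
  rw [face, ← hball, image_closure_of_isCompact]
  · exact hball ▸ isCompact_closedBall 0 1
  · exact hball ▸ continuousOn_disc d

theorem frontier_face [Finite Γ.D] (hφ : IsFacePerm φ) (d : Γ.D) :
    frontier (face φ d) = Set.range fun x : ℝ => embed hφ (edgePoint φ d x) := by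
  rw [(isOpen_face d).frontier_eq, closure_face hφ]
  ext y
  constructor
  · rintro ⟨⟨z, hz, rfl⟩, h⟩
    rw [mem_closedBall_zero_iff] at hz
    rw [disc_mem_face hz, and_iff_left (Equiv.Perm.SameCycle.refl _ _), not_lt] at h
    obtain ⟨x, rfl⟩ := exists_arc_ofReal_eq (len_pos φ d) (le_antisymm hz h)
    exact ⟨x, embed_edgePoint hφ d x⟩
  · rintro ⟨x, rfl⟩
    have hx := norm_arc_ofReal (len φ d) x
    simp only [embed_edgePoint]
    refine ⟨⟨_, mem_closedBall_zero_iff.2 hx.le, rfl⟩, fun h => ?_⟩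
    exact ((disc_mem_face hx.le).1 h).1.ne hx

theorem isBoundaryWalk_face [Finite Γ.D] (hφ : IsFacePerm φ) (d : Γ.D) :
    IsBoundaryWalk (embed hφ) (face φ d) φ d := by
  refine ⟨disc φ d, continuousOn_disc d, (disc_injOn d).bijOn_image, fun j s => ?_⟩
  rw [← zpow_natCast, ← edgePoint_int_add_unitInterval hφ d j s, embed_edgePoint]
  rfl

/-- The directed edges, in both directions, of the closed walk `d, φ d, φ² d, …`; these turn out to
be the edges on the boundary of the face at `d`. -/
def walkEdges (φ : Perm Γ.D) (d : Γ.D) : Set Γ.D :=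
  {e | φ.SameCycle d e ∨ φ.SameCycle d (Γ.rev e)}

theorem embed_point_zpow_mem_frontier [Finite Γ.D] (hφ : IsFacePerm φ) (d : Γ.D) (i : ℤ)
    (s : unitInterval) : embed hφ (point ((φ ^ i) d) s) ∈ frontier (face φ d) := by
  rw [frontier_face hφ]
  exact ⟨i + s, congrArg _ (edgePoint_int_add_unitInterval hφ d i s)⟩

theorem boundaryEdges_face [Finite Γ.D] (hφ : IsFacePerm φ) (d : Γ.D) :
    boundaryEdges (embed hφ) (face φ d) = walkEdges φ d := by
  ext e
  constructor
  · intro h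
    obtain ⟨s, hs0, hs1⟩ : ∃ s : unitInterval, s ≠ 0 ∧ s ≠ 1 :=
      let ⟨s, h0, h1⟩ := exists_between (zero_lt_one (α := unitInterval))
      ⟨s, h0.ne', h1.ne⟩
    have hs := h s
    rw [frontier_face hφ] at hs
    obtain ⟨x, hx⟩ := hs
    rcases eq_or_rev_of_point_eq hs0 hs1 (embed_injective hφ hx).symm with ⟨he, -⟩ | ⟨he, -⟩
    · exact Or.inl ⟨_, he⟩
    · exact Or.inr ⟨_, he⟩
  · rintro (⟨i, rfl⟩ | ⟨i, hi⟩) s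
    · exact embed_point_zpow_mem_frontier hφ d i s
    · rw [← point_rev, ← hi]
      exact embed_point_zpow_mem_frontier hφ d i _

theorem frontier_face_eq_image_boundaryEdges [Finite Γ.D] (hφ : IsFacePerm φ) (d : Γ.D) :
    frontier (face φ d) =
      {y | ∃ e ∈ boundaryEdges (embed hφ) (face φ d), ∃ s, y = embed hφ (point e s)} := by
  ext y
  constructor
  · rw [frontier_face hφ]
    rintro ⟨x, rfl⟩
    refine ⟨(φ ^ ⌊x⌋) d, ?_, _, rfl⟩
    rw [boundaryEdges_face hφ]
    exact Or.inl ⟨_, rfl⟩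
  · rintro ⟨e, he, s, rfl⟩
    exact he s

theorem isPreconnected_closedCell (d : Γ.D) :
    IsPreconnected (disc φ d '' Metric.closedBall 0 1) :=
  (convex_closedBall (0 : ℂ) 1).isPreconnected.image _ (continuousOn_disc d)

theorem embed_point_mem_closedCell [Finite Γ.D] (hφ : IsFacePerm φ) (d : Γ.D) (s : unitInterval) :
    embed hφ (point d s) ∈ disc φ d '' Metric.closedBall 0 1 := by
  rw [embed_point]
  exact Set.mem_image_of_mem _ (mem_closedBall_zero_iff.2 (norm_arc_ofReal _ _).le)

theorem isCellularEmbedding_embed [Finite Γ.D] {ρ : Perm Γ.D} (hρ : IsRotation ρ)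
    (hφ : IsFacePerm (ρ * Γ.revPerm)) : IsCellularEmbedding ρ (embed hφ) where
  rotation := hρ
  continuous := continuous_embed hφ
  injective := embed_injective hφ
  cellular := by
    rw [faces_embed]
    rintro _ ⟨d, rfl⟩
    obtain ⟨e, hsource, htarget, -⟩ := exists_face_chart hφ d
    rw [← hsource, ← htarget]
    exact ⟨e.toHomeomorphSourceTarget⟩
  boundaries := ⟨face _, (faces_embed hφ).symm, fun _ _ => face_eq_iff, isBoundaryWalk_face hφ⟩

end

/-! ### Face-coloured maps -/

section

variable {Γ : Multigraph} {φ : Perm Γ.D}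

/-- The closed walk `d, φ d, φ² d, …`, indexed by residues modulo its length. -/
def walk (φ : Perm Γ.D) (d : Γ.D) (i : ZMod (len φ d)) : Γ.D := (φ ^ (i.cast : ℤ)) d

theorem zpow_apply_eq_zpow_apply_iff_zmod {d : Γ.D} {i j : ℤ} :
    (φ ^ i) d = (φ ^ j) d ↔ (i : ZMod (len φ d)) = j := by
  rw [zpow_apply_eq_zpow_apply_iff, ← ZMod.intCast_zmod_eq_zero_iff_dvd, Int.cast_sub, sub_eq_zero]

theorem walk_intCast (d : Γ.D) (i : ℤ) : walk φ d i = (φ ^ i) d :=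
  zpow_apply_eq_zpow_apply_iff_zmod.2 (ZMod.intCast_zmod_cast _)

theorem walk_add_one (d : Γ.D) (i : ZMod (len φ d)) : walk φ d (i + 1) = φ (walk φ d i) := by
  obtain ⟨i, rfl⟩ := ZMod.intCast_surjective i
  rw [← Int.cast_one, ← Int.cast_add, walk_intCast, walk_intCast, add_comm, zpow_one_add,
    Equiv.Perm.mul_apply]

theorem sameCycle_iff_mem_range_walk {d e : Γ.D} : φ.SameCycle d e ↔ e ∈ Set.range (walk φ d) := by
  constructor
  · rintro ⟨i, rfl⟩
    exact ⟨i, walk_intCast d i⟩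
  · rintro ⟨i, rfl⟩
    exact ⟨_, rfl⟩

theorem walkEdges_eq_range_walk (d : Γ.D) :
    walkEdges φ d = Set.range (walk φ d) ∪ Set.range (fun i => Γ.rev (walk φ d i)) := by
  ext e
  simp only [walkEdges, Set.mem_ofPred_eq, Set.mem_union, Set.mem_range,
    sameCycle_iff_mem_range_walk]
  refine or_congr_right (exists_congr fun i => ⟨fun h => ?_, fun h => ?_⟩)
  · rw [h, Γ.rev_rev]
  · rw [← h, Γ.rev_rev]

theorem self_mem_walkEdges (d : Γ.D) : d ∈ walkEdges φ d :=
  Or.inl (Equiv.Perm.SameCycle.refl _ _)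

theorem rev_mem_walkEdges_iff {d e : Γ.D} : Γ.rev e ∈ walkEdges φ d ↔ e ∈ walkEdges φ d := by
  simp only [walkEdges, Set.mem_ofPred_eq, Γ.rev_rev, or_comm]

theorem walkEdges_eq_of_sameCycle {d d' : Γ.D} (h : φ.SameCycle d d') :
    walkEdges φ d = walkEdges φ d' := by
  ext e
  exact or_congr ⟨h.symm.trans, h.trans⟩ ⟨h.symm.trans, h.trans⟩

/-- A map on a closed orientable surface, given by the rotation `ρ` of its connected graph, whose
faces are coloured by the signs of the directed edges on their boundary walks, and pass through
every vertex at most once. -/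
structure IsColouredMap (ρ : Perm Γ.D) (sgn : Γ.D → ℤˣ) : Prop where
  rotation : IsRotation ρ
  sgn_rev : ∀ d, sgn (Γ.rev d) = -sgn d
  sgn_rotation : ∀ d, sgn (ρ d) = -sgn d
  head_ne_tail : ∀ d, Γ.head d ≠ Γ.tail d
  simple : ∀ d (i : ℤ), Γ.tail (((ρ * Γ.revPerm) ^ i) d) = Γ.tail d →
    ((ρ * Γ.revPerm) ^ i) d = d
  tail_surjective : Function.Surjective Γ.tail
  connected : ∀ x y, Relation.ReflTransGen (fun x y => ∃ d, Γ.tail d = x ∧ Γ.head d = y) x y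

namespace IsColouredMap

variable {ρ : Perm Γ.D} {sgn : Γ.D → ℤˣ}

theorem isFacePerm (h : IsColouredMap ρ sgn) : IsFacePerm (ρ * Γ.revPerm) where
  tail_apply d := ((h.rotation (Γ.rev d) (ρ (Γ.rev d))).1 ⟨1, by rw [zpow_one]⟩).symm
  tail_surjective := h.tail_surjective

theorem sgn_facePerm (h : IsColouredMap ρ sgn) (d : Γ.D) : sgn ((ρ * Γ.revPerm) d) = sgn d := by
  change sgn (ρ (Γ.rev d)) = sgn d
  rw [h.sgn_rotation, h.sgn_rev, neg_neg]

theorem sgn_zpow (h : IsColouredMap ρ sgn) (d : Γ.D) (i : ℤ) :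
    sgn (((ρ * Γ.revPerm) ^ i) d) = sgn d := by
  have hsemi := semiconj_zpow (b := (1 : Perm ℤˣ)) h.sgn_facePerm i d
  rwa [one_zpow] at hsemi

theorem sgn_eq_of_sameCycle (h : IsColouredMap ρ sgn) {d d' : Γ.D}
    (hd : (ρ * Γ.revPerm).SameCycle d d') : sgn d' = sgn d := by
  obtain ⟨i, rfl⟩ := hd
  exact h.sgn_zpow d i

theorem not_sameCycle_rev (h : IsColouredMap ρ sgn) {d d' e : Γ.D} (hs : sgn d = sgn d')
    (hd : (ρ * Γ.revPerm).SameCycle d e) : ¬ (ρ * Γ.revPerm).SameCycle d' (Γ.rev e) := by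
  intro hd'
  have hneg := h.sgn_eq_of_sameCycle hd'
  rw [h.sgn_rev, h.sgn_eq_of_sameCycle hd, hs] at hneg
  exact neg_units_ne_self _ hneg

theorem two_le_len [Finite Γ.D] (h : IsColouredMap ρ sgn) (d : Γ.D) :
    2 ≤ len (ρ * Γ.revPerm) d := by
  by_contra! hlt
  have hone : len (ρ * Γ.revPerm) d = 1 := by
    have := len_pos (ρ * Γ.revPerm) d
    omega
  refine h.head_ne_tail d ?_
  rw [← h.isFacePerm.tail_apply, Function.minimalPeriod_eq_one_iff_isFixedPt.1 hone]

theorem tail_walk_injective (h : IsColouredMap ρ sgn) (d : Γ.D) :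
    Function.Injective fun i => Γ.tail (walk (ρ * Γ.revPerm) d i) := by
  intro i j hij
  obtain ⟨i, rfl⟩ := ZMod.intCast_surjective i
  obtain ⟨j, rfl⟩ := ZMod.intCast_surjective j
  simp only [walk_intCast] at hij
  have hshift : ((ρ * Γ.revPerm) ^ (j - i)) (((ρ * Γ.revPerm) ^ i) d) =
      ((ρ * Γ.revPerm) ^ j) d := by
    rw [← Equiv.Perm.mul_apply, ← zpow_add, sub_add_cancel]
  have hfix := h.simple (((ρ * Γ.revPerm) ^ i) d) (j - i) (by rw [hshift, hij])
  exact (zpow_apply_eq_zpow_apply_iff_zmod.1 (hshift.symm.trans hfix)).symm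

theorem isCycle_walkEdges [Finite Γ.D] (h : IsColouredMap ρ sgn) (d : Γ.D) :
    IsCycle (len (ρ * Γ.revPerm) d) (walkEdges (ρ * Γ.revPerm) d) := by
  refine ⟨h.two_le_len d, walk _ d, fun i => ?_, h.tail_walk_injective d, fun i j hij => ?_,
    walkEdges_eq_range_walk d⟩
  · rw [walk_add_one, h.isFacePerm.tail_apply]
  · exact h.not_sameCycle_rev rfl (sameCycle_iff_mem_range_walk.2 ⟨j, rfl⟩)
      (hij ▸ sameCycle_iff_mem_range_walk.2 ⟨i, rfl⟩)

theorem sameCycle_of_mem_walkEdges (h : IsColouredMap ρ sgn) {d d' e : Γ.D}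
    (hs : sgn d = sgn d') (hd : e ∈ walkEdges (ρ * Γ.revPerm) d)
    (hd' : e ∈ walkEdges (ρ * Γ.revPerm) d') : (ρ * Γ.revPerm).SameCycle d d' := by
  rcases hd with hd | hd <;> rcases hd' with hd' | hd'
  · exact hd.trans hd'.symm
  · exact absurd hd' (h.not_sameCycle_rev hs hd)
  · exact absurd hd (h.not_sameCycle_rev hs.symm hd')
  · exact hd.trans hd'.symm

theorem exists_sgn_eq_mem_walkEdges (h : IsColouredMap ρ sgn) (ε : ℤˣ) (e : Γ.D) :
    ∃ d, sgn d = ε ∧ e ∈ walkEdges (ρ * Γ.revPerm) d := by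
  by_cases he : sgn e = ε
  · exact ⟨e, he, self_mem_walkEdges e⟩
  · refine ⟨Γ.rev e, ?_, rev_mem_walkEdges_iff.1 (self_mem_walkEdges _)⟩
    rw [h.sgn_rev, Int.units_ne_iff_eq_neg.1 he, neg_neg]

theorem isCycleDecomposition [Finite Γ.D] (h : IsColouredMap ρ sgn) (ε : ℤˣ) (l : ℕ)
    (hl : ∀ d, sgn d = ε → len (ρ * Γ.revPerm) d = l) :
    IsCycleDecomposition l (walkEdges (ρ * Γ.revPerm) '' {d | sgn d = ε}) := by
  constructor
  · rintro _ ⟨d, hd, rfl⟩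
    rw [← hl d hd]
    exact h.isCycle_walkEdges d
  · intro e
    obtain ⟨d, hd, he⟩ := h.exists_sgn_eq_mem_walkEdges ε e
    refine ⟨_, ⟨⟨d, hd, rfl⟩, he⟩, ?_⟩
    rintro _ ⟨⟨d', hd', rfl⟩, he'⟩
    exact walkEdges_eq_of_sameCycle
      (h.sameCycle_of_mem_walkEdges ((show sgn d' = ε from hd').trans hd.symm) he' he)

theorem pairwiseDisjoint_boundaryEdges [Finite Γ.D] (h : IsColouredMap ρ sgn) (ε : ℤˣ) :
    (face (ρ * Γ.revPerm) '' {d | sgn d = ε}).PairwiseDisjoint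
      (boundaryEdges (embed h.isFacePerm)) := by
  rintro _ ⟨d, hd : sgn d = ε, rfl⟩ _ ⟨d', hd' : sgn d' = ε, rfl⟩ hne
  refine Set.disjoint_left.2 fun e he he' => hne ?_
  rw [boundaryEdges_face] at he he'
  exact face_eq_iff.2 (h.sameCycle_of_mem_walkEdges (hd.trans hd'.symm) he he')

theorem bijOn_boundaryEdges [Finite Γ.D] (h : IsColouredMap ρ sgn) (ε : ℤˣ) :
    Set.BijOn (boundaryEdges (embed h.isFacePerm)) (face (ρ * Γ.revPerm) '' {d | sgn d = ε})
      (walkEdges (ρ * Γ.revPerm) '' {d | sgn d = ε}) := by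
  refine ⟨?_, ?_, ?_⟩
  · rintro _ ⟨d, hd, rfl⟩
    exact ⟨d, hd, (boundaryEdges_face h.isFacePerm d).symm⟩
  · rintro _ ⟨d, hd : sgn d = ε, rfl⟩ _ ⟨d', hd' : sgn d' = ε, rfl⟩ he
    rw [boundaryEdges_face, boundaryEdges_face] at he
    exact face_eq_iff.2 (h.sameCycle_of_mem_walkEdges (hd.trans hd'.symm) (self_mem_walkEdges d)
      (he ▸ self_mem_walkEdges d))
  · rintro _ ⟨d, hd, rfl⟩
    exact ⟨_, ⟨d, hd, rfl⟩, boundaryEdges_face h.isFacePerm d⟩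

theorem disjoint_image_face [Finite Γ.D] (h : IsColouredMap ρ sgn) {ε ε' : ℤˣ} (hne : ε ≠ ε') :
    Disjoint (face (ρ * Γ.revPerm) '' {d | sgn d = ε})
      (face (ρ * Γ.revPerm) '' {d | sgn d = ε'}) := by
  rw [Set.disjoint_left]
  rintro _ ⟨d, hd : sgn d = ε, rfl⟩ ⟨d', hd' : sgn d' = ε', he⟩
  exact hne (hd.symm.trans ((h.sgn_eq_of_sameCycle (face_eq_iff.1 he)).trans hd'))

theorem isBiembedding_embed [Finite Γ.D] (h : IsColouredMap ρ sgn) (l l' : ℕ)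
    (hl : ∀ d, sgn d = -1 → len (ρ * Γ.revPerm) d = l)
    (hl' : ∀ d, sgn d = 1 → len (ρ * Γ.revPerm) d = l') :
    IsBiembedding l l' (walkEdges (ρ * Γ.revPerm) '' {d | sgn d = -1})
      (walkEdges (ρ * Γ.revPerm) '' {d | sgn d = 1}) (embed h.isFacePerm) where
  decomposition := h.isCycleDecomposition _ l hl
  decomposition' := h.isCycleDecomposition _ l' hl'
  continuous := continuous_embed h.isFacePerm
  injective := embed_injective h.isFacePerm
  frontier_eq := by
    rw [faces_embed]
    rintro _ ⟨d, rfl⟩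
    exact frontier_face_eq_image_boundaryEdges h.isFacePerm d
  colouring := by
    refine ⟨_, _, ?_, h.disjoint_image_face (by decide), h.pairwiseDisjoint_boundaryEdges (-1),
      h.pairwiseDisjoint_boundaryEdges 1, h.bijOn_boundaryEdges (-1), h.bijOn_boundaryEdges 1⟩
    have hcover : {d | sgn d = -1} ∪ {d | sgn d = 1} = Set.univ :=
      Set.eq_univ_of_forall fun d => (Int.units_eq_one_or (sgn d)).symm
    rw [faces_embed, ← Set.image_union, hcover, Set.image_univ]

theorem connectedComponent_embed_vert_eq [Finite Γ.D] (h : IsColouredMap ρ sgn) (x y : Γ.V) :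
    connectedComponent (embed h.isFacePerm (vert x)) =
      connectedComponent (embed h.isFacePerm (vert y)) := by
  induction h.connected x y with
  | refl => rfl
  | tail _ hd ih =>
    obtain ⟨d, rfl, rfl⟩ := hd
    rw [ih, ← point_zero, ← point_one]
    exact connectedComponent_eq ((isPreconnected_closedCell d).subset_connectedComponent
      (embed_point_mem_closedCell _ d 0) (embed_point_mem_closedCell _ d 1))

theorem connectedSpace_surface [Finite Γ.D] [Nonempty Γ.V] (h : IsColouredMap ρ sgn) :
    ConnectedSpace (Surface (ρ * Γ.revPerm)) := by
  obtain ⟨x₀⟩ := ‹Nonempty Γ.V›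
  refine connectedSpace_iff_connectedComponent.2 ⟨embed h.isFacePerm (vert x₀), ?_⟩
  refine Set.eq_univ_of_forall fun y => ?_
  obtain ⟨d, z, hz, rfl⟩ := exists_disc_eq y
  rw [h.connectedComponent_embed_vert_eq x₀ (Γ.tail d), ← point_zero]
  exact (isPreconnected_closedCell d).subset_connectedComponent (embed_point_mem_closedCell _ d 0)
    ⟨z, mem_closedBall_zero_iff.2 hz, rfl⟩

end IsColouredMap

end

/-! ### Half-plane coordinates on the discs and corners at the vertices -/

section

variable {Γ : Multigraph} {φ ρ : Perm Γ.D}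

theorem eq_or_eq_of_edgePoint_eq_point {d e : Γ.D} {x s : ℝ} (hs : s ∈ Set.Ico (0 : ℝ) 1)
    (h : edgePoint φ d x = point e ⟨s, hs.1, hs.2.le⟩) :
    Γ.tail ((φ ^ ⌊x⌋) d) = Γ.tail e ∧ s = 0 ∧ Int.fract x = 0 ∨
      (φ ^ ⌊x⌋) d = e ∧ Int.fract x = s ∨ (φ ^ ⌊x⌋) d = Γ.rev e ∧ Int.fract x = 1 - s := by
  have hs1 : (⟨s, hs.1, hs.2.le⟩ : unitInterval) ≠ 1 := fun h1 => hs.2.ne (congrArg Subtype.val h1)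
  rcases hs.1.eq_or_lt with rfl | hs0
  · left
    have hzero :
        (⟨Int.fract x, Int.fract_nonneg x, (Int.fract_lt_one x).le⟩ : unitInterval) = 0 := by
      by_contra hne
      refine point_ne_vert _ hne (fun h1 => ?_) _ (h.trans (point_zero e))
      exact (Int.fract_lt_one x).ne (congrArg Subtype.val h1)
    rw [edgePoint, hzero, point_zero] at h
    exact ⟨vert_injective (h.trans (point_zero e)), rfl, congrArg Subtype.val hzero⟩
  · right
    rcases eq_or_rev_of_point_eq (fun h0 => hs0.ne' (congrArg Subtype.val h0)) hs1 h.symm with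
      ⟨hd, hx⟩ | ⟨hd, hx⟩
    · exact Or.inl ⟨hd, congrArg Subtype.val hx⟩
    · exact Or.inr ⟨hd, congrArg Subtype.val hx⟩

theorem exists_tail_zpow_eq_of_edgePoint_eq_point (hφ : IsFacePerm φ) {d e : Γ.D} {x s : ℝ}
    (hs : s ∈ Set.Ico (0 : ℝ) 1) (h : edgePoint φ d x = point e ⟨s, hs.1, hs.2.le⟩) :
    ∃ i : ℤ, Γ.tail ((φ ^ i) d) = Γ.tail e ∧ |x - i| = s := by
  rcases eq_or_eq_of_edgePoint_eq_point hs h with ⟨hd, rfl, hx⟩ | ⟨hd, hx⟩ | ⟨hd, hx⟩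
  · exact ⟨⌊x⌋, hd, by rw [Int.self_sub_floor, hx, abs_zero]⟩
  · exact ⟨⌊x⌋, by rw [hd], by rw [Int.self_sub_floor, hx, abs_of_nonneg hs.1]⟩
  · refine ⟨1 + ⌊x⌋, ?_, ?_⟩
    · rw [zpow_one_add, Equiv.Perm.mul_apply, hφ.tail_apply, hd, head_rev]
    · have hsub : x - ((1 + ⌊x⌋ : ℤ) : ℝ) = -s := by
        push_cast
        linarith [Int.self_sub_floor x]
      rw [hsub, abs_neg, abs_of_nonneg hs.1]

/-- The coordinate on the punctured closed disc at `d` given by the closed upper half plane, its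
universal covering; the real interval `[i, i + 1]` runs along the edge `φ ^ i d`. -/
def unroll (φ : Perm Γ.D) (d : Γ.D) (ζ : ℂ) : Surface φ := disc φ d (arc (len φ d) ζ)

/-- The point with polar coordinates `a` and `πt` around the tail of `d`: the integral part of `t`
gives the corner, in the order of the rotation `ρ⁻¹`. -/
def corner (ρ : Perm Γ.D) (d : Γ.D) (a t : ℝ) : Surface (ρ * Γ.revPerm) :=
  unroll (ρ * Γ.revPerm) ((ρ ^ (-⌊t⌋)) d) (a * arc 2 (Int.fract t : ℝ))

theorem tail_rotation_zpow (hφ : IsFacePerm (ρ * Γ.revPerm)) (d : Γ.D) (i : ℤ) :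
    Γ.tail ((ρ ^ i) d) = Γ.tail d := by
  have htail (d : Γ.D) : Γ.tail (ρ d) = Γ.tail d := by
    have hd : Γ.tail (ρ (Γ.rev (Γ.rev d))) = Γ.head (Γ.rev d) := hφ.tail_apply (Γ.rev d)
    rwa [Γ.rev_rev, head_rev] at hd
  have hsemi := semiconj_zpow (b := (1 : Perm Γ.V)) htail i d
  rwa [one_zpow] at hsemi

theorem corner_int_add (d : Γ.D) (a t : ℝ) (i : ℤ) :
    corner ρ d a (i + t) = corner ρ ((ρ ^ (-i)) d) a t := by
  rw [corner, corner, Int.floor_intCast_add, Int.fract_intCast_add, neg_add, add_comm, zpow_add,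
    Equiv.Perm.mul_apply]

theorem corner_eq_unroll_of_mem_Ico (d : Γ.D) (a : ℝ) {t : ℝ} (ht : t ∈ Set.Ico (0 : ℝ) 1) :
    corner ρ d a t = unroll (ρ * Γ.revPerm) d (a * arc 2 t) := by
  rw [corner, Int.floor_eq_zero_iff.2 ht, Int.fract_eq_self.2 ht, neg_zero, zpow_zero,
    Equiv.Perm.one_apply]

theorem corner_add_mul_len (d : Γ.D) (a t : ℝ) (n : ℤ) :
    corner ρ d a (t + n * len ρ d) = corner ρ d a t := by
  have hcomm : t + n * len ρ d = ((n * len ρ d : ℤ) : ℝ) + t := by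
    push_cast
    ring
  rw [hcomm, corner_int_add, zpow_apply_eq_self_iff.2 (Dvd.intro_left n rfl).neg_right]

variable [Finite Γ.D]

theorem norm_arc_len_le_one {d : Γ.D} {ζ : ℂ} : ‖arc (len φ d) ζ‖ ≤ 1 ↔ 0 ≤ ζ.im :=
  norm_arc_le_one (len_pos φ d)

theorem unroll_int_add (d : Γ.D) (i : ℤ) {ζ : ℂ} (hζ : 0 ≤ ζ.im) :
    unroll φ d (i + ζ) = unroll φ ((φ ^ i) d) ζ := by
  rw [unroll, unroll, len_zpow, arc_add, disc_arc_mul d i (norm_arc_len_le_one.2 hζ)]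

theorem unroll_ofReal (hφ : IsFacePerm φ) (d : Γ.D) (x : ℝ) :
    unroll φ d x = embed hφ (edgePoint φ d x) := (embed_edgePoint hφ d x).symm

theorem unroll_zero (hφ : IsFacePerm φ) (d : Γ.D) :
    unroll φ d 0 = embed hφ (vert (Γ.tail d)) := by
  rw [← Complex.ofReal_zero, unroll_ofReal hφ, edgePoint_zero]

theorem continuousOn_unroll (d : Γ.D) : ContinuousOn (unroll φ d) {ζ | 0 ≤ ζ.im} :=
  (continuousOn_disc d).comp (continuous_arc _).continuousOn fun _ hζ =>
    mem_closedBall_zero_iff.2 (norm_arc_len_le_one.2 hζ)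

theorem unroll_ne_disc_zero {d : Γ.D} {ζ : ℂ} (hζ : 0 ≤ ζ.im) (d' : Γ.D) :
    unroll φ d ζ ≠ disc φ d' 0 := by
  intro he
  obtain ⟨i, -, hi⟩ := exists_zpow_of_disc_eq (by rw [norm_zero]; exact one_pos)
    (norm_arc_len_le_one.2 hζ) he.symm
  exact mul_ne_zero (arc_ne_zero _ _) (arc_ne_zero _ _) hi.symm

theorem exists_zpow_of_unroll_eq {d d' : Γ.D} {ζ ζ' : ℂ} (hζ : 0 < ζ.im) (hζ' : 0 ≤ ζ'.im)
    (h : unroll φ d ζ = unroll φ d' ζ') : ∃ i : ℤ, d' = (φ ^ i) d ∧ ζ = i + ζ' := by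
  obtain ⟨i, rfl, hi⟩ := exists_zpow_of_disc_eq ((norm_arc_lt_one (len_pos φ d)).2 hζ)
    (norm_arc_len_le_one.2 hζ') h
  rw [len_zpow, ← arc_add, arc_eq_arc (len_pos φ d)] at hi
  obtain ⟨n, hn⟩ := hi
  refine ⟨i + n * len φ d, ?_, ?_⟩
  · rw [zpow_add, Equiv.Perm.mul_apply, zpow_apply_eq_self_iff.2 (Dvd.intro_left n rfl)]
  · rw [hn]
    push_cast
    ring

theorem im_eq_zero_of_unroll_eq {d d' : Γ.D} {x : ℝ} {ζ : ℂ} (hζ : 0 ≤ ζ.im)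
    (h : unroll φ d x = unroll φ d' ζ) : ζ.im = 0 := by
  have hnorm := norm_eq_one_of_disc_eq (norm_arc_ofReal _ _) (norm_arc_len_le_one.2 hζ) h
  exact hζ.antisymm' (not_lt.1 fun hpos => ((norm_arc_lt_one (len_pos φ d')).2 hpos).ne hnorm)

theorem unroll_neg_ofReal (hφ : IsFacePerm (ρ * Γ.revPerm)) (d : Γ.D) {a : ℝ}
    (ha : a ∈ unitInterval) :
    unroll (ρ * Γ.revPerm) d (-a) = unroll (ρ * Γ.revPerm) (ρ⁻¹ d) a := by
  have hneg : -a = ((-1 : ℤ) : ℝ) + ((unitInterval.symm ⟨a, ha⟩ : unitInterval) : ℝ) := by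
    rw [unitInterval.coe_symm_eq]
    push_cast
    ring
  rw [← Complex.ofReal_neg, unroll_ofReal hφ, unroll_ofReal hφ, hneg,
    edgePoint_int_add_unitInterval hφ, edgePoint_unitInterval hφ _ ⟨a, ha⟩, ← point_rev (ρ⁻¹ d)]
  rfl

theorem corner_eq_unroll (hφ : IsFacePerm (ρ * Γ.revPerm)) (d : Γ.D) {a t : ℝ}
    (ha : a ∈ unitInterval) (ht : t ∈ unitInterval) :
    corner ρ d a t = unroll (ρ * Γ.revPerm) d (a * arc 2 t) := by
  rcases ht.2.lt_or_eq with ht1 | rfl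
  · exact corner_eq_unroll_of_mem_Ico d a ⟨ht.1, ht1⟩
  · have hone : (1 : ℝ) = ((1 : ℤ) : ℝ) + 0 := by rw [Int.cast_one, add_zero]
    have harc : arc 2 (1 : ℝ) = -1 := by simpa using arc_two_intCast 1
    conv_lhs => rw [hone, corner_int_add, corner_eq_unroll_of_mem_Ico _ _ ⟨le_rfl, one_pos⟩]
    rw [Complex.ofReal_zero, arc_zero, mul_one, harc, mul_neg_one, unroll_neg_ofReal hφ d ha,
      zpow_neg_one]

theorem corner_zero (hφ : IsFacePerm (ρ * Γ.revPerm)) (d : Γ.D) (t : ℝ) :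
    corner ρ d 0 t = embed hφ (vert (Γ.tail d)) := by
  rw [corner, Complex.ofReal_zero, zero_mul, unroll_zero hφ, tail_rotation_zpow hφ]

theorem continuousOn_corner (hφ : IsFacePerm (ρ * Γ.revPerm)) (d : Γ.D) :
    ContinuousOn (fun p : ℝ × ℝ => corner ρ d p.1 p.2) (Set.Icc 0 1 ×ˢ Set.univ) := by
  refine continuousOn_prod_univ_of_Icc_intCast isClosed_Icc fun j => ?_
  have hmem : ∀ t ∈ Set.Icc (j : ℝ) (j + 1), t - j ∈ unitInterval := fun t ht =>
    ⟨sub_nonneg.2 ht.1, sub_le_iff_le_add'.2 ht.2⟩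
  have heq : Set.EqOn (fun p : ℝ × ℝ => corner ρ d p.1 p.2)
      (fun p => unroll (ρ * Γ.revPerm) ((ρ ^ (-j)) d) (p.1 * arc 2 ((p.2 - j : ℝ) : ℂ)))
      (Set.Icc 0 1 ×ˢ Set.Icc (j : ℝ) (j + 1)) := by
    rintro ⟨a, t⟩ ⟨ha, ht⟩
    dsimp only at ha ht ⊢
    rw [← corner_eq_unroll hφ _ ha (hmem t ht), ← corner_int_add, add_sub_cancel]
  refine ContinuousOn.congr ((continuousOn_unroll _).comp (Continuous.continuousOn ?_) ?_) heq
  · exact Continuous.mul (by fun_prop) ((continuous_arc 2).comp (by fun_prop))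
  · exact fun p hp => im_mul_arc_two_nonneg hp.1.1 (hmem _ hp.2)

end

/-! ### Discs around the vertices -/

section

variable {Γ : Multigraph} {ρ : Perm Γ.D} {sgn : Γ.D → ℤˣ}

/-- Half of the number of directed edges at the tail of `d`. -/
def halfDeg (ρ : Perm Γ.D) (d : Γ.D) : ℕ := Function.minimalPeriod ρ d / 2

/-- A parametrization of a neighbourhood of the tail of `d`, each of the `2q` corners being a sector
of angle `π / q`, for `q = halfDeg ρ d`: the radius of the sector is changed in such a way that
`w ↦ w ^ q` maps the sector to a half-disc by the coordinate `unroll`, up to sign. -/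
def star (ρ : Perm Γ.D) (d : Γ.D) (w : ℂ) : Surface (ρ * Γ.revPerm) :=
  corner ρ d (‖w‖ ^ halfDeg ρ d) (len ρ d * w.arg / (2 * Real.pi))

/-- The open disc on which `star` is injective. -/
def starDisc (ρ : Perm Γ.D) (d : Γ.D) : Set ℂ := {w | ‖w‖ ^ halfDeg ρ d < 3 / 4}

theorem isOpen_starDisc (d : Γ.D) : IsOpen (starDisc ρ d) :=
  isOpen_lt (by fun_prop) continuous_const

namespace IsColouredMap

theorem sgn_rotation_zpow (h : IsColouredMap ρ sgn) (d : Γ.D) (i : ℤ) :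
    sgn ((ρ ^ i) d) = (-1) ^ i * sgn d := by
  have hneg : Function.Semiconj sgn ρ (Equiv.mulLeft (-1 : ℤˣ)) := fun d =>
    (h.sgn_rotation d).trans (neg_one_mul _).symm
  have hpow := semiconj_zpow hneg i d
  rwa [Equiv.zpow_mulLeft, Equiv.coe_mulLeft] at hpow

theorem two_mul_halfDeg (h : IsColouredMap ρ sgn) (d : Γ.D) : 2 * halfDeg ρ d = len ρ d := by
  have hsgn := h.sgn_rotation_zpow d (len ρ d)
  rw [zpow_apply_eq_self_iff.2 dvd_rfl, right_eq_mul, zpow_natCast] at hsgn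
  refine Nat.mul_div_cancel' (even_iff_two_dvd.1 (Nat.not_odd_iff_even.1 fun hodd => ?_))
  rw [hodd.neg_one_pow] at hsgn
  exact absurd hsgn (by decide)

theorem tail_eq_iff_exists_rotation_zpow (h : IsColouredMap ρ sgn) {d e : Γ.D} :
    Γ.tail d = Γ.tail e ↔ ∃ i : ℤ, (ρ ^ i) d = e :=
  (h.rotation d e).symm

variable [Finite Γ.D]

theorem halfDeg_pos (h : IsColouredMap ρ sgn) (d : Γ.D) : 0 < halfDeg ρ d := by
  have htwo := h.two_mul_halfDeg d
  have hpos := len_pos ρ d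
  omega

theorem star_mul_arc (h : IsColouredMap ρ sgn) (d : Γ.D) {r : ℝ} (hr : 0 ≤ r) (t : ℝ) :
    star ρ d (r * arc (len ρ d) t) = corner ρ d (r ^ halfDeg ρ d) t := by
  rw [star, norm_mul_arc hr]
  rcases hr.eq_or_lt with rfl | hr
  · rw [zero_pow (h.halfDeg_pos d).ne', corner_zero h.isFacePerm, corner_zero h.isFacePerm]
  · have harc := norm_mul_arc_arg (len_pos ρ d) (r * arc (len ρ d) t)
    rw [norm_mul_arc hr.le] at harc
    obtain ⟨n, hn⟩ := (arc_eq_arc (len_pos ρ d)).1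
      (mul_left_cancel₀ (Complex.ofReal_ne_zero.2 hr.ne') harc)
    have hn' : len ρ d * ((r : ℂ) * arc (len ρ d) t).arg / (2 * Real.pi) = t + n * len ρ d := by
      exact_mod_cast hn
    rw [hn', corner_add_mul_len]

theorem continuousOn_star (h : IsColouredMap ρ sgn) (d : Γ.D) :
    ContinuousOn (star ρ d) (Metric.closedBall 0 1) := by
  refine continuousOn_closedBall_of_mul_arc (len_pos ρ d) ?_
  refine ContinuousOn.congr ((continuousOn_corner h.isFacePerm d).comp
    (f := fun p : ℝ × ℝ => (p.1 ^ halfDeg ρ d, p.2)) (by fun_prop) fun p hp => ?_)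
    fun p hp => h.star_mul_arc d hp.1.1 p.2
  exact ⟨⟨pow_nonneg hp.1.1 _, pow_le_one₀ hp.1.1 hp.1.2⟩, hp.2⟩

theorem norm_pow_mul_arc_two (h : IsColouredMap ρ sgn) (d : Γ.D) (w : ℂ) :
    ((‖w‖ ^ halfDeg ρ d : ℝ) : ℂ) * arc 2 ((len ρ d * w.arg / (2 * Real.pi) : ℝ) : ℂ) =
      w ^ halfDeg ρ d := by
  conv_rhs => rw [← norm_mul_arc_arg (len_pos ρ d) w]
  rw [mul_pow, ← zpow_natCast (arc _ _), arc_zpow, ← h.two_mul_halfDeg d, Int.cast_natCast,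
    mul_comm (halfDeg ρ d : ℂ), arc_mul_cancel (h.halfDeg_pos d), Complex.ofReal_pow]

theorem exists_star_eq_unroll (h : IsColouredMap ρ sgn) {d : Γ.D} (hd : sgn d = 1) (w : ℂ) :
    ∃ e, ∃ ζ ∈ halfPlane, Γ.tail e = Γ.tail d ∧ ‖ζ‖ = ‖w‖ ^ halfDeg ρ d ∧
      star ρ d w = unroll (ρ * Γ.revPerm) e ζ ∧ ((sgn e : ℤ) : ℂ) * ζ = w ^ halfDeg ρ d := by
  have hr : 0 ≤ ‖w‖ ^ halfDeg ρ d := by positivity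
  refine ⟨_, _, mul_arc_two_mem_halfPlane hr ⟨Int.fract_nonneg _, Int.fract_lt_one _⟩,
    tail_rotation_zpow h.isFacePerm d _, norm_mul_arc hr 2 _, rfl, ?_⟩
  rw [← h.norm_pow_mul_arc_two d w, h.sgn_rotation_zpow, hd, mul_one, zpow_neg,
    Int.units_inv_eq_self, ← arc_two_intCast, mul_left_comm, ← arc_add]
  congr 2
  exact_mod_cast Int.floor_add_fract _

/-! ### Injectivity of the parametrization -/

theorem eq_of_unroll_eq_of_im_pos (h : IsColouredMap ρ sgn) {d d' : Γ.D}
    (ht : Γ.tail d = Γ.tail d') {ζ ζ' : ℂ} (hζ : 0 < ζ.im) (hζ' : 0 ≤ ζ'.im) (hn : ‖ζ‖ < 1)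
    (hn' : ‖ζ'‖ < 1) (he : unroll (ρ * Γ.revPerm) d ζ = unroll (ρ * Γ.revPerm) d' ζ') :
    ζ = ζ' ∧ d = d' := by
  obtain ⟨i, rfl, rfl⟩ := exists_zpow_of_unroll_eq hζ hζ' he
  have hfix := h.simple d i ht.symm
  have hlt : |(i : ℝ)| < 2 := by
    rw [← Complex.norm_intCast, ← add_sub_cancel_right (i : ℂ) ζ']
    exact (norm_sub_le _ _).trans_lt (by linarith)
  have hi : i = 0 := by
    refine Int.eq_zero_of_abs_lt_dvd (zpow_apply_eq_self_iff.1 hfix) ?_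
    have htwo : (2 : ℤ) ≤ len (ρ * Γ.revPerm) d := by exact_mod_cast h.two_le_len d
    exact lt_of_lt_of_le (by exact_mod_cast hlt) htwo
  rw [hi]
  simp

theorem eq_of_unroll_ofReal_eq (h : IsColouredMap ρ sgn) {d d' : Γ.D} (ht : Γ.tail d = Γ.tail d')
    {a b : ℝ} (ha : a ∈ Set.Ico (0 : ℝ) 1) (hb : b ∈ Set.Ico (0 : ℝ) 1)
    (he : unroll (ρ * Γ.revPerm) d a = unroll (ρ * Γ.revPerm) d' b) :
    a = b ∧ (a = 0 ∨ d = d') := by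
  rw [unroll_ofReal h.isFacePerm, unroll_ofReal h.isFacePerm] at he
  have hpoint := (embed_injective h.isFacePerm he).trans
    (edgePoint_unitInterval h.isFacePerm d' ⟨b, hb.1, hb.2.le⟩)
  have hdd := eq_or_eq_of_edgePoint_eq_point hb hpoint
  rw [Int.floor_eq_zero_iff.2 ha, Int.fract_eq_self.2 ha, zpow_zero, Equiv.Perm.one_apply] at hdd
  rcases hdd with ⟨-, rfl, rfl⟩ | ⟨rfl, rfl⟩ | ⟨rfl, -⟩
  · exact ⟨rfl, Or.inl rfl⟩
  · exact ⟨rfl, Or.inr rfl⟩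
  · exact absurd ht (h.head_ne_tail d')

theorem eq_of_unroll_eq (h : IsColouredMap ρ sgn) {d d' : Γ.D} (ht : Γ.tail d = Γ.tail d')
    {ζ ζ' : ℂ} (hζ : ζ ∈ halfPlane) (hζ' : ζ' ∈ halfPlane) (hn : ‖ζ‖ < 1) (hn' : ‖ζ'‖ < 1)
    (he : unroll (ρ * Γ.revPerm) d ζ = unroll (ρ * Γ.revPerm) d' ζ') :
    ζ = ζ' ∧ (ζ = 0 ∨ d = d') := by
  rcases hζ with hpos | ⟨a, ha, rfl⟩
  · exact (h.eq_of_unroll_eq_of_im_pos ht hpos (im_nonneg_of_mem_halfPlane hζ') hn hn' he).imp_right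
      Or.inr
  · rcases hζ' with hpos' | ⟨b, hb, rfl⟩
    · exact absurd (im_eq_zero_of_unroll_eq hpos'.le he) hpos'.ne'
    · rw [Complex.norm_real, Real.norm_of_nonneg ‹_›] at hn hn'
      exact_mod_cast h.eq_of_unroll_ofReal_eq ht ⟨ha, hn⟩ ⟨hb, hn'⟩ he

theorem eq_of_corner_eq (h : IsColouredMap ρ sgn) {d : Γ.D} {a b s t : ℝ}
    (ha : a ∈ Set.Ico (0 : ℝ) 1) (hb : b ∈ Set.Ico (0 : ℝ) 1)
    (he : corner ρ d a s = corner ρ d b t) :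
    a = b ∧ (a = 0 ∨ arc (len ρ d) s = arc (len ρ d) t) := by
  have hfract (x : ℝ) : Int.fract x ∈ Set.Ico (0 : ℝ) 1 := ⟨Int.fract_nonneg x, Int.fract_lt_one x⟩
  obtain ⟨hζ, hd⟩ := h.eq_of_unroll_eq
    (by rw [tail_rotation_zpow h.isFacePerm, tail_rotation_zpow h.isFacePerm])
    (mul_arc_two_mem_halfPlane ha.1 (hfract s)) (mul_arc_two_mem_halfPlane hb.1 (hfract t))
    (by rw [norm_mul_arc ha.1]; exact ha.2) (by rw [norm_mul_arc hb.1]; exact hb.2) he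
  obtain rfl : a = b := by
    rw [← norm_mul_arc ha.1 2 (Int.fract s), hζ, norm_mul_arc hb.1]
  refine ⟨rfl, or_iff_not_imp_left.2 fun ha0 => ?_⟩
  have ha0' : (a : ℂ) ≠ 0 := Complex.ofReal_ne_zero.2 ha0
  have hst : Int.fract s = Int.fract t := by
    refine eq_of_arc_eq_of_abs_sub_lt (l := 2) ?_ (mul_left_cancel₀ ha0' hζ)
    rw [abs_sub_lt_iff]
    constructor <;> push_cast <;> linarith [(hfract s).1, (hfract s).2, (hfract t).1, (hfract t).2]
  obtain ⟨n, hn⟩ := zpow_apply_eq_zpow_apply_iff.1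
    (hd.resolve_left (mul_ne_zero ha0' (arc_ne_zero _ _)))
  refine (arc_eq_arc (len_pos ρ d)).2 ⟨-n, ?_⟩
  have hfloor : (⌊s⌋ : ℝ) = ⌊t⌋ - len ρ d * n := by exact_mod_cast (by linarith : ⌊s⌋ = _)
  rw [← Int.floor_add_fract s, ← Int.floor_add_fract t, hst, hfloor]
  push_cast
  ring

theorem star_injOn (h : IsColouredMap ρ sgn) (d : Γ.D) :
    Set.InjOn (star ρ d) {w | ‖w‖ ^ halfDeg ρ d < 1} := by
  intro w (hw : ‖w‖ ^ halfDeg ρ d < 1) w' (hw' : ‖w'‖ ^ halfDeg ρ d < 1) he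
  have hq := (h.halfDeg_pos d).ne'
  obtain ⟨hpow, harc⟩ := h.eq_of_corner_eq ⟨by positivity, hw⟩ ⟨by positivity, hw'⟩ he
  have hnorm := (pow_left_inj₀ (norm_nonneg w) (norm_nonneg w') hq).1 hpow
  rcases harc with h0 | harc
  · have hw0 : ‖w‖ = 0 := (pow_eq_zero_iff hq).1 h0
    rw [norm_eq_zero.1 hw0, norm_eq_zero.1 (hnorm.symm.trans hw0)]
  · rw [← norm_mul_arc_arg (len_pos ρ d) w, ← norm_mul_arc_arg (len_pos ρ d) w', hnorm, harc]

/-! ### Openness of the parametrization -/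

theorem unroll_mem_star (h : IsColouredMap ρ sgn) {d e : Γ.D} (ht : Γ.tail d = Γ.tail e) {ζ : ℂ}
    (h0 : 0 ≤ ζ.im) (h1 : ‖ζ‖ < 3 / 4) :
    unroll (ρ * Γ.revPerm) e ζ ∈ star ρ d '' starDisc ρ d := by
  obtain ⟨i, rfl⟩ := h.tail_eq_iff_exists_rotation_zpow.1 ht
  have hr : (‖ζ‖ ^ ((halfDeg ρ d : ℝ)⁻¹)) ^ halfDeg ρ d = ‖ζ‖ :=
    Real.rpow_inv_natCast_pow (norm_nonneg _) (h.halfDeg_pos d).ne'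
  have hr0 : 0 ≤ ‖ζ‖ ^ ((halfDeg ρ d : ℝ)⁻¹) := Real.rpow_nonneg (norm_nonneg _) _
  have ht : (2 : ℕ) * ζ.arg / (2 * Real.pi) ∈ unitInterval := by
    have harg : 0 ≤ ζ.arg := Complex.arg_nonneg_iff.2 h0
    refine ⟨by positivity, div_le_one_of_le₀ ?_ (by positivity)⟩
    push_cast
    linarith [Complex.arg_le_pi ζ]
  refine ⟨((‖ζ‖ ^ ((halfDeg ρ d : ℝ)⁻¹) : ℝ) : ℂ) * arc (len ρ d)
    ((((-i : ℤ) : ℝ) + (2 : ℕ) * ζ.arg / (2 * Real.pi) : ℝ) : ℂ), ?_, ?_⟩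
  · rw [starDisc, Set.mem_ofPred_eq, norm_mul_arc hr0, hr]
    exact h1
  · rw [h.star_mul_arc d hr0, hr, corner_int_add, neg_neg,
      corner_eq_unroll h.isFacePerm _ ⟨norm_nonneg _, by linarith⟩ ht,
      norm_mul_arc_arg two_pos]

theorem exists_norm_sub_eq_of_unroll_eq (h : IsColouredMap ρ sgn) {d e : Γ.D} {ξ ζ : ℂ}
    (hξ : 0 ≤ ξ.im) (hζ : ζ ∈ halfPlane) (hn : ‖ζ‖ < 1)
    (he : unroll (ρ * Γ.revPerm) d ξ = unroll (ρ * Γ.revPerm) e ζ) :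
    ∃ i : ℤ, Γ.tail (((ρ * Γ.revPerm) ^ i) d) = Γ.tail e ∧ ‖ξ - i‖ = ‖ζ‖ := by
  rcases hζ with hpos | ⟨a, ha, rfl⟩
  · have hpos' : 0 < ξ.im := hξ.lt_of_ne' fun hzero => by
      obtain ⟨x, rfl⟩ : ∃ x : ℝ, (x : ℂ) = ξ := ⟨ξ.re, Complex.ext rfl hzero.symm⟩
      exact hpos.ne' (im_eq_zero_of_unroll_eq hpos.le he)
    obtain ⟨i, rfl, rfl⟩ := exists_zpow_of_unroll_eq hpos' hpos.le he
    exact ⟨i, rfl, by rw [add_sub_cancel_left]⟩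
  · obtain ⟨x, rfl⟩ : ∃ x : ℝ, (x : ℂ) = ξ :=
      ⟨ξ.re, Complex.ext rfl (im_eq_zero_of_unroll_eq hξ he.symm).symm⟩
    rw [Complex.norm_real, Real.norm_of_nonneg ha] at hn ⊢
    rw [unroll_ofReal h.isFacePerm, unroll_ofReal h.isFacePerm] at he
    obtain ⟨i, hi, habs⟩ := exists_tail_zpow_eq_of_edgePoint_eq_point h.isFacePerm ⟨ha, hn⟩
      ((embed_injective h.isFacePerm he).trans
        (edgePoint_unitInterval h.isFacePerm e ⟨a, ha, hn.le⟩))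
    refine ⟨i, hi, ?_⟩
    rw [← Complex.ofReal_intCast, ← Complex.ofReal_sub, Complex.norm_real, Real.norm_eq_abs]
    exact habs

theorem unroll_mem_star_iff (h : IsColouredMap ρ sgn) {d : Γ.D} (hd : sgn d = 1) {e : Γ.D} {ξ : ℂ}
    (hξ : 0 ≤ ξ.im) :
    unroll (ρ * Γ.revPerm) e ξ ∈ star ρ d '' starDisc ρ d ↔
      ∃ i : ℤ, Γ.tail (((ρ * Γ.revPerm) ^ i) e) = Γ.tail d ∧ ‖ξ - i‖ < 3 / 4 := by
  constructor
  · rintro ⟨w, hw, he⟩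
    obtain ⟨e', ζ, hζ, htail, hnorm, hstar, -⟩ := h.exists_star_eq_unroll hd w
    have hlt : ‖ζ‖ < 3 / 4 := hnorm.trans_lt hw
    obtain ⟨i, hi, hi'⟩ :=
      h.exists_norm_sub_eq_of_unroll_eq hξ hζ (by linarith) (he.symm.trans hstar)
    exact ⟨i, hi.trans htail, hi'.trans_lt hlt⟩
  · rintro ⟨i, hi, hlt⟩
    have him : 0 ≤ (ξ - i).im := by rwa [Complex.sub_im, Complex.intCast_im, sub_zero]
    rw [← add_sub_cancel (i : ℂ) ξ, unroll_int_add e i him]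
    exact h.unroll_mem_star hi.symm him hlt

theorem star_ne_disc_zero (h : IsColouredMap ρ sgn) {d : Γ.D} (hd : sgn d = 1) (w : ℂ) (d' : Γ.D) :
    star ρ d w ≠ disc (ρ * Γ.revPerm) d' 0 := by
  obtain ⟨e, ζ, hζ, -, -, hstar, -⟩ := h.exists_star_eq_unroll hd w
  rw [hstar]
  exact unroll_ne_disc_zero (im_nonneg_of_mem_halfPlane hζ) d'

theorem isOpen_star (h : IsColouredMap ρ sgn) {d : Γ.D} (hd : sgn d = 1) :
    IsOpen (star ρ d '' starDisc ρ d) := by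
  refine isOpen_surface_of fun e => ?_
  let W : Set ℂ := ⋃ i ∈ {i : ℤ | Γ.tail (((ρ * Γ.revPerm) ^ i) e) = Γ.tail d},
    Metric.ball (i : ℂ) (3 / 4)
  have hW (ξ : ℂ) (hξ : 0 ≤ ξ.im) : unroll (ρ * Γ.revPerm) e ξ ∈ star ρ d '' starDisc ρ d ↔
      ξ ∈ W := by
    simp only [h.unroll_mem_star_iff hd hξ, W, Set.mem_iUnion, Set.mem_ofPred_eq, exists_prop,
      mem_ball_iff_norm]
  refine ⟨arc (len (ρ * Γ.revPerm) e) '' W,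
    isOpenMap_arc (len_pos _ e) _ (isOpen_biUnion fun _ _ => Metric.isOpen_ball), fun z hz => ?_⟩
  constructor
  · intro hmem
    obtain ⟨ζ, rfl⟩ := exists_arc_eq (len_pos (ρ * Γ.revPerm) e) (z := z) fun hz0 => by
      obtain ⟨w, -, hw⟩ := hmem
      exact h.star_ne_disc_zero hd w e (by rw [hw, hz0])
    exact ⟨ζ, (hW ζ (norm_arc_len_le_one.1 hz)).1 hmem, rfl⟩
  · rintro ⟨ζ, hζ, rfl⟩
    exact (hW ζ (norm_arc_len_le_one.1 hz)).2 hζ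

theorem exists_star_chart (h : IsColouredMap ρ sgn) {d : Γ.D} (hd : sgn d = 1) :
    ∃ e : OpenPartialHomeomorph (Surface (ρ * Γ.revPerm)) ℂ,
      e.source = star ρ d '' starDisc ρ d ∧ e.target = starDisc ρ d ∧
        ∀ z, e.symm z = star ρ d z := by
  have := h.isFacePerm.t2Space
  have hlt {w : ℂ} (hw : ‖w‖ ^ halfDeg ρ d ≤ 3 / 4) : ‖w‖ ^ halfDeg ρ d < 1 := by linarith
  have hUK : starDisc ρ d ⊆ {w | ‖w‖ ^ halfDeg ρ d ≤ 3 / 4} :=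
    fun w (hw : ‖w‖ ^ halfDeg ρ d < 3 / 4) => hw.le
  have hball : {w : ℂ | ‖w‖ ^ halfDeg ρ d ≤ 3 / 4} ⊆ Metric.closedBall 0 1 := fun w hw =>
    mem_closedBall_zero_iff.2 ((pow_lt_one_iff_of_nonneg (norm_nonneg w)
      (h.halfDeg_pos d).ne').1 (hlt hw)).le
  refine exists_openPartialHomeomorph_of_isCompact
    ((isCompact_closedBall (0 : ℂ) 1).of_isClosed_subset
      (isClosed_le (by fun_prop) continuous_const) hball)
    (isOpen_starDisc d) hUK ((h.continuousOn_star d).mono hball)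
    ((h.star_injOn d).mono fun w hw => hlt (hUK hw)) ?_ (h.isOpen_star hd)
  rintro w hw ⟨w', hw', he⟩
  rwa [← h.star_injOn d (hlt (hUK hw')) (hlt hw) he]

end IsColouredMap

end

/-! ### The branched map to the plane and the oriented atlas -/

section

variable {Γ : Multigraph} {ρ : Perm Γ.D} {sgn : Γ.D → ℤˣ}

/-- The map of the surface to the Riemann sphere given by `z ↦ z ^ l` on the positive faces, and by
`z ↦ z ^ (-l)` on the negative ones, `l` being the length of the boundary of the face. -/
def branch (sgn : Γ.D → ℤˣ) : Surface (ρ * Γ.revPerm) → ℂ :=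
  Surface.lift fun d z => z ^ ((len (ρ * Γ.revPerm) d : ℤ) * (sgn d : ℤ))

namespace IsColouredMap

theorem exists_tail_eq_and_sgn_eq_one (h : IsColouredMap ρ sgn) (x : Γ.V) :
    ∃ d, Γ.tail d = x ∧ sgn d = 1 := by
  obtain ⟨d, rfl⟩ := h.tail_surjective x
  rcases Int.units_eq_one_or (sgn d) with hd | hd
  · exact ⟨d, rfl, hd⟩
  · exact ⟨ρ d, (h.tail_eq_iff_exists_rotation_zpow.2 ⟨1, rfl⟩).symm,
      by rw [h.sgn_rotation, hd, neg_neg]⟩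

theorem arc_sgn_mul_eq_of_point_eq (h : IsColouredMap ρ sgn) {d d' : Γ.D} {s s' : unitInterval}
    (he : point d s = point d' s') :
    arc 1 ((sgn d : ℤ) * (s : ℝ)) = arc 1 ((sgn d' : ℤ) * (s' : ℝ)) := by
  have hvert (d : Γ.D) (s : unitInterval) {x : Γ.V} (hx : point d s = vert x) :
      arc 1 ((sgn d : ℤ) * (s : ℝ)) = 1 := by
    have hs : s = 0 ∨ s = 1 := by
      by_contra! hs
      exact point_ne_vert d hs.1 hs.2 x hx
    rcases hs with rfl | rfl
    · rw [Set.Icc.coe_zero, Complex.ofReal_zero, mul_zero, arc_zero]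
    · rw [Set.Icc.coe_one, Complex.ofReal_one, mul_one, arc_one_intCast]
  by_cases hs : s = 0 ∨ s = 1
  · obtain ⟨x, hx⟩ : ∃ x, point d s = vert x := by
      rcases hs with rfl | rfl
      exacts [⟨_, point_zero d⟩, ⟨_, point_one d⟩]
    rw [hvert d s hx, hvert d' s' (he.symm.trans hx)]
  · rw [not_or] at hs
    rcases eq_or_rev_of_point_eq hs.1 hs.2 he with ⟨rfl, rfl⟩ | ⟨rfl, rfl⟩
    · rfl
    · refine (arc_eq_arc one_pos).2 ⟨sgn d, ?_⟩
      rw [h.sgn_rev, unitInterval.coe_symm_eq]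
      push_cast
      ring

theorem arc_sgn_mul_eq_of_edgePoint_eq (h : IsColouredMap ρ sgn) {d d' : Γ.D} {x x' : ℝ}
    (he : edgePoint (ρ * Γ.revPerm) d x = edgePoint (ρ * Γ.revPerm) d' x') :
    arc 1 ((sgn d : ℤ) * x) = arc 1 ((sgn d' : ℤ) * x') := by
  have hfract (d : Γ.D) (x : ℝ) : arc 1 ((sgn d : ℤ) * x) =
      arc 1 ((sgn (((ρ * Γ.revPerm) ^ ⌊x⌋) d) : ℤ) * (Int.fract x : ℝ)) := by
    refine (arc_eq_arc one_pos).2 ⟨(sgn d : ℤ) * ⌊x⌋, ?_⟩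
    rw [h.sgn_zpow, Int.fract]
    push_cast
    ring
  rw [edgePoint, edgePoint] at he
  rw [hfract d, hfract d']
  exact (h.arc_sgn_mul_eq_of_point_eq he :)

variable [Finite Γ.D]

theorem branch_disc (h : IsColouredMap ρ sgn) (d : Γ.D) {z : ℂ} (hz : ‖z‖ ≤ 1) :
    branch sgn (disc (ρ * Γ.revPerm) d z) = z ^ ((len (ρ * Γ.revPerm) d : ℤ) * (sgn d : ℤ)) := by
  refine Surface.lift_disc (fun d i z _ => ?_) (fun d d' x x' he => ?_) d hz
  · rw [mul_zpow, arc_zpow_mul (len_pos _ _), len_zpow, h.sgn_zpow, ← Int.cast_mul, arc_one_intCast,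
      one_mul]
  · rw [arc_zpow_mul (len_pos _ _), arc_zpow_mul (len_pos _ _)]
    exact h.arc_sgn_mul_eq_of_edgePoint_eq he

theorem branch_unroll (h : IsColouredMap ρ sgn) (d : Γ.D) {ζ : ℂ} (hζ : 0 ≤ ζ.im) :
    branch sgn (unroll (ρ * Γ.revPerm) d ζ) = arc 1 ((sgn d : ℤ) * ζ) := by
  rw [unroll, h.branch_disc _ (norm_arc_len_le_one.2 hζ), arc_zpow_mul (len_pos _ _)]

theorem branch_star (h : IsColouredMap ρ sgn) {d : Γ.D} (hd : sgn d = 1) (w : ℂ) :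
    branch sgn (star ρ d w) = arc 1 (w ^ halfDeg ρ d) := by
  obtain ⟨e, ζ, hζ, -, -, hstar, hpow⟩ := h.exists_star_eq_unroll hd w
  rw [hstar, h.branch_unroll e (im_nonneg_of_mem_halfPlane hζ), hpow]

theorem exists_hasStrictDerivAt_branch_star (h : IsColouredMap ρ sgn) {d : Γ.D} (hd : sgn d = 1)
    {w : ℂ} (hw : w ≠ 0) :
    ∃ a ≠ 0, HasStrictDerivAt (fun w => branch sgn (star ρ d w)) a w := by
  simp only [h.branch_star hd]
  refine ⟨_, ?_, (((hasStrictDerivAt_pow (halfDeg ρ d) w).const_mul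
    (2 * Real.pi * Complex.I)).div_const ((1 : ℕ) : ℂ)).cexp⟩
  have hq : (halfDeg ρ d : ℂ) ≠ 0 := Nat.cast_ne_zero.2 (h.halfDeg_pos d).ne'
  exact mul_ne_zero (Complex.exp_ne_zero _) (div_ne_zero (mul_ne_zero Complex.two_pi_I_ne_zero
    (mul_ne_zero hq (pow_ne_zero _ hw))) (Nat.cast_ne_zero.2 one_ne_zero))

theorem exists_hasStrictDerivAt_branch_disc (h : IsColouredMap ρ sgn) (d : Γ.D) {z : ℂ}
    (hz : ‖z‖ < 1) (hz0 : z ≠ 0) :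
    ∃ a ≠ 0, HasStrictDerivAt (fun z => branch sgn (disc (ρ * Γ.revPerm) d z)) a z := by
  set n : ℤ := (len (ρ * Γ.revPerm) d : ℤ) * (sgn d : ℤ)
  have hn : (n : ℂ) ≠ 0 := Int.cast_ne_zero.2 <|
    mul_ne_zero (Nat.cast_ne_zero.2 (len_pos _ _).ne') (Units.ne_zero _)
  refine ⟨_, mul_ne_zero hn (zpow_ne_zero (n - 1) hz0),
    (hasStrictDerivAt_zpow n z (Or.inl hz0)).congr_of_eventuallyEq ?_⟩
  filter_upwards [Metric.isOpen_ball.mem_nhds (mem_ball_zero_iff.2 hz)] with w hw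
  exact (h.branch_disc d (mem_ball_zero_iff.1 hw).le).symm

/-! ### The centres of the charts -/

theorem star_zero (h : IsColouredMap ρ sgn) (d : Γ.D) :
    star ρ d 0 = embed h.isFacePerm (vert (Γ.tail d)) := by
  rw [star, norm_zero, zero_pow (h.halfDeg_pos d).ne', corner_zero h.isFacePerm]

theorem eq_tail_of_embed_vert_mem_star (h : IsColouredMap ρ sgn) {d : Γ.D} (hd : sgn d = 1)
    {x : Γ.V} (hx : embed h.isFacePerm (vert x) ∈ star ρ d '' starDisc ρ d) : x = Γ.tail d := by
  obtain ⟨e, rfl⟩ := h.tail_surjective x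
  rw [← unroll_zero h.isFacePerm, h.unroll_mem_star_iff hd le_rfl] at hx
  obtain ⟨i, hi, hlt⟩ := hx
  rw [zero_sub, norm_neg, Complex.norm_intCast] at hlt
  have hlt' : |(i : ℝ)| < 1 := by linarith
  obtain rfl : i = 0 := Int.abs_lt_one_iff.1 (by exact_mod_cast hlt')
  exact hi

theorem embed_vert_notMem_face (h : IsColouredMap ρ sgn) (x : Γ.V) (d : Γ.D) :
    embed h.isFacePerm (vert x) ∉ face (ρ * Γ.revPerm) d := fun hx => by
  have hcompl : embed h.isFacePerm (vert x) ∈ (Set.range (embed h.isFacePerm))ᶜ := by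
    rw [compl_range_embed]
    exact Set.mem_iUnion.2 ⟨d, hx⟩
  exact hcompl ⟨_, rfl⟩

theorem mem_face_or_mem_star (h : IsColouredMap ρ sgn) (y : Surface (ρ * Γ.revPerm)) :
    (∃ d, y ∈ face (ρ * Γ.revPerm) d) ∨
      ∃ x, ∀ d, Γ.tail d = x → y ∈ star ρ d '' starDisc ρ d := by
  obtain ⟨d, z, hz, rfl⟩ := exists_disc_eq y
  rcases hz.lt_or_eq with hlt | hone
  · exact Or.inl ⟨d, (disc_mem_face hz).2 ⟨hlt, Equiv.Perm.SameCycle.refl _ _⟩⟩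
  · obtain ⟨x, rfl⟩ := exists_arc_ofReal_eq (len_pos (ρ * Γ.revPerm) d) hone
    have him : (0 : ℝ) ≤ (((x - round x : ℝ)) : ℂ).im := (Complex.ofReal_im _).ge
    refine Or.inr ⟨Γ.tail (((ρ * Γ.revPerm) ^ round x) d), fun d' hd' => ?_⟩
    have hx : (x : ℂ) = (round x : ℤ) + (x - round x : ℝ) := by
      push_cast
      ring
    change unroll _ d (x : ℂ) ∈ _
    rw [hx, unroll_int_add d _ him]
    refine h.unroll_mem_star hd' him ?_
    rw [Complex.norm_real, Real.norm_eq_abs]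
    linarith [abs_sub_round x]

theorem exists_branched_atlas (h : IsColouredMap ρ sgn) :
    ∃ (I : Type) (κ : I → OpenPartialHomeomorph (Surface (ρ * Γ.revPerm)) ℂ)
      (c : I → Surface (ρ * Γ.revPerm)), (∀ y, ∃ i, y ∈ (κ i).source) ∧
      (∀ i j, i ≠ j → c i ∉ (κ j).source) ∧ ∀ i, ∀ z ∈ (κ i).target, (κ i).symm z ≠ c i →
        ∃ a ≠ 0, HasStrictDerivAt (fun z => branch sgn ((κ i).symm z)) a z := by
  choose dart hdart hsgn using h.exists_tail_eq_and_sgn_eq_one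
  choose κs hκs hκs' hκs'' using fun x => h.exists_star_chart (hsgn x)
  choose κf hκf hκf' hκf'' using exists_face_chart h.isFacePerm
  refine ⟨Γ.V ⊕ Quotient (Equiv.Perm.SameCycle.setoid (ρ * Γ.revPerm)),
    Sum.elim κs fun o => κf o.out,
    Sum.elim (fun x => embed h.isFacePerm (vert x)) fun o => disc _ o.out 0,
    fun y => ?_, ?_, ?_⟩
  · rcases h.mem_face_or_mem_star y with ⟨d, hd⟩ | ⟨x, hx⟩
    · refine ⟨Sum.inr (Quotient.mk _ d), ?_⟩
      rw [Sum.elim_inr, hκf, face_eq_iff.2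
        (Quotient.mk_out (s := Equiv.Perm.SameCycle.setoid (ρ * Γ.revPerm)) d)]
      exact hd
    · exact ⟨Sum.inl x, by rw [Sum.elim_inl, hκs]; exact hx _ (hdart x)⟩
  · rintro (x | o) (x' | o') hne hmem
    all_goals simp only [Sum.elim_inl, Sum.elim_inr, hκs, hκf] at hmem
    · rw [h.eq_tail_of_embed_vert_mem_star (hsgn x') hmem, hdart] at hne
      exact hne rfl
    · exact h.embed_vert_notMem_face x _ hmem
    · obtain ⟨w, -, hw⟩ := hmem
      exact h.star_ne_disc_zero (hsgn x') w _ hw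
    · have hcycle := ((disc_mem_face (norm_zero.trans_le zero_le_one)).1 hmem).2
      refine hne (congrArg Sum.inr ?_)
      rw [← Quotient.out_eq o, ← Quotient.out_eq o']
      exact Quotient.sound hcycle.symm
  · rintro (x | o) z hz hne
    all_goals simp only [Sum.elim_inl, Sum.elim_inr, hκs', hκs'', hκf', hκf''] at hz hne ⊢
    · refine h.exists_hasStrictDerivAt_branch_star (hsgn x) ?_
      rintro rfl
      exact hne (by rw [h.star_zero, hdart])
    · refine h.exists_hasStrictDerivAt_branch_disc o.out (mem_ball_zero_iff.1 hz) ?_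
      rintro rfl
      exact hne rfl

theorem isClosedOrientableSurface [Nonempty Γ.V] (h : IsColouredMap ρ sgn) :
    IsClosedOrientableSurface (Surface (ρ * Γ.revPerm)) := by
  refine ⟨h.isFacePerm.t2Space, inferInstance, h.connectedSpace_surface, ?_⟩
  obtain ⟨I, κ, c, hcover, hc, hu⟩ := h.exists_branched_atlas
  refine ⟨Set.range κ, fun y => ?_, ?_⟩
  · obtain ⟨i, hi⟩ := hcover y
    exact ⟨κ i, ⟨i, rfl⟩, hi⟩
  · rintro _ ⟨i, rfl⟩ _ ⟨j, rfl⟩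
    exact transition_oriented_of_branched κ c (branch sgn) hc hu i j

end IsColouredMap

end

/-! ### Coverings of surfaces -/

section

variable {Γ' Γ : Multigraph}

/-- A covering of graphs which is compatible with the rotations and preserves the lengths of the
boundary walks of the faces, so that it extends to a covering of surfaces. -/
structure Hom.IsMapCovering (π : Hom Γ' Γ) (ρ' : Perm Γ'.D) (ρ : Perm Γ.D) : Prop where
  isCovering : π.IsCovering
  rotation : Function.Semiconj π.onD ρ' ρ
  len_eq : ∀ d, len (ρ * Γ.revPerm) (π.onD d) = len (ρ' * Γ'.revPerm) d

/-- The map of surfaces which extends a homomorphism of graphs to the discs. -/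
def surfaceMap (π : Hom Γ' Γ) (φ' : Perm Γ'.D) (φ : Perm Γ.D) : Surface φ' → Surface φ :=
  Surface.lift fun d z => disc φ (π.onD d) z

namespace Hom.IsMapCovering

variable {π : Hom Γ' Γ} {ρ' : Perm Γ'.D} {ρ : Perm Γ.D}

theorem semiconj_facePerm (h : π.IsMapCovering ρ' ρ) :
    Function.Semiconj π.onD (ρ' * Γ'.revPerm) (ρ * Γ.revPerm) := fun d =>
  (h.rotation (Γ'.rev d)).trans (congrArg ρ (π.rev_onD d).symm)

theorem realize_edgePoint (h : π.IsMapCovering ρ' ρ) (d : Γ'.D) (x : ℝ) :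
    π.realize (edgePoint (ρ' * Γ'.revPerm) d x) = edgePoint (ρ * Γ.revPerm) (π.onD d) x :=
  congrArg (point · _) (semiconj_zpow h.semiconj_facePerm ⌊x⌋ d)

theorem len_rotation_onD (h : π.IsMapCovering ρ' ρ) (hρ' : IsRotation ρ') (d : Γ'.D) :
    len ρ (π.onD d) = len ρ' d := by
  have hfix (i : ℤ) : (ρ ^ i) (π.onD d) = π.onD d ↔ (ρ' ^ i) d = d := by
    rw [← semiconj_zpow h.rotation i d]
    have htail : Γ'.tail ((ρ' ^ i) d) = Γ'.tail d := ((hρ' _ _).1 ⟨i, rfl⟩).symm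
    exact (h.isCovering.2.2 (Γ'.tail d)).injOn.eq_iff htail rfl
  have hdvd (n : ℤ) : (len ρ (π.onD d) : ℤ) ∣ n ↔ (len ρ' d : ℤ) ∣ n := by
    rw [len, ← zpow_apply_eq_self_iff, hfix, zpow_apply_eq_self_iff, len]
  exact Nat.dvd_antisymm (Int.natCast_dvd_natCast.1 ((hdvd _).2 dvd_rfl))
    (Int.natCast_dvd_natCast.1 ((hdvd _).1 dvd_rfl))

theorem halfDeg_onD (h : π.IsMapCovering ρ' ρ) (hρ' : IsRotation ρ') (d : Γ'.D) :
    halfDeg ρ (π.onD d) = halfDeg ρ' d :=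
  congrArg (· / 2) (h.len_rotation_onD hρ' d)

variable [Finite Γ'.D] [Finite Γ.D]

theorem surfaceMap_disc (h : π.IsMapCovering ρ' ρ) (d : Γ'.D) {z : ℂ} (hz : ‖z‖ ≤ 1) :
    surfaceMap π (ρ' * Γ'.revPerm) (ρ * Γ.revPerm) (disc (ρ' * Γ'.revPerm) d z) =
      disc (ρ * Γ.revPerm) (π.onD d) z := by
  refine Surface.lift_disc (fun d i z hz => ?_) (fun d d' x x' he => ?_) d hz
  · rw [← h.len_eq, disc_arc_mul _ _ hz, semiconj_zpow h.semiconj_facePerm i d]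
  · rw [← h.len_eq, ← h.len_eq, disc_arc_eq_disc_arc_iff, ← h.realize_edgePoint,
      ← h.realize_edgePoint, he]

theorem surfaceMap_unroll (h : π.IsMapCovering ρ' ρ) (d : Γ'.D) {ζ : ℂ} (hζ : 0 ≤ ζ.im) :
    surfaceMap π (ρ' * Γ'.revPerm) (ρ * Γ.revPerm) (unroll (ρ' * Γ'.revPerm) d ζ) =
      unroll (ρ * Γ.revPerm) (π.onD d) ζ := by
  rw [unroll, h.surfaceMap_disc d (norm_arc_len_le_one.2 hζ), unroll, h.len_eq]

theorem surfaceMap_star (h : π.IsMapCovering ρ' ρ) (hρ' : IsRotation ρ') (d : Γ'.D) (w : ℂ) :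
    surfaceMap π (ρ' * Γ'.revPerm) (ρ * Γ.revPerm) (star ρ' d w) = star ρ (π.onD d) w := by
  have hfract (t : ℝ) : Int.fract t ∈ unitInterval :=
    ⟨Int.fract_nonneg t, (Int.fract_lt_one t).le⟩
  rw [star, star, corner, corner, h.halfDeg_onD hρ', h.surfaceMap_unroll _
    (im_mul_arc_two_nonneg (by positivity) (hfract _)), semiconj_zpow h.rotation,
    h.len_rotation_onD hρ']

theorem surfaceMap_embed (h : π.IsMapCovering ρ' ρ) (hφ' : IsFacePerm (ρ' * Γ'.revPerm))
    (hφ : IsFacePerm (ρ * Γ.revPerm)) (y : Γ'.Realization) :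
    surfaceMap π (ρ' * Γ'.revPerm) (ρ * Γ.revPerm) (embed hφ' y) = embed hφ (π.realize y) := by
  obtain ⟨d, x, rfl⟩ := exists_edgePoint_eq hφ' y
  rw [embed_edgePoint, h.surfaceMap_disc d (norm_arc_ofReal _ _).le, h.realize_edgePoint,
    embed_edgePoint, h.len_eq]

theorem surfaceMap_surjective (h : π.IsMapCovering ρ' ρ) :
    Function.Surjective (surfaceMap π (ρ' * Γ'.revPerm) (ρ * Γ.revPerm)) := by
  intro y
  obtain ⟨d, z, hz, rfl⟩ := exists_disc_eq y
  obtain ⟨d', rfl⟩ := h.isCovering.2.1 d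
  exact ⟨_, h.surfaceMap_disc d' hz⟩

theorem isCoveringMap {sgn : Γ.D → ℤˣ} (h : π.IsMapCovering ρ' ρ)
    (h' : IsColouredMap ρ' (sgn ∘ π.onD)) (hsgn : IsColouredMap ρ sgn) :
    IsCoveringMap (surfaceMap π (ρ' * Γ'.revPerm) (ρ * Γ.revPerm)) := by
  have := h'.isFacePerm.t2Space
  have := hsgn.isFacePerm.t2Space
  rw [← isLocalHomeomorph_iff_isCoveringMap]
  refine isLocalHomeomorph_of_charts (Z := ℂ) fun y => ?_
  rcases h'.mem_face_or_mem_star y with ⟨d, hd⟩ | ⟨x, hx⟩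
  · obtain ⟨e', hsource', htarget', he'⟩ := exists_face_chart h'.isFacePerm d
    obtain ⟨e, -, htarget, he⟩ := exists_face_chart hsgn.isFacePerm (π.onD d)
    refine ⟨e', e, hsource' ▸ hd, htarget'.trans htarget.symm, fun z hz => ?_⟩
    rw [htarget', mem_ball_zero_iff] at hz
    rw [he', he, h.surfaceMap_disc d hz.le]
  · obtain ⟨d, hd, hone⟩ := h'.exists_tail_eq_and_sgn_eq_one x
    obtain ⟨e', hsource', htarget', he'⟩ := h'.exists_star_chart hone
    obtain ⟨e, -, htarget, he⟩ := hsgn.exists_star_chart hone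
    refine ⟨e', e, hsource' ▸ hx d hd, ?_, fun z _ => ?_⟩
    · rw [htarget, htarget', starDisc, starDisc, h.halfDeg_onD h'.rotation]
    · rw [he', he, h.surfaceMap_star h'.rotation]

end Hom.IsMapCovering

end

end Multigraph

/-! ### Uniqueness of the surface of a cellular embedding -/

theorem bijOn_arc_mul_ball (l : ℕ) (i : ℤ) :
    Set.BijOn (fun z => arc l i * z) (Metric.ball 0 1) (Metric.ball 0 1) := by
  refine ⟨fun z hz => ?_, (mul_right_injective₀ (arc_ne_zero _ _)).injOn, fun z hz =>
    ⟨(arc l i)⁻¹ * z, ?_, mul_inv_cancel_left₀ (arc_ne_zero _ _) z⟩⟩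
  · rwa [mem_ball_zero_iff, norm_mul, norm_arc_intCast, one_mul, ← mem_ball_zero_iff]
  · rwa [mem_ball_zero_iff, norm_mul, norm_inv, norm_arc_intCast, inv_one, one_mul,
      ← mem_ball_zero_iff]

theorem exists_sameCycle_representative {α : Type*} (φ : Perm α) :
    ∃ rep : α → α, (∀ d, φ.SameCycle (rep d) d) ∧ ∀ d d', φ.SameCycle d d' → rep d = rep d' :=
  ⟨fun d => (Quotient.mk (Equiv.Perm.SameCycle.setoid φ) d).out,
    fun d => Quotient.mk_out (s := Equiv.Perm.SameCycle.setoid φ) d,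
    fun _ _ h => congrArg Quotient.out (Quotient.sound (s := Equiv.Perm.SameCycle.setoid φ) h)⟩

namespace Multigraph

variable {Γ : Multigraph} {φ : Perm Γ.D} {S : Type*} [TopologicalSpace S] {σ : Γ.Realization → S}

theorem arc_len_intCast_eq_iff [Finite Γ.D] {d : Γ.D} {i j : ℤ} :
    arc (len φ d) i = arc (len φ d) j ↔ (φ ^ i) d = (φ ^ j) d := by
  rw [arc_eq_arc (len_pos φ d), zpow_apply_eq_zpow_apply_iff]
  refine exists_congr fun n => ?_
  rw [sub_eq_iff_eq_add', mul_comm (Nat.cast _) n]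
  norm_cast

theorem IsBoundaryWalk.exists_bijOn_and_apply_arc [Finite Γ.D] {F : Set S} {d : Γ.D}
    (h : IsBoundaryWalk σ F φ d) :
    ∃ χ : ℂ → S, ContinuousOn χ (Metric.closedBall 0 1) ∧ Set.BijOn χ (Metric.ball 0 1) F ∧
      ∀ x : ℝ, χ (arc (len φ d) x) = σ (edgePoint φ d x) := by
  obtain ⟨χ, hcont, hbij, hbd⟩ := h
  refine ⟨χ, hcont, hbij, fun x => ?_⟩
  obtain ⟨j, -, s, hpoint, harc⟩ := exists_lt_len_unitInterval (φ := φ) d x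
  rw [hpoint, harc, zpow_natCast]
  exact hbd j s

/-- The maps `G d` parametrize the faces of `σ` by the closed unit disc. The boundary of `face d`
is run through along the orbit of `d`, starting with `d`, and the parametrizations of the edges of
one orbit differ by rotations of the disc. -/
structure IsCellFamily (φ : Perm Γ.D) (σ : Γ.Realization → S) (face : Γ.D → Set S)
    (G : Γ.D → ℂ → S) : Prop where
  range_face : Set.range face = faces σ
  sameCycle : ∀ d d', face d = face d' → φ.SameCycle d d'
  continuousOn : ∀ d, ContinuousOn (G d) (Metric.closedBall 0 1)
  bijOn : ∀ d, Set.BijOn (G d) (Metric.ball 0 1) (face d)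
  apply_arc : ∀ d (x : ℝ), G d (arc (len φ d) x) = σ (edgePoint φ d x)
  apply_arc_mul : ∀ d (i : ℤ) z, G d (arc (len φ d) i * z) = G ((φ ^ i) d) z

theorem IsCellularEmbedding.exists_isCellFamily [Finite Γ.D] {ρ : Perm Γ.D}
    (hσ : IsCellularEmbedding ρ σ) : ∃ face G, IsCellFamily (ρ * Γ.revPerm) σ face G := by
  obtain ⟨face, hrange, hface, hwalk⟩ := hσ.boundaries
  set φ := ρ * Γ.revPerm
  choose χ hcont hbij hχ using fun d => (hwalk d).exists_bijOn_and_apply_arc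
  obtain ⟨rep, hrep, hrep_eq⟩ := exists_sameCycle_representative φ
  choose j hj using hrep
  have hlen (d : Γ.D) : len φ (rep d) = len φ d := by rw [← len_zpow (rep d) (j d), hj]
  refine ⟨face, fun d z => χ (rep d) (arc (len φ d) (j d) * z), hrange, fun d d' => (hface d d').1,
    fun d => ?_, fun d => ?_, fun d x => ?_, fun d i z => ?_⟩
  · refine (hcont (rep d)).comp (by fun_prop) fun z hz => ?_
    rwa [mem_closedBall_zero_iff, norm_mul, norm_arc_intCast, one_mul, ← mem_closedBall_zero_iff]
  · rw [← (hface (rep d) d).2 ⟨_, hj d⟩]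
    exact (hbij (rep d)).comp (bijOn_arc_mul_ball _ _)
  · have hshift : edgePoint φ d x = edgePoint φ (rep d) (j d + x) := by
      rw [edgePoint_int_add, hj]
    rw [hshift, ← hχ, hlen, Complex.ofReal_add, Complex.ofReal_intCast, arc_add]
  · have hrep : rep ((φ ^ i) d) = rep d := (hrep_eq _ _ ⟨i, rfl⟩).symm
    have hmove : (φ ^ (j d + i)) (rep d) = (φ ^ j ((φ ^ i) d)) (rep d) := by
      rw [add_comm, zpow_add, Equiv.Perm.mul_apply, hj, ← hrep, hj]
    have harc := arc_len_intCast_eq_iff.2 hmove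
    rw [hlen, Int.cast_add, arc_add] at harc
    rw [hrep, len_zpow, ← harc, mul_assoc]

namespace IsCellFamily

variable {face : Γ.D → Set S} {G : Γ.D → ℂ → S}

theorem face_subset (h : IsCellFamily φ σ face G) (d : Γ.D) : face d ⊆ (Set.range σ)ᶜ := by
  obtain ⟨x, -, hx⟩ : face d ∈ faces σ := h.range_face ▸ ⟨d, rfl⟩
  exact hx ▸ connectedComponentIn_subset _ _

theorem face_eq_connectedComponentIn (h : IsCellFamily φ σ face G) {d : Γ.D} {y : S}
    (hy : y ∈ face d) : face d = connectedComponentIn (Set.range σ)ᶜ y := by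
  obtain ⟨x, -, hx⟩ : face d ∈ faces σ := h.range_face ▸ ⟨d, rfl⟩
  rw [hx] at hy ⊢
  exact connectedComponentIn_eq hy

theorem apply_mem_face (h : IsCellFamily φ σ face G) (d : Γ.D) {z : ℂ} (hz : ‖z‖ < 1) :
    G d z ∈ face d :=
  (h.bijOn d).mapsTo (mem_ball_zero_iff.2 hz)

variable [Finite Γ.D]

theorem apply_mem_range_iff (h : IsCellFamily φ σ face G) (d : Γ.D) {z : ℂ} (hz : ‖z‖ ≤ 1) :
    G d z ∈ Set.range σ ↔ ‖z‖ = 1 := by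
  refine ⟨fun hmem => hz.eq_of_not_lt fun hlt => h.face_subset d (h.apply_mem_face d hlt) hmem,
    fun hone => ?_⟩
  obtain ⟨x, rfl⟩ := exists_arc_ofReal_eq (len_pos φ d) hone
  exact ⟨_, (h.apply_arc d x).symm⟩

theorem lift_disc (h : IsCellFamily φ σ face G) (d : Γ.D) {z : ℂ} (hz : ‖z‖ ≤ 1) :
    Surface.lift G (disc φ d z) = G d z :=
  Surface.lift_disc (fun d i z _ => h.apply_arc_mul d i z)
    (fun d d' x x' he => by rw [h.apply_arc, h.apply_arc, he]) d hz

theorem continuous_lift (h : IsCellFamily φ σ face G) :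
    Continuous (Surface.lift G : Surface φ → S) :=
  continuous_surface_iff.2 fun d =>
    (h.continuousOn d).congr fun _ hz => h.lift_disc d (mem_closedBall_zero_iff.1 hz)

theorem lift_embed (h : IsCellFamily φ σ face G) (hφ : IsFacePerm φ) (y : Γ.Realization) :
    Surface.lift G (embed hφ y) = σ y := by
  obtain ⟨d, x, rfl⟩ := exists_edgePoint_eq hφ y
  rw [embed_edgePoint, h.lift_disc d (norm_arc_ofReal _ _).le, h.apply_arc]

theorem disc_eq_disc_of_apply_eq (h : IsCellFamily φ σ face G) {d d' : Γ.D} {z z' : ℂ}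
    (hz : ‖z‖ < 1) (hz' : ‖z'‖ < 1) (he : G d z = G d' z') : disc φ d z = disc φ d' z' := by
  have hmem' : G d z ∈ face d' := he ▸ h.apply_mem_face d' hz'
  obtain ⟨i, rfl⟩ := h.sameCycle d d' <|
    (h.face_eq_connectedComponentIn (h.apply_mem_face d hz)).trans
      (h.face_eq_connectedComponentIn hmem').symm
  rw [← h.apply_arc_mul] at he
  rw [(h.bijOn d).injOn (mem_ball_zero_iff.2 hz)
    ((bijOn_arc_mul_ball _ i).mapsTo (mem_ball_zero_iff.2 hz')) he, disc_arc_mul d i hz'.le]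

theorem lift_injective (h : IsCellFamily φ σ face G) (hinj : Function.Injective σ) :
    Function.Injective (Surface.lift G : Surface φ → S) := by
  intro y y' he
  obtain ⟨d, z, hz, rfl⟩ := exists_disc_eq y
  obtain ⟨d', z', hz', rfl⟩ := exists_disc_eq y'
  rw [h.lift_disc d hz, h.lift_disc d' hz'] at he
  have hnorm : ‖z‖ = 1 ↔ ‖z'‖ = 1 := by
    rw [← h.apply_mem_range_iff d hz, he, h.apply_mem_range_iff d' hz']
  rcases hz.lt_or_eq with hlt | hone
  · exact h.disc_eq_disc_of_apply_eq hlt (hz'.lt_of_ne fun hone => hlt.ne (hnorm.2 hone)) he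
  · obtain ⟨x, rfl⟩ := exists_arc_ofReal_eq (len_pos φ d) hone
    obtain ⟨x', rfl⟩ := exists_arc_ofReal_eq (len_pos φ d') (hnorm.1 hone)
    rw [h.apply_arc, h.apply_arc] at he
    rw [disc_arc_eq_disc_arc_iff, hinj he]

theorem lift_surjective (h : IsCellFamily φ σ face G) (hφ : IsFacePerm φ) :
    Function.Surjective (Surface.lift G : Surface φ → S) := by
  intro y
  by_cases hy : y ∈ Set.range σ
  · obtain ⟨x, rfl⟩ := hy
    exact ⟨_, h.lift_embed hφ x⟩
  · obtain ⟨d, hd⟩ : connectedComponentIn (Set.range σ)ᶜ y ∈ Set.range face :=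
      h.range_face ▸ ⟨y, hy, rfl⟩
    have hyd : y ∈ face d := hd ▸ mem_connectedComponentIn hy
    obtain ⟨z, hz, rfl⟩ := (h.bijOn d).surjOn hyd
    exact ⟨disc φ d z, h.lift_disc d (mem_ball_zero_iff.1 hz).le⟩

end IsCellFamily

theorem IsCellularEmbedding.exists_homeomorph [Finite Γ.D] [T2Space S] {ρ : Perm Γ.D}
    (hσ : IsCellularEmbedding ρ σ) (hφ : IsFacePerm (ρ * Γ.revPerm)) :
    ∃ H : Surface (ρ * Γ.revPerm) ≃ₜ S, ∀ y, H (embed hφ y) = σ y := by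
  obtain ⟨face, G, hG⟩ := hσ.exists_isCellFamily
  exact ⟨hG.continuous_lift.homeoOfEquivCompactToT2
    (f := Equiv.ofBijective _ ⟨hG.lift_injective hσ.injective, hG.lift_surjective hφ⟩),
    hG.lift_embed hφ⟩

theorem Hom.IsMapCovering.exists_isCoveringMap {Γ' : Multigraph} {π : Hom Γ' Γ} {ρ' : Perm Γ'.D}
    {ρ : Perm Γ.D} {sgn : Γ.D → ℤˣ} [Finite Γ'.D] [Finite Γ.D] [T2Space S]
    (h : π.IsMapCovering ρ' ρ) (h' : IsColouredMap ρ' (sgn ∘ π.onD)) (hsgn : IsColouredMap ρ sgn)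
    (hσ : IsCellularEmbedding ρ σ) :
    ∃ p : Surface (ρ' * Γ'.revPerm) → S, IsCoveringMap p ∧ Function.Surjective p ∧
      p ∘ embed h'.isFacePerm = σ ∘ π.realize := by
  obtain ⟨H, hH⟩ := hσ.exists_homeomorph hsgn.isFacePerm
  refine ⟨H ∘ surfaceMap π _ _, (h.isCoveringMap h' hsgn).homeomorph_comp H,
    H.surjective.comp h.surfaceMap_surjective, funext fun y => ?_⟩
  rw [Function.comp_apply, Function.comp_apply, h.surfaceMap_embed h'.isFacePerm hsgn.isFacePerm,
    hH, Function.comp_apply]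

end Multigraph

/-! ### The map of an array -/

theorem units_zsmul_eq_zero_iff {G : Type*} [AddGroup G] (ε : ℤˣ) (a : G) :
    (ε : ℤ) • a = 0 ↔ a = 0 := by
  rcases Int.units_eq_one_or ε with rfl | rfl
  · rw [Units.val_one, one_zsmul]
  · rw [Units.val_neg, Units.val_one, neg_one_zsmul, neg_eq_zero]

namespace Multigraph

variable {Γ : Multigraph}

theorem tail_eq_of_sameCycle {ρ : Perm Γ.D} (hρ : ∀ d, Γ.tail (ρ d) = Γ.tail d) {d d' : Γ.D}
    (h : ρ.SameCycle d d') : Γ.tail d = Γ.tail d' := by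
  obtain ⟨i, rfl⟩ := h
  have hsemi := semiconj_zpow (b := 1) (f := Γ.tail) (a := ρ) hρ i d
  rw [hsemi, one_zpow, Equiv.Perm.one_apply]

theorem walkEdges_eq_setOf_pow [Finite Γ.D] (φ : Perm Γ.D) (d : Γ.D) :
    walkEdges φ d = {e | ∃ j : ℕ, e = (φ ^ j) d ∨ e = Γ.rev ((φ ^ j) d)} := by
  have hpow (e : Γ.D) : φ.SameCycle d e ↔ ∃ j : ℕ, (φ ^ j) d = e :=
    ⟨fun h => h.exists_nat_pow_eq, fun ⟨j, hj⟩ => ⟨j, by rw [zpow_natCast, hj]⟩⟩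
  ext e
  simp only [walkEdges, Set.mem_ofPred_eq, hpow, exists_or]
  refine or_congr (exists_congr fun j => eq_comm) (exists_congr fun j => ?_)
  rw [eq_comm, Function.Involutive.eq_iff Γ.rev_rev]

theorem walkEdges_inv_mul_revPerm (ρ : Perm Γ.D) (d : Γ.D) :
    walkEdges (ρ⁻¹ * Γ.revPerm) d = walkEdges (ρ * Γ.revPerm) (Γ.rev d) := by
  have hconj : ρ⁻¹ * Γ.revPerm = Γ.revPerm * (ρ * Γ.revPerm)⁻¹ * Γ.revPerm⁻¹ := by
    rw [mul_inv_rev, mul_inv_cancel_left]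
    rfl
  ext e
  simp only [walkEdges, Set.mem_ofPred_eq, hconj, Equiv.Perm.sameCycle_conj,
    Equiv.Perm.sameCycle_inv]
  rw [or_comm]
  exact or_congr (by rw [show Γ.revPerm⁻¹ (Γ.rev e) = e from Γ.rev_rev e]; rfl) Iff.rfl

end Multigraph

namespace PFArray

section

variable {m n : ℕ} {G : Type}

theorem card_filter_skel {A : PFArray m n G} (P : Fin m × Fin n → Prop) [DecidablePred P] :
    (Finset.univ.filter fun c : A.skel => P c.1).card = (A.skel.filter P).card := by
  rw [Finset.univ_eq_attach, Finset.filter_attach, Finset.card_map, Finset.card_attach]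

end

variable {m n : ℕ} {G : Type} [AddCommGroup G]

instance [Finite G] (A : PFArray m n G) : Finite A.graph.D :=
  inferInstanceAs (Finite (G × A.skel × ℤˣ))

/-- The properties of the array of a biembedding that do not involve the orderings of its rows and
columns: these have `s` and `k` filled cells, sum to zero, and the multigraph of the array is
connected and without loops. -/
structure IsRegular (A : PFArray m n G) (s k : ℕ) : Prop where
  row_card : ∀ i, (A.skel.filter (fun c => c.1 = i)).card = s
  col_card : ∀ j, (A.skel.filter (fun c => c.2 = j)).card = k
  row_sum : ∀ i, ∑ c with c.1.1 = i, A.entry c = 0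
  col_sum : ∀ j, ∑ c with c.1.2 = j, A.entry c = 0
  entry_ne_zero : ∀ c, A.entry c ≠ 0
  nonempty : Nonempty A.skel
  connected : ∀ x y, Relation.ReflTransGen
    (fun x y => ∃ d, A.graph.tail d = x ∧ A.graph.head d = y) x y

/-- The directed edge `(x, c, ε)` of the multigraph of an array. -/
def dart (A : PFArray m n G) (x : G) (c : A.skel) (ε : ℤˣ) : A.graph.D := (x, c, ε)

/-- The sign `ε` of a directed edge `(x, c, ε)`, which is also the colour of the face at the edge:
the faces of sign `1` come from the columns, those of sign `-1` from the rows. -/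
def sign (A : PFArray m n G) (d : A.graph.D) : ℤˣ := d.2.2

/-- The permutation of the filled cells which the boundary walks of the faces of sign `ε` follow. -/
def ordering {A : PFArray m n G} (αr αc : Perm A.skel) (ε : ℤˣ) : Perm A.skel :=
  if ε = 1 then αc else αr

variable {A : PFArray m n G} {s k : ℕ} {αr αc : Perm A.skel}

theorem exists_dart_eq (d : A.graph.D) : ∃ x c ε, A.dart x c ε = d := ⟨d.1, d.2.1, d.2.2, rfl⟩

theorem rev_dart (x : G) (c : A.skel) (ε : ℤˣ) :
    A.graph.rev (A.dart x c ε) = A.dart (x + (ε : ℤ) • A.entry c) c (-ε) := rfl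

theorem rotation_dart_one (x : G) (c : A.skel) :
    A.rotation αr αc (A.dart x c 1) = A.dart x (αr c) (-1) := rfl

theorem rotation_dart_neg_one (x : G) (c : A.skel) :
    A.rotation αr αc (A.dart x c (-1)) = A.dart x (αc c) 1 := rfl

theorem tail_rotation (d : A.graph.D) : A.graph.tail (A.rotation αr αc d) = A.graph.tail d := by
  obtain ⟨x, c, ε, rfl⟩ := exists_dart_eq d
  rcases Int.units_eq_one_or ε with rfl | rfl <;> rfl

theorem sign_rotation (d : A.graph.D) : A.sign (A.rotation αr αc d) = -A.sign d := by
  obtain ⟨x, c, ε, rfl⟩ := exists_dart_eq d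
  rcases Int.units_eq_one_or ε with rfl | rfl <;> rfl

theorem rotation_inv : (A.rotation αr αc)⁻¹ = A.rotation αc⁻¹ αr⁻¹ := rfl

theorem head_ne_tail (hA : ∀ c, A.entry c ≠ 0) (d : A.graph.D) :
    A.graph.head d ≠ A.graph.tail d := by
  obtain ⟨x, c, ε, rfl⟩ := exists_dart_eq d
  intro h
  exact hA c ((units_zsmul_eq_zero_iff ε _).1 (add_eq_left.1 h))

theorem facePerm_dart (x : G) (c : A.skel) (ε : ℤˣ) :
    (A.rotation αr αc * A.graph.revPerm) (A.dart x c ε)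
      = A.dart (x + (ε : ℤ) • A.entry c) (ordering αr αc ε c) ε := by
  change A.rotation αr αc (A.graph.rev (A.dart x c ε)) = _
  rcases Int.units_eq_one_or ε with rfl | rfl
  · rw [rev_dart, rotation_dart_neg_one, ordering, if_pos rfl]
  · rw [rev_dart, neg_neg, rotation_dart_one, ordering, if_neg (by decide)]

theorem partialSum_succ (a : Perm A.skel) (c : A.skel) (j : ℕ) :
    A.partialSum a c (j + 1) = A.partialSum a c j + A.entry ((a ^ j) c) :=
  Finset.sum_range_succ _ _

theorem facePerm_pow_dart (x : G) (c : A.skel) (ε : ℤˣ) (j : ℕ) :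
    ((A.rotation αr αc * A.graph.revPerm) ^ j) (A.dart x c ε)
      = A.dart (x + (ε : ℤ) • A.partialSum (ordering αr αc ε) c j)
        ((ordering αr αc ε ^ j) c) ε := by
  induction j with
  | zero =>
    rw [partialSum, Finset.sum_range_zero, smul_zero, add_zero, pow_zero, pow_zero,
      Equiv.Perm.one_apply, Equiv.Perm.one_apply]
  | succ j ih =>
    rw [pow_succ', Equiv.Perm.mul_apply, ih, facePerm_dart, partialSum_succ, smul_add, add_assoc,
      pow_succ', Equiv.Perm.mul_apply]

/-! ### Rows and columns as faces -/

theorem partialSum_ordering_minimalPeriod (hA : A.IsRegular s k) (hord : A.SimpleCompatible αr αc)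
    (ε : ℤˣ) (c : A.skel) : A.partialSum (ordering αr αc ε) c
      (Function.minimalPeriod (ordering αr αc ε) c) = 0 := by
  classical
  rw [partialSum, sum_range_minimalPeriod]
  unfold ordering
  split_ifs
  · simp_rw [hord.cols, eq_comm (a := c.1.2)]
    exact hA.col_sum c.1.2
  · simp_rw [hord.rows, eq_comm (a := c.1.1)]
    exact hA.row_sum c.1.1

theorem minimalPeriod_ordering (hA : A.IsRegular s k) (hord : A.SimpleCompatible αr αc) (ε : ℤˣ)
    (c : A.skel) : Function.minimalPeriod (ordering αr αc ε) c = if ε = 1 then k else s := by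
  classical
  rw [minimalPeriod_eq_card_sameCycle]
  unfold ordering
  split_ifs
  · simp_rw [hord.cols, eq_comm (a := c.1.2)]
    rw [card_filter_skel fun d => d.2 = c.1.2, hA.col_card]
  · simp_rw [hord.rows, eq_comm (a := c.1.1)]
    rw [card_filter_skel fun d => d.1 = c.1.1, hA.row_card]

theorem isSimple_ordering (hord : A.SimpleCompatible αr αc) (ε : ℤˣ) :
    A.IsSimple (ordering αr αc ε) := by
  unfold ordering
  split_ifs
  · exact hord.simple_cols
  · exact hord.simple_rows

theorem eq_zero_of_partialSum_ordering_eq_zero (hA : A.IsRegular s k)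
    (hord : A.SimpleCompatible αr αc) {ε : ℤˣ} {c : A.skel} {j : ℕ}
    (hj : j < Function.minimalPeriod (ordering αr αc ε) c)
    (h : A.partialSum (ordering αr αc ε) c j = 0) : j = 0 := by
  by_contra hne
  have hpos : 1 ≤ j := Nat.one_le_iff_ne_zero.2 hne
  exact hj.ne <| isSimple_ordering hord ε c ⟨hpos, hj.le⟩ ⟨hpos.trans hj.le, le_rfl⟩
    (h.trans (partialSum_ordering_minimalPeriod hA hord ε c).symm)

theorem len_facePerm_dart (hA : A.IsRegular s k) (hord : A.SimpleCompatible αr αc) (x : G)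
    (c : A.skel) (ε : ℤˣ) :
    Multigraph.len (A.rotation αr αc * A.graph.revPerm) (A.dart x c ε)
      = Function.minimalPeriod (ordering αr αc ε) c := by
  apply Nat.dvd_antisymm
  · apply Function.IsPeriodicPt.minimalPeriod_dvd
    rw [Function.IsPeriodicPt, Function.IsFixedPt, Equiv.Perm.iterate_eq_pow, facePerm_pow_dart,
      partialSum_ordering_minimalPeriod hA hord, smul_zero, add_zero, ← Equiv.Perm.iterate_eq_pow,
      Function.iterate_minimalPeriod]
  · apply Function.IsPeriodicPt.minimalPeriod_dvd
    have h := Function.iterate_minimalPeriod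
      (f := (A.rotation αr αc * A.graph.revPerm)) (x := A.dart x c ε)
    rw [Equiv.Perm.iterate_eq_pow, facePerm_pow_dart] at h
    rw [Function.IsPeriodicPt, Function.IsFixedPt, Equiv.Perm.iterate_eq_pow]
    exact congrArg (fun d : A.graph.D => d.2.1) h

theorem len_facePerm (hA : A.IsRegular s k) (hord : A.SimpleCompatible αr αc) (d : A.graph.D) :
    Multigraph.len (A.rotation αr αc * A.graph.revPerm) d = if A.sign d = 1 then k else s := by
  obtain ⟨x, c, ε, rfl⟩ := exists_dart_eq d
  rw [len_facePerm_dart hA hord, minimalPeriod_ordering hA hord]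
  rfl

variable {H : Type} [AddCommGroup H]

theorem partialSum_map (f : G →+ H) (a : Perm A.skel) (c : A.skel) (j : ℕ) :
    (A.map f).partialSum a c j = f (A.partialSum a c j) :=
  (map_sum f _ _).symm

theorem IsSimple.of_map {a : Perm A.skel} (f : G →+ H) (h : (A.map f).IsSimple a) :
    A.IsSimple a := fun c i hi j hj he =>
  h c hi hj ((partialSum_map f a c i).trans (he ▸ (partialSum_map f a c j).symm))

theorem SimpleCompatible.of_map (f : G →+ H) (h : (A.map f).SimpleCompatible αr αc) :
    A.SimpleCompatible αr αc where
  rows := h.rows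
  cols := h.cols
  simple_rows := .of_map f h.simple_rows
  simple_cols := .of_map f h.simple_cols
  compatible := h.compatible

theorem isCovering_graphProj (f : G →+ H) (hf : Function.Surjective f) :
    (A.graphProj f).IsCovering := by
  refine ⟨hf, ?_, fun x => ⟨?_, ?_, ?_⟩⟩
  · rintro ⟨y, c, ε⟩
    obtain ⟨x, rfl⟩ := hf y
    exact ⟨(x, c, ε), rfl⟩
  · rintro _ rfl
    rfl
  · rintro ⟨x, c, ε⟩ rfl ⟨x', c', ε'⟩ hx' he
    obtain rfl : x' = x := hx'
    exact Prod.ext rfl (congrArg (fun d : (A.map f).graph.D => d.2) he)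
  · rintro ⟨y, c, ε⟩ hy
    obtain rfl : y = f x := hy
    exact ⟨(x, c, ε), rfl, rfl⟩

theorem sameCycle_rotation_dart_one (hord : A.SimpleCompatible αr αc) (x : G) (c c' : A.skel) :
    (A.rotation αr αc).SameCycle (A.dart x c 1) (A.dart x c' 1) := by
  obtain ⟨i, rfl⟩ := hord.compatible.exists_pow_eq' Set.finite_univ (Set.mem_univ c)
    (Set.mem_univ c')
  refine ⟨2 * i, ?_⟩
  have hsemi : Function.Semiconj (fun c => A.dart x c 1) ⇑(αc * αr)
      ⇑(A.rotation αr αc ^ (2 : ℤ)) := fun c => rfl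
  rw [zpow_mul, ← semiconj_zpow hsemi, zpow_natCast]

theorem isMapCovering_graphProj (f : G →+ H) (hf : Function.Surjective f) (hA : A.IsRegular s k)
    (hB : (A.map f).IsRegular s k) (hord : (A.map f).SimpleCompatible αr αc) :
    (A.graphProj f).IsMapCovering (A.rotation αr αc) ((A.map f).rotation αr αc) where
  isCovering := isCovering_graphProj f hf
  rotation := by
    rintro ⟨x, c, ε⟩
    rcases Int.units_eq_one_or ε with rfl | rfl <;> rfl
  len_eq d := by
    rw [len_facePerm hB hord, len_facePerm hA (.of_map f hord)]
    rfl

theorem isRotation (hord : A.SimpleCompatible αr αc) :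
    Multigraph.IsRotation (A.rotation αr αc) := by
  have hone (d : A.graph.D) :
      ∃ c, (A.rotation αr αc).SameCycle d (A.dart (A.graph.tail d) c 1) := by
    obtain ⟨x, c, ε, rfl⟩ := exists_dart_eq d
    rcases Int.units_eq_one_or ε with rfl | rfl
    · exact ⟨c, Equiv.Perm.SameCycle.refl _ _⟩
    · exact ⟨αc c, 1, rotation_dart_neg_one x c⟩
  refine fun d d' => ⟨Multigraph.tail_eq_of_sameCycle tail_rotation, fun h => ?_⟩
  obtain ⟨c, hc⟩ := hone d
  obtain ⟨c', hc'⟩ := hone d'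
  exact (hc.trans (h ▸ sameCycle_rotation_dart_one hord _ c c')).trans hc'.symm

variable [Finite G]

theorem facePerm_zpow_apply_eq_self (hA : A.IsRegular s k) (hord : A.SimpleCompatible αr αc)
    (d : A.graph.D) (i : ℤ)
    (h : A.graph.tail (((A.rotation αr αc * A.graph.revPerm) ^ i) d) = A.graph.tail d) :
    ((A.rotation αr αc * A.graph.revPerm) ^ i) d = d := by
  obtain ⟨j, hj, hij, -⟩ := Multigraph.exists_lt_len
    (φ := A.rotation αr αc * A.graph.revPerm) d i
  obtain ⟨x, c, ε, rfl⟩ := exists_dart_eq d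
  rw [hij, zpow_natCast] at h ⊢
  rw [len_facePerm_dart hA hord] at hj
  rw [facePerm_pow_dart] at h
  rw [eq_zero_of_partialSum_ordering_eq_zero hA hord hj
    ((units_zsmul_eq_zero_iff ε _).1 (add_eq_left.1 h)), pow_zero, Equiv.Perm.one_apply]

theorem isColouredMap (hA : A.IsRegular s k) (hord : A.SimpleCompatible αr αc) :
    Multigraph.IsColouredMap (A.rotation αr αc) A.sign where
  rotation := isRotation hord
  sgn_rev _ := rfl
  sgn_rotation := sign_rotation
  head_ne_tail := head_ne_tail hA.entry_ne_zero
  simple := facePerm_zpow_apply_eq_self hA hord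
  tail_surjective x := hA.nonempty.elim fun c => ⟨A.dart x c 1, rfl⟩
  connected := hA.connected

theorem cycles_eq_image_walkEdges (αr αc : Perm A.skel) :
    A.cycles αc = Multigraph.walkEdges (A.rotation αr αc * A.graph.revPerm) ''
      {d | A.sign d = 1} := by
  have hcycle (x : G) (c : A.skel) :
      Multigraph.walkEdges (A.rotation αr αc * A.graph.revPerm) (A.dart x c 1) =
        {d | ∃ j : ℕ, d = (x + A.partialSum αc c j, (αc ^ j) c, 1) ∨
          d = A.graph.rev (x + A.partialSum αc c j, (αc ^ j) c, 1)} := by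
    rw [Multigraph.walkEdges_eq_setOf_pow]
    simp only [facePerm_pow_dart, ordering, if_pos, Units.val_one, one_smul]
    rfl
  ext C
  constructor
  · rintro ⟨x, c, rfl⟩
    exact ⟨A.dart x c 1, rfl, hcycle x c⟩
  · rintro ⟨⟨x, c, ε⟩, hε, rfl⟩
    obtain rfl : ε = 1 := hε
    exact ⟨x, c, hcycle x c⟩

-- Passing to the mirror image of the map inverts the rotation and exchanges rows and columns.
theorem cycles_inv_eq_image_walkEdges (αr αc : Perm A.skel) :
    A.cycles αr⁻¹ = Multigraph.walkEdges (A.rotation αr αc * A.graph.revPerm) ''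
      {d | A.sign d = -1} := by
  rw [cycles_eq_image_walkEdges αc⁻¹ αr⁻¹, ← rotation_inv]
  simp only [Multigraph.walkEdges_inv_mul_revPerm]
  ext C
  constructor
  · rintro ⟨d, hd, rfl⟩
    exact ⟨A.graph.rev d, congrArg Neg.neg hd, rfl⟩
  · rintro ⟨d, hd, rfl⟩
    exact ⟨A.graph.rev d, neg_eq_iff_eq_neg.2 hd,
      congrArg (Multigraph.walkEdges _) (A.graph.rev_rev d)⟩

theorem isAssociatedBiembedding_embed (hA : A.IsRegular s k) (hord : A.SimpleCompatible αr αc) :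
    A.IsAssociatedBiembedding s k αr αc
      (Multigraph.embed (isColouredMap hA hord).isFacePerm) where
  cellular := Multigraph.isCellularEmbedding_embed (isRotation hord) _
  biembedding := by
    rw [cycles_inv_eq_image_walkEdges αr αc, cycles_eq_image_walkEdges αr αc]
    refine (isColouredMap hA hord).isBiembedding_embed s k (fun d hd => ?_) fun d hd => ?_
    · rw [len_facePerm hA hord, hd, if_neg (by decide)]
    · rw [len_facePerm hA hord, if_pos hd]

theorem exists_isAssociatedBiembedding (hA : A.IsRegular s k) (hord : A.SimpleCompatible αr αc) :
    ∃ (S : Type) (_ : TopologicalSpace S) (σ : A.graph.Realization → S),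
      IsClosedOrientableSurface S ∧ A.IsAssociatedBiembedding s k αr αc σ := by
  have : Nonempty A.graph.V := ⟨(0 : G)⟩
  exact ⟨_, inferInstance, _, (isColouredMap hA hord).isClosedOrientableSurface,
    isAssociatedBiembedding_embed hA hord⟩

theorem exists_lift_isAssociatedBiembedding [Finite H] (f : G →+ H) (hf : Function.Surjective f)
    (hA : A.IsRegular s k) (hB : (A.map f).IsRegular s k)
    (hord : (A.map f).SimpleCompatible αr αc) {S : Type*} [TopologicalSpace S] [T2Space S]
    {σ : (A.map f).graph.Realization → S}
    (hσ : (A.map f).IsAssociatedBiembedding s k αr αc σ) :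
    ∃ (S' : Type) (_ : TopologicalSpace S') (σ' : A.graph.Realization → S') (p : S' → S),
      IsClosedOrientableSurface S' ∧ A.IsAssociatedBiembedding s k αr αc σ' ∧
      IsCoveringMap p ∧ Function.Surjective p ∧ p ∘ σ' = σ ∘ (A.graphProj f).realize := by
  have : Nonempty A.graph.V := ⟨(0 : G)⟩
  have hordA := SimpleCompatible.of_map f hord
  obtain ⟨p, hp⟩ := (isMapCovering_graphProj f hf hA hB hord).exists_isCoveringMap
    (sgn := (A.map f).sign)
    (isColouredMap hA hordA) (isColouredMap hB hord) hσ.cellular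
  exact ⟨_, inferInstance, _, p, (isColouredMap hA hordA).isClosedOrientableSurface,
    isAssociatedBiembedding_embed hA hordA, hp⟩

end PFArray

/-! ### Counting entries of Heffter arrays -/

namespace PFArray

variable {m n : ℕ} {G : Type}

theorem card_skel {k : ℕ} (A : PFArray m n G)
    (h : ∀ j, (A.skel.filter (fun c => c.2 = j)).card = k) : A.skel.card = n * k := by
  rw [Finset.card_eq_sum_card_fiberwise (f := Prod.snd) (t := Finset.univ)
    fun _ _ => Finset.mem_coe.2 (Finset.mem_univ _), Finset.sum_congr rfl fun j _ => h j,
    Finset.sum_const, Finset.card_univ, Fintype.card_fin, smul_eq_mul]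

variable [AddCommGroup G] [DecidableEq G]

/-- The number of occurrences of `x` in the multiset of all `±a_c`. -/
def occurrences (A : PFArray m n G) (x : G) : ℕ :=
  (Finset.univ.filter fun c => A.entry c = x).card +
    (Finset.univ.filter fun c => -A.entry c = x).card

theorem occurrences_pos (A : PFArray m n G) (c : A.skel) : 0 < A.occurrences (A.entry c) := by
  have hc : (Finset.univ.filter fun d => A.entry d = A.entry c).Nonempty :=
    ⟨c, Finset.mem_filter.2 ⟨Finset.mem_univ c, rfl⟩⟩
  exact Nat.add_pos_left hc.card_pos _

theorem sum_occurrences [Fintype G] (A : PFArray m n G) :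
    ∑ x, A.occurrences x = 2 * A.skel.card := by
  simp only [occurrences, Finset.sum_add_distrib, Finset.sum_card_fiberwise_eq_card_filter,
    Finset.mem_univ, Finset.filter_true, Finset.card_univ, Fintype.card_coe, two_mul]

theorem occurrences_map [Fintype G] {H : Type} [AddCommGroup H] [DecidableEq H]
    (A : PFArray m n G) (f : G →+ H) (y : H) :
    (A.map f).occurrences y = ∑ x with f x = y, A.occurrences x := by
  simp only [occurrences, Finset.sum_add_distrib, Finset.sum_card_fiberwise_eq_card_filter,
    Finset.mem_filter_univ, map_neg]
  rfl

theorem card_edges (A : PFArray m n G) (x y : G) :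
    Nat.card {d // A.graph.tail d = x ∧ A.graph.head d = y} = A.occurrences (y - x) := by
  let e : {d // A.graph.tail d = x ∧ A.graph.head d = y} ≃
      {p : A.skel × ℤˣ // (p.2 : ℤ) • A.entry p.1 = y - x} :=
    { toFun d := ⟨d.1.2, by
        obtain ⟨⟨x, c, ε⟩, rfl, rfl⟩ := d
        exact (add_sub_cancel_left x _).symm⟩
      invFun p := ⟨A.dart x p.1.1 p.1.2, rfl, (add_eq_of_eq_sub' p.2 : x + _ = y)⟩
      left_inv d := Subtype.ext (Prod.ext d.2.1.symm rfl)
      right_inv _ := rfl }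
  rw [Nat.card_congr e, Nat.card_eq_fintype_card, Fintype.card_subtype, Finset.card_filter,
    Fintype.sum_prod_type_right, UnitsInt.univ, Finset.sum_pair (by decide)]
  simp only [Units.val_one, Units.val_neg, one_smul, neg_smul, ← Finset.card_filter]
  rfl

end PFArray

section

variable {n k lam t l : ℕ}

theorem order_eq_mul (ht : t ∣ 2 * n * k / lam) :
    order n k lam t = (2 * n * k / (lam * t) + 1) * t := by
  rw [order, ← Nat.div_div_eq_div_mul, add_mul, Nat.div_mul_cancel ht, one_mul]

theorem order_div (ht : t ∣ 2 * n * k / lam) (h0 : 0 < t) :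
    order n k lam t / t = 2 * n * k / (lam * t) + 1 := by
  rw [order_eq_mul ht, Nat.mul_div_cancel _ h0]

theorem order_eq_order_mul (ht : t ∣ 2 * n * k / lam) (hl : l ∣ t) :
    order n k lam t = order n k (lam * l) (t / l) * l := by
  rw [order, order, ← Nat.div_div_eq_div_mul, add_mul, Nat.div_mul_cancel (hl.trans ht),
    Nat.div_mul_cancel hl]

theorem div_dvd_div_mul (ht : t ∣ 2 * n * k / lam) (hl : l ∣ t) :
    t / l ∣ 2 * n * k / (lam * l) := by
  rw [← Nat.div_div_eq_div_mul]
  exact Nat.div_dvd_div hl ht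

theorem proj_surjective (ht : t ∣ 2 * n * k / lam) (hl : l ∣ t) :
    Function.Surjective (proj ht hl) :=
  ZMod.castHom_surjective (order_dvd ht hl)

theorem card_filter_proj_eq (ht : t ∣ 2 * n * k / lam) (hl : l ∣ t) (h0 : 0 < t)
    [NeZero (order n k lam t)] (y : ZMod (order n k (lam * l) (t / l))) :
    (Finset.univ.filter fun x => proj ht hl x = y).card = l := by
  have hpos : 0 < order n k (lam * l) (t / l) :=
    Nat.add_pos_right _ (Nat.div_pos (Nat.le_of_dvd h0 hl) (Nat.pos_of_dvd_of_pos hl h0))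
  have : NeZero (order n k (lam * l) (t / l)) := ⟨hpos.ne'⟩
  rw [card_filter_map_eq _ (proj_surjective ht hl), ZMod.card, ZMod.card,
    Nat.div_eq_of_eq_mul_right hpos (order_eq_order_mul ht hl)]

/-- The reduction of `ℤ_v` modulo the index of its subgroup of order `t`, which is the number of
parts of the multigraph of a Heffter array. -/
def reduce (ht : t ∣ 2 * n * k / lam) :
    ZMod (order n k lam t) →+* ZMod (2 * n * k / (lam * t) + 1) :=
  ZMod.castHom (Dvd.intro t (order_eq_mul ht).symm) _

theorem mem_zmultiples_order_div_iff (ht : t ∣ 2 * n * k / lam) (h0 : 0 < t)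
    (x : ZMod (order n k lam t)) :
    x ∈ AddSubgroup.zmultiples ((order n k lam t / t : ℕ) : ZMod (order n k lam t)) ↔
      reduce ht x = 0 := by
  rw [order_div ht h0]
  exact mem_zmultiples_iff_castHom_eq_zero _ x

theorem card_filter_reduce_eq (ht : t ∣ 2 * n * k / lam) [NeZero (order n k lam t)]
    (y : ZMod (2 * n * k / (lam * t) + 1)) :
    (Finset.univ.filter fun x => reduce ht x = y).card = t := by
  have hcard := card_filter_map_eq (reduce ht).toAddMonoidHom (ZMod.ringHom_surjective _) y
  rw [ZMod.card, ZMod.card,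
    Nat.div_eq_of_eq_mul_right (Nat.succ_pos _) (order_eq_mul ht)] at hcard
  exact hcard

theorem proj_mem_zmultiples (ht : t ∣ 2 * n * k / lam) (hl : l ∣ t) (h0 : 0 < t)
    {x : ZMod (order n k lam t)}
    (hx : x ∈ AddSubgroup.zmultiples ((order n k lam t / t : ℕ) : ZMod (order n k lam t))) :
    proj ht hl x ∈ AddSubgroup.zmultiples
      ((order n k (lam * l) (t / l) / (t / l) : ℕ) : ZMod (order n k (lam * l) (t / l))) := by
  obtain ⟨i, rfl⟩ := hx
  refine ⟨i, ?_⟩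
  dsimp only
  rw [map_zsmul, order_div ht h0, order_div (div_dvd_div_mul ht hl)
    (Nat.div_pos (Nat.le_of_dvd h0 hl) (Nat.pos_of_dvd_of_pos hl h0)), mul_assoc lam,
    Nat.mul_div_cancel' hl]
  exact congrArg _ (map_natCast (ZMod.castHom (order_dvd ht hl) _) _).symm

end

namespace IsHeffterArray

variable {m n s k lam t : ℕ} {A : PFArray m n (ZMod (order n k lam t))}

theorem neZero_order (hA : IsHeffterArray lam t s k A) : NeZero (order n k lam t) :=
  ⟨(Nat.add_pos_right _ hA.t_pos).ne'⟩

theorem parts_pos (hA : IsHeffterArray lam t s k A) : 0 < 2 * n * k / (lam * t) := by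
  have hpos : 0 < 2 * n * k := Nat.mul_pos (Nat.mul_pos two_pos hA.n_pos) hA.k_pos
  rw [← Nat.div_div_eq_div_mul]
  exact Nat.div_pos (Nat.le_of_dvd (Nat.div_pos (Nat.le_of_dvd hpos hA.lam_dvd) hA.lam_pos)
    hA.t_dvd) hA.t_pos

theorem occurrences_of_reduce_ne_zero (hA : IsHeffterArray lam t s k A)
    {x : ZMod (order n k lam t)} (hx : reduce hA.t_dvd x ≠ 0) : A.occurrences x = lam :=
  hA.count x (mt (mem_zmultiples_order_div_iff hA.t_dvd hA.t_pos x).1 hx)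

-- The elements outside the subgroup already account for all `2nk` entries `±a_c`.
theorem occurrences_of_reduce_eq_zero (hA : IsHeffterArray lam t s k A)
    {x : ZMod (order n k lam t)} (hx : reduce hA.t_dvd x = 0) : A.occurrences x = 0 := by
  have := hA.neZero_order
  have hcard : (Finset.univ.filter fun x => ¬reduce hA.t_dvd x = 0).card = 2 * n * k / lam := by
    have h := Finset.card_filter_add_card_filter_not (s := Finset.univ)
      fun x => reduce hA.t_dvd x = 0
    rw [card_filter_reduce_eq, Finset.card_univ, ZMod.card, add_comm] at h
    exact Nat.add_right_cancel h
  have hne : ∑ x with ¬reduce hA.t_dvd x = 0, A.occurrences x = 2 * (n * k) := by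
    rw [Finset.sum_congr rfl fun x hx => hA.occurrences_of_reduce_ne_zero
      (Finset.mem_filter.1 hx).2, Finset.sum_const, hcard, smul_eq_mul,
      Nat.div_mul_cancel hA.lam_dvd, mul_assoc]
  have hsum := A.sum_occurrences
  rw [A.card_skel hA.col_card, ← Finset.sum_filter_add_sum_filter_not _
    fun x => reduce hA.t_dvd x = 0, hne, Nat.add_eq_right] at hsum
  exact Finset.sum_eq_zero_iff.1 hsum x (Finset.mem_filter.2 ⟨Finset.mem_univ x, hx⟩)

theorem isCompleteMultipartite (hA : IsHeffterArray lam t s k A) :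
    A.graph.IsCompleteMultipartite lam (2 * n * k / (lam * t) + 1) t := by
  have := hA.neZero_order
  have hsub (x y : ZMod (order n k lam t)) :
      reduce hA.t_dvd x = reduce hA.t_dvd y ↔ reduce hA.t_dvd (y - x) = 0 := by
    rw [map_sub, sub_eq_zero, eq_comm]
  have hpart (i : ZMod (2 * n * k / (lam * t) + 1)) :
      Nat.card {x // reduce hA.t_dvd x = i} = t := by
    rw [Nat.card_eq_fintype_card, Fintype.card_subtype, card_filter_reduce_eq]
  refine ⟨reduce hA.t_dvd, hpart, fun x y => ⟨fun h => ?_, fun h => ?_⟩⟩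
  · have hcard := (A.card_edges x y).trans (hA.occurrences_of_reduce_eq_zero ((hsub x y).1 h))
    exact (Nat.card_eq_zero.1 hcard).resolve_right (not_infinite_iff_finite.2 Subtype.finite)
  · exact (A.card_edges x y).trans (hA.occurrences_of_reduce_ne_zero (mt (hsub x y).2 h))

theorem entry_ne_zero (hA : IsHeffterArray lam t s k A) (c : A.skel) : A.entry c ≠ 0 := by
  intro h
  have hpos := A.occurrences_pos c
  rw [hA.occurrences_of_reduce_eq_zero (h ▸ map_zero _)] at hpos
  exact hpos.false

theorem nonempty_skel (hA : IsHeffterArray lam t s k A) : Nonempty A.skel := by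
  have hpos : 0 < A.skel.card := A.card_skel hA.col_card ▸ Nat.mul_pos hA.n_pos hA.k_pos
  exact (Finset.card_pos.1 hpos).to_subtype

theorem exists_edge (hA : IsHeffterArray lam t s k A) {x y : ZMod (order n k lam t)}
    (h : reduce hA.t_dvd x ≠ reduce hA.t_dvd y) :
    ∃ d, A.graph.tail d = x ∧ A.graph.head d = y := by
  have hcard := (A.card_edges x y).trans <| hA.occurrences_of_reduce_ne_zero <| by
    rw [map_sub]
    exact sub_ne_zero.2 h.symm
  have : Nonempty {d // A.graph.tail d = x ∧ A.graph.head d = y} :=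
    (Nat.card_pos_iff.1 (hA.lam_pos.trans_eq hcard.symm)).1
  exact nonempty_subtype.1 this

theorem reflTransGen_edge (hA : IsHeffterArray lam t s k A) (x y : ZMod (order n k lam t)) :
    Relation.ReflTransGen (fun x y => ∃ d, A.graph.tail d = x ∧ A.graph.head d = y) x y := by
  by_cases h : reduce hA.t_dvd x = reduce hA.t_dvd y
  · have : Nontrivial (ZMod (2 * n * k / (lam * t) + 1)) :=
      ZMod.nontrivial_iff.2 (Nat.succ_ne_succ_iff.2 hA.parts_pos.ne')
    have hne : reduce hA.t_dvd x ≠ reduce hA.t_dvd (x + 1) := by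
      rw [map_add, map_one]
      exact fun h => one_ne_zero (left_eq_add.1 h)
    exact .tail (.single (hA.exists_edge hne)) (hA.exists_edge (h ▸ hne.symm))
  · exact .single (hA.exists_edge h)

theorem isRegular (hA : IsHeffterArray lam t s k A) : A.IsRegular s k where
  row_card := hA.row_card
  col_card := hA.col_card
  row_sum := hA.row_sum
  col_sum := hA.col_sum
  entry_ne_zero := hA.entry_ne_zero
  nonempty := hA.nonempty_skel
  connected := hA.reflTransGen_edge

theorem isHeffterArray_projection (hA : IsHeffterArray lam t s k A) {l : ℕ} (hl : l ∣ t) :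
    IsHeffterArray (lam * l) (t / l) s k (hA.projection hl) where
  n_pos := hA.n_pos
  k_pos := hA.k_pos
  lam_pos := Nat.mul_pos hA.lam_pos (Nat.pos_of_dvd_of_pos hl hA.t_pos)
  t_pos := Nat.div_pos (Nat.le_of_dvd hA.t_pos hl) (Nat.pos_of_dvd_of_pos hl hA.t_pos)
  lam_dvd := (Nat.dvd_div_iff_mul_dvd hA.lam_dvd).1 (hl.trans hA.t_dvd)
  t_dvd := div_dvd_div_mul hA.t_dvd hl
  row_card := hA.row_card
  col_card := hA.col_card
  count y hy := by
    have := hA.neZero_order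
    have hfibre (x) (hx : proj hA.t_dvd hl x = y) : A.occurrences x = lam :=
      hA.count x fun h => hy (hx ▸ proj_mem_zmultiples hA.t_dvd hl hA.t_pos h)
    refine (A.occurrences_map (proj hA.t_dvd hl) y).trans ?_
    rw [Finset.sum_congr rfl fun x hx => hfibre x (Finset.mem_filter.1 hx).2, Finset.sum_const,
      card_filter_proj_eq hA.t_dvd hl hA.t_pos, smul_eq_mul, mul_comm]
  row_sum i := (map_sum _ _ _).symm.trans ((congrArg _ (hA.row_sum i)).trans (map_zero _))
  col_sum j := (map_sum _ _ _).symm.trans ((congrArg _ (hA.col_sum j)).trans (map_zero _))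

end IsHeffterArray

end

end Heffter

theorem mainTheorem7 {m n s k α t lam : ℕ}
    (A : Heffter.PFArray m n (ZMod (Heffter.order n k α t)))
    (hA : Heffter.IsHeffterArray α t s k A) (hlam : lam ∣ t)
    (αr αc : Equiv.Perm (hA.projection hlam).skel)
    (hord : (hA.projection hlam).SimpleCompatible αr αc) :
    Heffter.IsHeffterArray (α * lam) (t / lam) s k (hA.projection hlam) ∧
    A.graph.IsCompleteMultipartite α (2 * n * k / (α * t) + 1) t ∧
    (hA.projection hlam).graph.IsCompleteMultipartite (α * lam) (2 * n * k / (α * t) + 1)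
      (t / lam) ∧
    (hA.graphProjection hlam).IsCovering ∧
    (∃ (S : Type) (_ : TopologicalSpace S) (σ : (hA.projection hlam).graph.Realization → S),
      Heffter.IsClosedOrientableSurface S ∧
      (hA.projection hlam).IsAssociatedBiembedding s k αr αc σ) ∧
    ∀ (S : Type*) [TopologicalSpace S] (σ : (hA.projection hlam).graph.Realization → S),
      Heffter.IsClosedOrientableSurface S →
      (hA.projection hlam).IsAssociatedBiembedding s k αr αc σ →
      ∃ (S' : Type) (_ : TopologicalSpace S') (σ' : A.graph.Realization → S') (p : S' → S),
        Heffter.IsClosedOrientableSurface S' ∧ A.IsAssociatedBiembedding s k αr αc σ' ∧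
        IsCoveringMap p ∧ Function.Surjective p ∧
        p ∘ σ' = σ ∘ (hA.graphProjection hlam).realize := by
  have hB := hA.isHeffterArray_projection hlam
  have hsurj := Heffter.proj_surjective hA.t_dvd hlam
  have := hA.neZero_order
  have := hB.neZero_order
  refine ⟨hB, hA.isCompleteMultipartite, ?_, Heffter.PFArray.isCovering_graphProj _ hsurj,
    Heffter.PFArray.exists_isAssociatedBiembedding hB.isRegular hord, fun S _ σ hS hσ => ?_⟩
  · have h := hB.isCompleteMultipartite
    rwa [mul_assoc α, Nat.mul_div_cancel' hlam] at h
  · have := hS.t2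
    exact Heffter.PFArray.exists_lift_isAssociatedBiembedding _ hsurj hA.isRegular hB.isRegular
      hord hσ
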